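/- **Setting.** Everything is smooth and real. A *Cayley structure* on a 4-manifold $M$ is a field of cones $\widehat{\mathcal C}_x\subset T_xM$ such that near each point there is a smooth coframe $(\omega^0,\omega^1,\omega^2,\omega^3)$ (called *adapted*) with $$\widehat{\mathcal C}_x=\{\rho=0\},\qquad \rho=\tfrac13(\omega^2)^3+\omega^0\omega^3\omega^3-\omega^1\omega^2\omega^3 .$$ The *ruling planes* of $\widehat{\mathcal C}_x$ are the planes $\Pi_u=\ker\{\omega^0+u\,\omega^1-\tfrac13u^3\omega^3,\ \omega^2+u\,\omega^3\}\subset T_xM$, $u\in\mathbb R$; they form a 5-manifold $J$ with local coordinates $(x,u)$. Let $\mathcal C$ be the 6-manifold of null directions off the singular plane $\ker\{\omega^2,\omega^3\}$; it has local coordinates $(x,u,v)$, representing the direction at $x$ spanned by the vector $y(u,v)$ with $(\omega^0,\omega^1,\omega^2,\omega^3)(y)=(\tfrac13u^3-uv,\,v,\,-u,\,1)$. On $\mathcal C$ there is the 1-form $\alpha=d\rho|_{y(u,v)}$ (the derivative of $\rho$ along the fibre, pulled back from $M$), defined up to a nonvanishing factor. The *characteristic curves* are the curves in $\mathcal C$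 tangent to the line field of vectors $\ell$ with $\alpha(\ell)=0$ and $d\alpha(\ell,\cdot)|_{\ker\alpha}=0$. The Cayley structure is *half-flat* if there is a three-parameter family of connected immersed surfaces in $M$, all of whose tangent planes are ruling planes, such that along each ruling plane at each point of $M$ there passes exactly one member of the family. "Three-parameter" means that the lifts of the members to $J$ form a smooth foliation of $J$ by surfaces: $J$ has local coordinates $(t,s)\in\mathbb R^3\times\mathbb R^2$ in which each slice $t=\mathrm{const}$ is part of the lift of a member. A *2D path geometry* on a 3-manifold is a pair of line fields $\ell_1,\ell_2$ such that locally there is a coframe $(\eta^0,\eta,\zeta)$ with $\ell_1=\{\eta,\zeta\}^\perp$, $\ell_2=\{\eta,\eta^0\}^\perp$ and $d\eta\equiv-\eta^0\wedge\zeta$ modulo $\eta$. **Proposition.** Let $M$ carry a half-flat Cayley structure with such a family, let $S$ be a member of the family, and let $\hat S\subset\mathcal C$ be the 3-manifold of pairs (point of $S$, direction in its tangent plane other than the singular one), parametrized by a point $s\in S$ and $v\in\mathbb R$. Then: 1. The parameter $u$ of the tangent plane of $S$, relative to any adapted coframe, is a smooth function on $S$; and the characteristic directions tangent to $\hat S$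 form a line field $\ell_1$ on $\hat S$ which, together with the line field $\ell_2$ tangent to the fibres of $\hat S\to S$, is a 2D path geometry. 2. This path geometry is induced by a projectively flat connection: on the domain of each chart of $S$ there is a smooth torsion-free affine connection $\nabla$ such that, for every adapted coframe used to compute the characteristic curves, a smooth regular curve in $S$ is the projection of a characteristic curve lying in $\hat S$ if and only if it is an unparametrized geodesic of $\nabla$ and is nowhere tangent to the singular plane $\ker\{\omega^2,\omega^3\}$; and $\nabla$ is projectively flat, i.e. around each point there are coordinates on $S$ in which the unparametrized geodesics of $\nabla$ are exactly the straight lines. -/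

import Mathlib

open Set Filter Topology
open scoped Manifold ContDiff

universe u

/-- The coordinate spaces `ℝ²`, `ℝ³`, `ℝ⁴`. -/
abbrev E2 : Type := EuclideanSpace ℝ (Fin 2)

abbrev E3 : Type := EuclideanSpace ℝ (Fin 3)

abbrev E4 : Type := EuclideanSpace ℝ (Fin 4)

/-! ### Exterior derivative of 1-forms, path geometries on 3-manifolds -/

section Forms

variable {V : Type*} [NormedAddCommGroup V] [NormedSpace ℝ V]

/-- The value `dα(ξ, η)` at `x` of the exterior derivative of a 1-form `α`. -/
noncomputable def dForm (α : V → V →L[ℝ] ℝ) (x ξ η : V) : ℝ :=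
  extDeriv (fun y => ContinuousAlternatingMap.ofSubsingleton ℝ V ℝ (0 : Fin 1) (α y)) x ![ξ, η]

lemma dForm_add_left (α : V → V →L[ℝ] ℝ) (x ξ ξ' η : V) :
    dForm α x (ξ + ξ') η = dForm α x ξ η + dForm α x ξ' η := by
  unfold dForm
  have H := (extDeriv (fun y => ContinuousAlternatingMap.ofSubsingleton ℝ V ℝ (0 : Fin 1)
    (α y)) x).map_update_add ![ξ, η] 0 ξ ξ'
  have e (z : V) : Function.update ![ξ, η] 0 z = ![z, η] := by
    ext i; fin_cases i <;> rfl
  rwa [e, e, e] at H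

lemma dForm_smul_left (α : V → V →L[ℝ] ℝ) (x : V) (c : ℝ) (ξ η : V) :
    dForm α x (c • ξ) η = c * dForm α x ξ η := by
  unfold dForm
  have H := (extDeriv (fun y => ContinuousAlternatingMap.ofSubsingleton ℝ V ℝ (0 : Fin 1)
    (α y)) x).map_update_smul ![ξ, η] 0 c ξ
  have e (z : V) : Function.update ![ξ, η] 0 z = ![z, η] := by
    ext i; fin_cases i <;> rfl
  rwa [e, e] at H

/-- The degenerate directions at `x` of the (quasi-contact) 1-form `α`: the vectors `ξ ∈ ker α`
such that `ξ ⌟ dα` vanishes on `ker α`. -/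
noncomputable def characteristicSpace (α : V → V →L[ℝ] ℝ) (x : V) : Submodule ℝ V where
  carrier := {ξ | α x ξ = 0 ∧ ∀ η, α x η = 0 → dForm α x ξ η = 0}
  zero_mem' := by
    refine ⟨by simp, fun η _ => ?_⟩
    simpa using dForm_smul_left α x 0 0 η
  add_mem' := by
    rintro a b ⟨ha, ha'⟩ ⟨hb, hb'⟩
    refine ⟨by simp [ha, hb], fun η hη => ?_⟩
    rw [dForm_add_left, ha' η hη, hb' η hη, add_zero]
  smul_mem' := by
    rintro c a ⟨ha, ha'⟩
    refine ⟨by simp [ha], fun η hη => ?_⟩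
    rw [dForm_smul_left, ha' η hη, mul_zero]

/-- A 2D path geometry `(W, ℓ₁, ℓ₂)` on an open subset `W` of a 3-dimensional vector space `V`:
two line fields such that locally there is a coframe `(η⁰, η, ζ)` with `ℓ₁ = {η, ζ}^⊥`,
`ℓ₂ = {η, η⁰}^⊥` and `dη ≡ -η⁰ ∧ ζ` modulo `η`. -/
def IsPathGeometry (W : Set V) (ℓ₁ ℓ₂ : V → Submodule ℝ V) : Prop :=
  ∀ x ∈ W, ∃ U : Set V, IsOpen U ∧ x ∈ U ∧ U ⊆ W ∧ ∃ η₀ η ζ : V → V →L[ℝ] ℝ,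
    ContDiffOn ℝ ∞ η₀ U ∧ ContDiffOn ℝ ∞ η U ∧ ContDiffOn ℝ ∞ ζ U ∧
    ∀ y ∈ U,
      Function.Bijective (fun ξ : V => ![η₀ y ξ, η y ξ, ζ y ξ]) ∧
      (∀ ξ, ξ ∈ ℓ₁ y ↔ η y ξ = 0 ∧ ζ y ξ = 0) ∧
      (∀ ξ, ξ ∈ ℓ₂ y ↔ η y ξ = 0 ∧ η₀ y ξ = 0) ∧
      ∀ ξ ξ', η y ξ = 0 → η y ξ' = 0 →
        dForm η y ξ ξ' = -(η₀ y ξ * ζ y ξ' - η₀ y ξ' * ζ y ξ)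

end Forms

/-! ### Unparametrized geodesics and projective flatness on surfaces -/

/-- `c` restricts to a smooth regular curve `I → Ω` on the open set of times `I`. -/
def IsRegularCurve (Ω : Set E2) (I : Set ℝ) (c : ℝ → E2) : Prop :=
  IsOpen I ∧ ContDiffOn ℝ ∞ c I ∧ ∀ τ ∈ I, c τ ∈ Ω ∧ deriv c τ ≠ 0

/-- The curve `c` is, up to parametrization, a geodesic of the connection with Christoffel symbols
`Γ`: the covariant acceleration is proportional to the velocity. -/
def IsUnparamGeodesic (Γ : E2 → E2 →L[ℝ] E2 →L[ℝ] E2) (I : Set ℝ) (c : ℝ → E2) : Prop :=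
  ∀ τ ∈ I, ∃ k : ℝ, deriv (deriv c) τ + Γ (c τ) (deriv c τ) (deriv c τ) = k • deriv c τ

/-- `Γ` gives the Christoffel symbols of a smooth torsion-free affine connection on `Ω ⊆ ℝ²`. -/
def IsTorsionFreeConnection (Ω : Set E2) (Γ : E2 → E2 →L[ℝ] E2 →L[ℝ] E2) : Prop :=
  ContDiffOn ℝ ∞ Γ Ω ∧ ∀ s ∈ Ω, ∀ w w', Γ s w w' = Γ s w' w

/-- The connection `Γ` on `Ω` is projectively flat: around each point there are coordinates in which
its unparametrized geodesics are the straight lines, i.e. the unparametrized geodesics of the flat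
connection with vanishing Christoffel symbols. -/
def IsProjectivelyFlat (Ω : Set E2) (Γ : E2 → E2 →L[ℝ] E2 →L[ℝ] E2) : Prop :=
  ∀ s ∈ Ω, ∃ ψ : OpenPartialHomeomorph E2 E2, s ∈ ψ.source ∧ ψ.source ⊆ Ω ∧
    ContDiffOn ℝ ∞ ψ ψ.source ∧ ContDiffOn ℝ ∞ ψ.symm ψ.target ∧
    ∀ (I : Set ℝ) (c : ℝ → E2), IsRegularCurve ψ.source I c →
      (IsUnparamGeodesic Γ I c ↔ IsUnparamGeodesic (fun _ => 0) I (ψ ∘ c))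

/-! ### The ruled Cayley cubic -/

/-- The cubic form `⅓ (y²)³ + y⁰ y³ y³ - y¹ y² y³` defining the ruled Cayley cubic. -/
noncomputable def cayleyCubic (y : Fin 4 → ℝ) : ℝ :=
  1 / 3 * y 2 ^ 3 + y 0 * y 3 * y 3 - y 1 * y 2 * y 3

/-- The point `v γ₁(u) + γ₂(u)` of the cone, where `γ₁(u) = ∂₁ - u ∂₀` and
`γ₂(u) = ∂₃ - u ∂₂ + ⅓ u³ ∂₀`.  Up to scale these are the points of the cone off the singular plane
`{y² = y³ = 0}`. -/
noncomputable def nullVector (u v : ℝ) : Fin 4 → ℝ := ![u ^ 3 / 3 - u * v, v, -u, 1]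

/-- Membership in the ruling plane `Ker{ω⁰ + u ω¹ - ⅓ u³ ω³, ω² + u ω³}` of the cone. -/
def InRulingPlane (u : ℝ) (y : Fin 4 → ℝ) : Prop :=
  y 0 + u * y 1 - u ^ 3 / 3 * y 3 = 0 ∧ y 2 + u * y 3 = 0

/-! ### Cayley structures -/

section Cayley

variable {M : Type u} [TopologicalSpace M] [ChartedSpace E4 M]

/-- `(e, θ)` is an adapted coframe for the field of cones `cone`: `e` is a chart of `M`, `θ` is the
coordinate expression in this chart of a smooth coframe `(ω⁰, ω¹, ω², ω³)`, and the cones are the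
zero sets of the cubic form `⅓ (ω²)³ + ω⁰ ω³ ω³ - ω¹ ω² ω³`. -/
def IsAdaptedCoframe (cone : (x : M) → Set (TangentSpace (𝓡 4) x))
    (e : OpenPartialHomeomorph M E4) (θ : E4 → E4 →L[ℝ] (Fin 4 → ℝ)) : Prop :=
  e ∈ IsManifold.maximalAtlas (𝓡 4) ∞ M ∧
  ContDiffOn ℝ ∞ θ e.target ∧
  (∀ p ∈ e.target, Function.Bijective (θ p)) ∧
  ∀ x ∈ e.source, cone x = {y | cayleyCubic (θ (e x) (mfderiv (𝓡 4) (𝓡 4) e x y)) = 0}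

variable (M) in
/-- A Cayley structure: a field of cones over the ruled Cayley cubic, given near each point as the
zero set of the Cayley cubic form of a smooth coframe. -/
structure CayleyStructure where
  cone : (x : M) → Set (TangentSpace (𝓡 4) x)
  exists_adapted : ∀ x : M, ∃ e θ, IsAdaptedCoframe cone e θ ∧ x ∈ e.source

/-- The plane `P ⊆ T_x M` is a ruling plane of the cone at `x`: in some coframe at `x` adapted to
the cone it has the equation of `InRulingPlane u` for some real `u`. -/
def CayleyStructure.IsRulingPlane (C : CayleyStructure M) (x : M)
    (P : Submodule ℝ (TangentSpace (𝓡 4) x)) : Prop :=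
  ∃ A : TangentSpace (𝓡 4) x ≃L[ℝ] (Fin 4 → ℝ),
    C.cone x = {y | cayleyCubic (A y) = 0} ∧
    ∃ u : ℝ, ∀ y, y ∈ P ↔ InRulingPlane u (A y)

section Surfaces

variable {S : Type u} [TopologicalSpace S] [ChartedSpace E2 S]

/-- The lift of a surface `f : S → M` to the bundle of planes: `s ↦ (f s, T_{f s} f(S))`. -/
noncomputable def tangentLift (f : S → M) (s : S) :
    Σ x : M, Submodule ℝ (TangentSpace (𝓡 4) x) :=
  ⟨f s, LinearMap.range (mfderiv (𝓡 2) (𝓡 4) f s).toLinearMap⟩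

/-- A smooth immersed surface in `M` whose tangent planes are ruling planes. -/
def CayleyStructure.IsNullSurface (C : CayleyStructure M) (f : S → M) : Prop :=
  ContMDiff (𝓡 2) (𝓡 4) ∞ f ∧
  ∀ s, Function.Injective (mfderiv (𝓡 2) (𝓡 4) f s) ∧
    C.IsRulingPlane (f s) (tangentLift f s).2

end Surfaces

/-- The coordinate expression of a surface `f : S → M` in charts `φ` of `S` and `e` of `M`. -/
def surfaceCoord {S : Type u} [TopologicalSpace S] (f : S → M)
    (φ : OpenPartialHomeomorph S E2) (e : OpenPartialHomeomorph M E4) (s : E2) : E4 :=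
  e (f (φ.symm s))

/-- The open set on which `surfaceCoord` is meaningful. -/
def surfaceDomain {S : Type u} [TopologicalSpace S] (f : S → M)
    (φ : OpenPartialHomeomorph S E2) (e : OpenPartialHomeomorph M E4) : Set E2 :=
  {s | s ∈ φ.target ∧ f (φ.symm s) ∈ e.source}

/-- The plane of `T_x M`, `x = e⁻¹(p)`, with parameter `u` relative to the coframe `(e, θ)`. Thus
`(p, u)` are coordinates on the 5-dimensional manifold `J` of ruling planes. -/
noncomputable def rulingPlaneOf (e : OpenPartialHomeomorph M E4)
    (θ : E4 → E4 →L[ℝ] (Fin 4 → ℝ)) (q : E4 × ℝ) :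
    Σ x : M, Set (TangentSpace (𝓡 4) x) :=
  ⟨e.symm q.1, {y | InRulingPlane q.2 (θ q.1 (mfderiv (𝓡 4) (𝓡 4) e (e.symm q.1) y))}⟩

/-- A 3-parameter family of surfaces exhibiting a Cayley structure as half-flat; the Cayley
structure is half-flat if such a family exists.  The members are connected surfaces whose tangent
planes are ruling planes, and along each ruling plane at each point there passes exactly one
member.  The family has three parameters in the sense that its lift is a foliation by surfaces of
the 5-dimensional space `J` of ruling planes, with coordinates `(p, u)`: around each point, `J` has
coordinates `(t, s)` in `ℝ³ × ℝ²` such that, for each fixed `t`, the projection of the slice to `M`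
is tangent to the ruling planes represented by the slice and is part of a member. -/
structure CayleyStructure.HalfFlatFamily (C : CayleyStructure M) where
  ι : Type u
  S : ι → Type u
  [top : ∀ i, TopologicalSpace (S i)]
  [charted : ∀ i, ChartedSpace E2 (S i)]
  [manifold : ∀ i, IsManifold (𝓡 2) ∞ (S i)]
  [connected : ∀ i, ConnectedSpace (S i)]
  f : ∀ i, S i → M
  isNullSurface : ∀ i, C.IsNullSurface (f i)
  existsUnique : ∀ (x : M) (P : Submodule ℝ (TangentSpace (𝓡 4) x)), C.IsRulingPlane x P →
    ∃! i, ∃ s, tangentLift (f i) s = ⟨x, P⟩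
  threeParameter : ∀ e θ, IsAdaptedCoframe C.cone e θ → ∀ p ∈ e.target, ∀ u : ℝ,
    ∃ Ψ : OpenPartialHomeomorph (E4 × ℝ) (E3 × E2),
      (p, u) ∈ Ψ.source ∧ Ψ.source ⊆ e.target ×ˢ univ ∧
      ContDiffOn ℝ ∞ Ψ Ψ.source ∧ ContDiffOn ℝ ∞ Ψ.symm Ψ.target ∧
      (∀ t s, (t, s) ∈ Ψ.target → ∀ y : E4,
        y ∈ range (fderiv ℝ (fun s' => (Ψ.symm (t, s')).1) s) ↔
          InRulingPlane (Ψ.symm (t, s)).2 (θ (Ψ.symm (t, s)).1 y)) ∧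
      ∀ t, ∃ i, ∀ s, (t, s) ∈ Ψ.target → ∃ σ : S i,
        (⟨(tangentLift (f i) σ).1, (tangentLift (f i) σ).2⟩ :
          Σ x : M, Set (TangentSpace (𝓡 4) x)) = rulingPlaneOf e θ (Ψ.symm (t, s))

attribute [instance] CayleyStructure.HalfFlatFamily.top
  CayleyStructure.HalfFlatFamily.charted CayleyStructure.HalfFlatFamily.manifold
  CayleyStructure.HalfFlatFamily.connected

/-- The projective Hilbert form `∂_{y^i} L dx^i` of the bundle of projectivized null cones, in the
coordinates `(p, u, v)` of this 6-dimensional bundle, which represent the null direction at `p`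
spanned by the vector with components `nullVector u v` in the coframe. -/
noncomputable def hilbertForm (θ : E4 → E4 →L[ℝ] (Fin 4 → ℝ)) (q : E4 × ℝ × ℝ) :
    E4 × ℝ × ℝ →L[ℝ] ℝ :=
  ((fderiv ℝ cayleyCubic (nullVector q.2.1 q.2.2)).comp (θ q.1)).comp
    (ContinuousLinearMap.fst ℝ E4 (ℝ × ℝ))

end Cayley

/-! ### The path geometry of a null surface

Here `h` is the coordinate expression of a null surface, and `u s` is the parameter of the ruling
plane tangent to it at `s`. -/

/-- The null directions tangent to the surface, in the coordinates `(p, u, v)`: the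
3-dimensional lift of the surface to the bundle of projectivized null cones. -/
def surfaceLift (h : E2 → E4) (u : E2 → ℝ) (q : E2 × ℝ) : E4 × ℝ × ℝ := (h q.1, u q.1, q.2)

/-- The line field `ℓ₁` on the lifted surface: the characteristic directions tangent to it. -/
noncomputable def pathLine (θ : E4 → E4 →L[ℝ] (Fin 4 → ℝ)) (h : E2 → E4) (u : E2 → ℝ)
    (q : E2 × ℝ) : Submodule ℝ (E2 × ℝ) :=
  (characteristicSpace (hilbertForm θ) (surfaceLift h u q)).comap
    (fderiv ℝ (surfaceLift h u) q).toLinearMap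

/-- The line field `ℓ₂` on the lifted surface: the directions of the fibres over the surface. -/
def fibreLine (_q : E2 × ℝ) : Submodule ℝ (E2 × ℝ) :=
  LinearMap.ker (LinearMap.fst ℝ E2 ℝ)

/-- `u` is the smooth function on `Ω` such that the tangent plane of the surface `h` at `s` is the
ruling plane with parameter `u s` relative to the coframe `θ`. -/
def IsRulingParameter (θ : E4 → E4 →L[ℝ] (Fin 4 → ℝ)) (h : E2 → E4) (Ω : Set E2) (u : E2 → ℝ) :
    Prop :=
  ContDiffOn ℝ ∞ u Ω ∧
  ∀ s ∈ Ω, ∀ y : E4, y ∈ range (fderiv ℝ h s) ↔ InRulingPlane (u s) (θ (h s) y)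

/-- `c` is (on `I`) a path: the projection to the surface of a characteristic curve contained in
the lifted surface. -/
def IsPath (θ : E4 → E4 →L[ℝ] (Fin 4 → ℝ)) (h : E2 → E4) (u : E2 → ℝ) (I : Set ℝ)
    (c : ℝ → E2) : Prop :=
  ∃ v : ℝ → ℝ, ContDiffOn ℝ ∞ v I ∧
    ∀ τ ∈ I, deriv (fun σ => (c σ, v σ)) τ ∈ pathLine θ h u (c τ, v τ)

/-- The curve `c` in the surface is nowhere tangent to the plane field `Ker{ω², ω³}` of singular
directions of the cones. -/
def IsNowhereSingular (θ : E4 → E4 →L[ℝ] (Fin 4 → ℝ)) (h : E2 → E4) (I : Set ℝ)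
    (c : ℝ → E2) : Prop :=
  ∀ τ ∈ I, ¬ (θ (h (c τ)) (fderiv ℝ h (c τ) (deriv c τ)) 2 = 0 ∧
    θ (h (c τ)) (fderiv ℝ h (c τ) (deriv c τ)) 3 = 0)

/-!
The lifts of the members are the fibres of a submersion `T`, defined locally on the 5-dimensional
space of ruling planes with coordinates `(p, u)`, to a 3-dimensional *twistor space*. The members
through the point `h s` of a given surface `h` form a curve in the twistor space, whose velocity at
`h` itself is `g s = ∂_u T (h s, u s)`. So each surface comes with a map `s ↦ [g s]` to the
projective plane of directions in one fixed tangent space of the twistor space. The theorem holds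
because this map is a local diffeomorphism which sends the paths to straight lines.

* Both equations of the ruling planes are pulled back from the twistor space: with covectors `a`
  and `b`, one has `a ∘ dT = ω⁰ + u ω¹ - ⅓ u³ ω³` and `b ∘ dT = ω² + u ω³`
  (`IsTwistorMap.exists_covectors`).
* The lift of the surface is tangent to the fibres of `T`
  (`IsTwistorPatch.fderiv_comp_rulingLift_eq_zero`): it is an integral surface of a rank 3
  distribution whose only integral surfaces transversal to `∂_u` are these fibres. Consequently,
  along the surface, `a(dg) = ω¹ - u² ω³` and `b(dg) = ω³`, while `a(g) = b(g) = 0`, so that `[g]`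
  is an immersion (`IsTwistorPatch.twistorVelocity_independent`).
* By `fderiv_cayleyCubic_nullVector`, the 1-form `α = dρ|_y` is the pullback of the covector
  `a + (u² - v) b`, that is, `α` comes from the contact elements of the twistor space. Hence a
  direction in the lifted surface is characteristic exactly if the kernel of this covector is
  constant along it (`IsTwistorPatch.mem_pathLine_iff_covector`). The kernel contains `g` and the
  derivative of `g` in the direction with parameter `v`, so a path is a curve for which `[g]`
  stays on the line given by this kernel.
* The pullback of the flat connection by an affine chart of the projective plane
  (`exists_projective_chart`) therefore induces the paths (`IsTwistorPatch.pathLine_main`). For a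
  connection that induces the paths, the slope `dv/dτ` is an expression in the connection and the
  coframe, from which the path geometry (`isPathGeometry_pathLine`) and the geodesics (`isPath_iff`)
  are read off.
* Automorphisms of the cone act on the ruling planes by affine maps of `u`
  (`inRulingPlane_rulingMap`), so a change of the adapted coframe multiplies `g` by a function and
  the paths do not depend on the coframe (`IsCoframeChange.isPathConnectionAt`).
* Inducing the paths is a convex condition on a connection, so the local flat connections are glued
  by a partition of unity (`exists_global_connection`). The result is projectively equivalent to
  each of them, as connections with the same paths are (`IsPathConnectionAt.exists_smul_add`),
  and is therefore projectively flat.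
-/

/-! ### Planes in the ruled Cayley cubic cone -/

/-- The covector `ω⁰ + u ω¹ - ⅓ u³ ω³`, one of the two equations of the ruling plane `Π_u`. -/
noncomputable def rulingA (u : ℝ) : (Fin 4 → ℝ) →L[ℝ] ℝ :=
  ContinuousLinearMap.proj 0 + u • ContinuousLinearMap.proj 1
    - (u ^ 3 / 3) • ContinuousLinearMap.proj 3

/-- The covector `ω² + u ω³`, the other equation of the ruling plane `Π_u`. -/
noncomputable def rulingB (u : ℝ) : (Fin 4 → ℝ) →L[ℝ] ℝ :=
  ContinuousLinearMap.proj 2 + u • ContinuousLinearMap.proj 3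

lemma rulingA_apply (u : ℝ) (y : Fin 4 → ℝ) : rulingA u y = y 0 + u * y 1 - u ^ 3 / 3 * y 3 := by
  simp [rulingA]

lemma rulingB_apply (u : ℝ) (y : Fin 4 → ℝ) : rulingB u y = y 2 + u * y 3 := by
  simp [rulingB]

lemma inRulingPlane_iff (u : ℝ) (y : Fin 4 → ℝ) :
    InRulingPlane u y ↔ rulingA u y = 0 ∧ rulingB u y = 0 := by
  rw [rulingA_apply, rulingB_apply, InRulingPlane]

lemma InRulingPlane.add_smul {u : ℝ} {x y : Fin 4 → ℝ} (hx : InRulingPlane u x)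
    (hy : InRulingPlane u y) (r s : ℝ) : InRulingPlane u (r • x + s • y) := by
  rw [inRulingPlane_iff] at *
  simp [hx.1, hx.2, hy.1, hy.2]

lemma InRulingPlane.cayleyCubic_eq_zero {u : ℝ} {y : Fin 4 → ℝ} (h : InRulingPlane u y) :
    cayleyCubic y = 0 := by
  obtain ⟨h0, h2⟩ := h
  have e2 : y 2 = -u * y 3 := by linarith
  have e0 : y 0 = -u * y 1 + u ^ 3 / 3 * y 3 := by linarith
  rw [cayleyCubic, e2, e0]; ring

/-- A plane of the cone that contains a vector `k` off the singular plane is the ruling plane with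
parameter `-k² / k³`. -/
lemma inRulingPlane_of_span_subset {k m : Fin 4 → ℝ} (hk : k 3 ≠ 0)
    (h : ∀ r s : ℝ, cayleyCubic (r • k + s • m) = 0) :
    InRulingPlane (-k 2 / k 3) k ∧ InRulingPlane (-k 2 / k 3) m := by
  have hk0 : cayleyCubic k = 0 := by simpa using h 1 0
  have hk2 : k 2 = -(-k 2 / k 3) * k 3 := by field_simp
  set w := -k 2 / k 3 with hw
  have hkA : k 0 + w * k 1 - w ^ 3 / 3 * k 3 = 0 := by
    have : k 3 ^ 2 * (k 0 + w * k 1 - w ^ 3 / 3 * k 3) = 0 := by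
      rw [cayleyCubic, hk2] at hk0
      linear_combination hk0
    rcases mul_eq_zero.1 this with h' | h'
    · exact absurd (pow_eq_zero_iff two_ne_zero |>.1 h') hk
    · exact h'
  refine ⟨⟨hkA, by linarith⟩, ?_⟩
  -- The vector `m - (m³ / k³) k` of the plane has vanishing last component.
  have h1 := h (-(m 3 / k 3)) 1
  have h2 := h (1 - m 3 / k 3) 1
  set d := m 3 / k 3 with hd
  have hm3 : m 3 = d * k 3 := by rw [hd]; field_simp
  simp only [cayleyCubic, Pi.add_apply, Pi.smul_apply, smul_eq_mul] at h1 h2 hk0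
  rw [hm3] at h1 h2
  have hm2 : m 2 = d * k 2 := by
    have : (m 2 - d * k 2) ^ 3 = 0 := by linear_combination 3 * h1
    linarith [pow_eq_zero_iff (three_ne_zero) |>.1 this]
  rw [hm2] at h2
  have hm0 : k 3 * k 3 * ((m 0 - d * k 0) + w * (m 1 - d * k 1)) = 0 := by
    rw [hk2] at h2 hk0
    linear_combination h2 - hk0
  have hm0' : (m 0 - d * k 0) + w * (m 1 - d * k 1) = 0 := by
    rcases mul_eq_zero.1 hm0 with h' | h'
    · exact absurd h' (mul_ne_zero hk hk)
    · exact h'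
  constructor
  · rw [hm3]; linear_combination hm0' + d * hkA
  · rw [hm3, hm2]; linear_combination d * hk2

/-- The basis vector `γ₁(u)` of the ruling plane `Π_u`, spanning its intersection with the singular
plane. -/
def singVector (u : ℝ) : Fin 4 → ℝ := ![-u, 1, 0, 0]

lemma inRulingPlane_singVector (u : ℝ) : InRulingPlane u (singVector u) := by
  simp [InRulingPlane, singVector]

lemma inRulingPlane_nullVector (u v : ℝ) : InRulingPlane u (nullVector u v) := by
  simp only [InRulingPlane, nullVector]
  constructor <;> simp

lemma InRulingPlane.eq_add {u : ℝ} {y : Fin 4 → ℝ} (h : InRulingPlane u y) :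
    y = y 1 • singVector u + y 3 • nullVector u 0 := by
  obtain ⟨h0, h2⟩ := h
  ext i
  fin_cases i
  · simp [singVector, nullVector]; linarith
  · simp [singVector, nullVector]
  · simp [singVector, nullVector]; linarith
  · simp [singVector, nullVector]

section ConeAutomorphism

variable {B : (Fin 4 → ℝ) ≃ₗ[ℝ] (Fin 4 → ℝ)}

/-- The image of a ruling plane under an automorphism of the cone is the ruling plane through any
of its vectors off the singular plane. -/
lemma inRulingPlane_map_of_ne (hB : ∀ y, cayleyCubic (B y) = 0 ↔ cayleyCubic y = 0) {u : ℝ}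
    {k m : Fin 4 → ℝ} (hk : InRulingPlane u k) (hm : InRulingPlane u m) (h3 : B k 3 ≠ 0) :
    InRulingPlane (-B k 2 / B k 3) (B m) :=
  (inRulingPlane_of_span_subset h3 fun r s => by
    rw [← map_smul, ← map_smul, ← map_add, hB]
    exact (hk.add_smul hm r s).cayleyCubic_eq_zero).2

/-- An automorphism of the cone preserves the singular plane: a vector `γ₁(u)` lies on two planes
of the cone, a vector off the singular plane on only one. -/
lemma map_singVector_three (hB : ∀ y, cayleyCubic (B y) = 0 ↔ cayleyCubic y = 0) (u : ℝ) :
    B (singVector u) 3 = 0 := by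
  by_contra h3
  set k := B (singVector u) with hk
  set w := -k 2 / k 3
  have h1 : InRulingPlane w (B (nullVector u 0)) :=
    inRulingPlane_map_of_ne hB (inRulingPlane_singVector u) (inRulingPlane_nullVector u 0) h3
  have h0 : InRulingPlane w (B (singVector u)) :=
    inRulingPlane_map_of_ne hB (inRulingPlane_singVector u) (inRulingPlane_singVector u) h3
  have h2 : InRulingPlane w (B ![1, 0, 0, 0]) := by
    refine (inRulingPlane_of_span_subset h3 fun r s => ?_).2
    rw [hk, ← map_smul, ← map_smul, ← map_add, hB]
    simp [cayleyCubic, singVector]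
  -- The images of `γ₁(u)`, `γ₂(u)` and `∂₀` would be dependent.
  have e0 := h0.eq_add
  have e1 := h1.eq_add
  have e2 := h2.eq_add
  set x0 := B (singVector u)
  set x1 := B (nullVector u 0)
  set x2 := B ![1, 0, 0, 0]
  have key : (x1 1 * x2 3 - x1 3 * x2 1) • x0 + (x2 1 * x0 3 - x2 3 * x0 1) • x1
      + (x0 1 * x1 3 - x0 3 * x1 1) • x2 = 0 := by
    generalize hc0 : x1 1 * x2 3 - x1 3 * x2 1 = c0
    generalize hc1 : x2 1 * x0 3 - x2 3 * x0 1 = c1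
    generalize hc2 : x0 1 * x1 3 - x0 3 * x1 1 = c2
    rw [e0, e1, e2]
    have f1 : c0 * x0 1 + c1 * x1 1 + c2 * x2 1 = 0 := by rw [← hc0, ← hc1, ← hc2]; ring
    have f3 : c0 * x0 3 + c1 * x1 3 + c2 * x2 3 = 0 := by rw [← hc0, ← hc1, ← hc2]; ring
    calc _ = (c0 * x0 1 + c1 * x1 1 + c2 * x2 1) • singVector w
          + (c0 * x0 3 + c1 * x1 3 + c2 * x2 3) • nullVector w 0 := by module
      _ = 0 := by rw [f1, f3]; simp
  have key' : B ((x1 1 * x2 3 - x1 3 * x2 1) • singVector u +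
      (x2 1 * x0 3 - x2 3 * x0 1) • nullVector u 0
      + (x0 1 * x1 3 - x0 3 * x1 1) • ![1, 0, 0, 0]) = 0 := by
    rw [map_add, map_add, map_smul, map_smul, map_smul]; exact key
  have key2 := B.map_eq_zero_iff.1 key'
  have hc1 : x2 1 * x0 3 - x2 3 * x0 1 = 0 := by
    simpa [singVector, nullVector] using congrFun key2 3
  have h02 : x0 3 • x2 - x2 3 • x0 = 0 := by
    ext i
    fin_cases i
    · simp; linear_combination x0 3 * h2.1 - x2 3 * h0.1 - w * hc1
    · simp; linear_combination hc1
    · simp; linear_combination x0 3 * h2.2 - x2 3 * h0.2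
    · simp; ring
  have h02' : B (x0 3 • ![1, 0, 0, 0] - x2 3 • singVector u) = 0 := by
    rw [map_sub, map_smul, map_smul]; exact h02
  have h02'' := B.map_eq_zero_iff.1 h02'
  have hz : x2 3 = 0 := by simpa [singVector] using congrFun h02'' 1
  have hz' : x0 3 = 0 := by simpa [singVector, hz] using congrFun h02'' 0
  exact h3 hz'

lemma map_apply_three_of_singular (hB : ∀ y, cayleyCubic (B y) = 0 ↔ cayleyCubic y = 0)
    {y : Fin 4 → ℝ} (h2 : y 2 = 0) (h3 : y 3 = 0) : B y 2 = 0 ∧ B y 3 = 0 := by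
  have e : y = (y 1 + y 0) • singVector 0 + (-y 0) • singVector 1 := by
    ext i; fin_cases i <;> simp [singVector, h2, h3]
  have h : B y 3 = 0 := by
    rw [e, map_add, map_smul, map_smul]
    simp [map_singVector_three hB]
  refine ⟨?_, h⟩
  have : cayleyCubic (B y) = 0 := by rw [hB]; simp [cayleyCubic, h2, h3]
  simpa [cayleyCubic, h] using this

/-- The induced action of an automorphism of the cone on the parameter of the ruling planes. -/
noncomputable def rulingMap (B : (Fin 4 → ℝ) →ₗ[ℝ] (Fin 4 → ℝ)) (u : ℝ) : ℝ :=
  (B ![1, 0, 0, 0] 0 * u - B ![0, 1, 0, 0] 0) / B ![0, 1, 0, 0] 1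

lemma map_inRulingPlane_aux (hB : ∀ y, cayleyCubic (B y) = 0 ↔ cayleyCubic y = 0) (u : ℝ) :
    ∃ w : ℝ, ∀ y, InRulingPlane u y → InRulingPlane w (B y) := by
  have hB' : ∀ y, cayleyCubic (B.symm y) = 0 ↔ cayleyCubic y = 0 := fun y => by
    rw [← hB, B.apply_symm_apply]
  have h3 : B (nullVector u 0) 3 ≠ 0 := fun h3 => by
    have h2 : B (nullVector u 0) 2 = 0 := by
      have : cayleyCubic (B (nullVector u 0)) = 0 := by
        rw [hB]; exact (inRulingPlane_nullVector u 0).cayleyCubic_eq_zero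
      simpa [cayleyCubic, h3] using this
    have := (map_apply_three_of_singular hB' h2 h3).2
    simp [nullVector] at this
  exact ⟨_, fun y hy => inRulingPlane_map_of_ne hB (inRulingPlane_nullVector u 0) hy h3⟩

/-- An automorphism of the cone acts on the ruling planes by an affine map of the parameter. -/
lemma inRulingPlane_rulingMap (hB : ∀ y, cayleyCubic (B y) = 0 ↔ cayleyCubic y = 0) :
    B ![1, 0, 0, 0] 0 ≠ 0 ∧ B ![0, 1, 0, 0] 1 ≠ 0 ∧
    ∀ u y, InRulingPlane (rulingMap B u) (B y) ↔ InRulingPlane u y := by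
  have hB' : ∀ y, cayleyCubic (B.symm y) = 0 ↔ cayleyCubic y = 0 := fun y => by
    rw [← hB, B.apply_symm_apply]
  have hs (u : ℝ) : singVector u = ![0, 1, 0, 0] - u • ![1, 0, 0, 0] := by
    ext i; fin_cases i <;> simp [singVector]
  obtain ⟨h02, h03⟩ := map_apply_three_of_singular hB (y := ![1, 0, 0, 0]) rfl rfl
  obtain ⟨h12, h13⟩ := map_apply_three_of_singular hB (y := ![0, 1, 0, 0]) rfl rfl
  have hrel (u w : ℝ) (h : ∀ y, InRulingPlane u y → InRulingPlane w (B y)) :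
      B ![0, 1, 0, 0] 0 - u * B ![1, 0, 0, 0] 0
        + w * (B ![0, 1, 0, 0] 1 - u * B ![1, 0, 0, 0] 1) = 0 := by
    have := (h _ (inRulingPlane_singVector u)).1
    rw [hs, map_sub, map_smul] at this
    simpa [h03, h13] using this
  have hdep (r s : ℝ) (h0 : r * B ![1, 0, 0, 0] 0 + s * B ![0, 1, 0, 0] 0 = 0)
      (h1 : r * B ![1, 0, 0, 0] 1 + s * B ![0, 1, 0, 0] 1 = 0) : r = 0 ∧ s = 0 := by
    have : B (r • ![1, 0, 0, 0] + s • ![0, 1, 0, 0]) = 0 := by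
      rw [map_add, map_smul, map_smul]
      ext i; fin_cases i
      · simpa using h0
      · simpa using h1
      · simp [h02, h12]
      · simp [h03, h13]
    have h' := B.map_eq_zero_iff.1 this
    exact ⟨by simpa using congrFun h' 0, by simpa using congrFun h' 1⟩
  have h10 : B ![1, 0, 0, 0] 1 = 0 := by
    by_contra hne
    set u := B ![0, 1, 0, 0] 1 / B ![1, 0, 0, 0] 1 with hu
    obtain ⟨w, hw⟩ := map_inRulingPlane_aux hB u
    have e := hrel u w hw
    have e1 : B ![0, 1, 0, 0] 1 - u * B ![1, 0, 0, 0] 1 = 0 := by rw [hu]; field_simp; ring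
    rw [e1] at e
    have := (hdep (-u) 1 (by linarith) (by linarith)).2
    exact one_ne_zero this
  have h00 : B ![1, 0, 0, 0] 0 ≠ 0 := fun h =>
    one_ne_zero (hdep 1 0 (by rw [h]; ring) (by rw [h10]; ring)).1
  have h11 : B ![0, 1, 0, 0] 1 ≠ 0 := fun h =>
    h00 (by simpa using (hdep (B ![0, 1, 0, 0] 0) (-B ![1, 0, 0, 0] 0) (by ring)
      (by rw [h10, h]; ring)).2)
  have hmap (u w : ℝ) (h : ∀ y, InRulingPlane u y → InRulingPlane w (B y)) :
      w = rulingMap B u := by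
    have e := hrel u w h
    rw [h10] at e
    simp only [rulingMap, LinearEquiv.coe_coe]
    rw [eq_div_iff h11]
    linarith
  refine ⟨h00, h11, fun u y => ⟨fun h => ?_, fun h => ?_⟩⟩
  · obtain ⟨w, hw⟩ := map_inRulingPlane_aux hB u
    obtain rfl := hmap u w hw
    obtain ⟨w', hw'⟩ := map_inRulingPlane_aux hB' (rulingMap B u)
    have h2 := (hw' _ (hw _ (inRulingPlane_nullVector u 0))).2
    rw [B.symm_apply_apply] at h2
    have : w' = u := by simp [nullVector] at h2; linarith
    have := hw' _ h
    rwa [B.symm_apply_apply, ‹w' = u›] at this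
  · obtain ⟨w, hw⟩ := map_inRulingPlane_aux hB u
    obtain rfl := hmap u w hw
    exact hw y h

end ConeAutomorphism

/-- The derivative of the Cayley cubic along the cone is a combination of the two equations of the
ruling plane through the point. -/
lemma fderiv_cayleyCubic_nullVector (u v : ℝ) :
    fderiv ℝ cayleyCubic (nullVector u v) = rulingA u + (u ^ 2 - v) • rulingB u := by
  have hp (i : Fin 4) : HasFDerivAt (fun y : Fin 4 → ℝ => y i)
      (ContinuousLinearMap.proj (R := ℝ) (φ := fun _ : Fin 4 => ℝ) i) (nullVector u v) :=
    hasFDerivAt_apply i _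
  have h := ((((hp 2).pow 3).const_mul (1 / 3)).add (((hp 0).mul (hp 3)).mul (hp 3))).sub
    (((hp 1).mul (hp 2)).mul (hp 3))
  have h' : HasFDerivAt cayleyCubic _ (nullVector u v) := h
  rw [h'.fderiv]
  ext y
  simp [rulingA_apply, rulingB_apply, nullVector]
  ring

/-! ### Calculus preliminaries -/

section Calculus

variable {E F G : Type*} [NormedAddCommGroup E] [NormedSpace ℝ E] [NormedAddCommGroup F]
  [NormedSpace ℝ F] [NormedAddCommGroup G] [NormedSpace ℝ G]

lemma fderiv_clm_apply_apply {c : E → F →L[ℝ] G} {f : E → F} {x : E}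
    (hc : DifferentiableAt ℝ c x) (hf : DifferentiableAt ℝ f x) (w : E) :
    fderiv ℝ (fun y => c y (f y)) x w = fderiv ℝ c x w (f x) + c x (fderiv ℝ f x w) := by
  rw [fderiv_clm_apply hc hf]
  simp [add_comm]

lemma fderiv_clm_apply_const_apply {c : E → F →L[ℝ] G} {x : E}
    (hc : DifferentiableAt ℝ c x) (z : F) (w : E) :
    fderiv ℝ (fun y => c y z) x w = fderiv ℝ c x w z := by
  rw [fderiv_clm_apply_apply hc (differentiableAt_const z)]
  simp

lemma fderiv_prod_snd_eq_deriv {f : E × ℝ → F} {p : E} {t : ℝ} (hf : DifferentiableAt ℝ f (p, t)) :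
    fderiv ℝ f (p, t) (0, 1) = deriv (fun r => f (p, r)) t := by
  have h : HasDerivAt (fun r : ℝ => (p, r)) ((0 : E), (1 : ℝ)) t :=
    (hasDerivAt_const t p).prodMk (hasDerivAt_id t)
  exact (hf.hasFDerivAt.comp_hasDerivAt t h).deriv.symm

lemma fderiv_fderiv_symm {f : E → F} {x : E} (hf : ContDiffAt ℝ 2 f x) (v w : E) :
    fderiv ℝ (fderiv ℝ f) x v w = fderiv ℝ (fderiv ℝ f) x w v :=
  (hf.isSymmSndFDerivAt (by simp)) v w

/-- A field of covectors that vanishes on the kernel of the differential of a submersion `T` is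
the composition of this differential with a smooth field of covectors along `T`. -/
lemma exists_covector_comp_fderiv [FiniteDimensional ℝ F] {n : ℕ∞ω} {T : E → F} {x : E}
    {A : E → E →L[ℝ] ℝ} (hdT : ContDiffAt ℝ n (fderiv ℝ T) x)
    (hsurj : Function.Surjective (fderiv ℝ T x)) (hA : ContDiffAt ℝ n A x)
    (hker : ∀ᶠ y in 𝓝 x, ∀ ξ, fderiv ℝ T y ξ = 0 → A y ξ = 0) :
    ∃ a : E → F →L[ℝ] ℝ, ContDiffAt ℝ n a x ∧
      ∀ᶠ y in 𝓝 x, ∀ ξ, a y (fderiv ℝ T y ξ) = A y ξ := by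
  have : CompleteSpace F := FiniteDimensional.complete ℝ F
  obtain ⟨R', hR'⟩ := (fderiv ℝ T x).toLinearMap.exists_rightInverse_of_surjective
    (LinearMap.range_eq_top.2 hsurj)
  let R : F →L[ℝ] E := LinearMap.toContinuousLinearMap R'
  have hR : (fderiv ℝ T x).comp R = ContinuousLinearEquiv.refl ℝ F := by
    ext z; exact LinearMap.congr_fun hR' z
  have hN : ContDiffAt ℝ n (fun y => (fderiv ℝ T y).comp R) x := hdT.clm_comp contDiffAt_const
  have hinv : ContDiffAt ℝ n (fun y => ((fderiv ℝ T y).comp R).inverse) x := by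
    refine ContDiffAt.comp x (g := ContinuousLinearMap.inverse) ?_ hN
    rw [hR]; exact contDiffAt_map_inverse _
  refine ⟨fun y => ((A y).comp R).comp ((fderiv ℝ T y).comp R).inverse,
    (hA.clm_comp contDiffAt_const).clm_comp hinv, ?_⟩
  have hev : ∀ᶠ y in 𝓝 x, (fderiv ℝ T y).comp R ∈
      range ((↑) : (F ≃L[ℝ] F) → F →L[ℝ] F) := by
    refine hN.continuousAt.eventually_mem ?_
    rw [hR]; exact ContinuousLinearEquiv.nhds _
  filter_upwards [hker, hev] with y hy ⟨e, he⟩ ξ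
  rw [← he, ContinuousLinearMap.inverse_equiv]
  have h0 : fderiv ℝ T y (ξ - R (e.symm (fderiv ℝ T y ξ))) = 0 := by
    have := congrArg (fun L : F →L[ℝ] F => L (e.symm (fderiv ℝ T y ξ))) he
    simp only [ContinuousLinearEquiv.coe_coe, ContinuousLinearEquiv.apply_symm_apply,
      ContinuousLinearMap.comp_apply] at this
    rw [map_sub, ← this, sub_self]
  have := hy _ h0
  rw [map_sub, sub_eq_zero] at this
  simp [this]

lemma dForm_eq {α : E → E →L[ℝ] ℝ} {x : E} (hα : DifferentiableAt ℝ α x) (ξ η : E) :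
    dForm α x ξ η = fderiv ℝ α x ξ η - fderiv ℝ α x η ξ := by
  have hd : DifferentiableAt ℝ
      (fun y => ContinuousAlternatingMap.ofSubsingleton ℝ E ℝ (0 : Fin 1) (α y)) x :=
    (ContinuousAlternatingMap.ofSubsingletonLIE (𝕜 := ℝ) (E := E) (F := ℝ)
      (0 : Fin 1)).differentiableAt.comp x hα
  unfold dForm
  rw [extDeriv_apply hd]
  have e0 (z : E) : fderiv ℝ (fun y => α y z) x = (fderiv ℝ α x).flip z := by
    ext w; exact fderiv_clm_apply_const_apply hα z w
  simp [Fin.sum_univ_two, Fin.removeNth_apply, e0]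
  ring

end Calculus

/-! ### Null surfaces and twistor maps in coordinates -/

/-- `θ` is a smooth coframe on the open set `N`. -/
structure IsCoframe (θ : E4 → E4 →L[ℝ] (Fin 4 → ℝ)) (N : Set E4) : Prop where
  isOpen : IsOpen N
  smooth : ContDiffOn ℝ ∞ θ N
  bijective : ∀ p ∈ N, Function.Bijective (θ p)

/-- `h` is a smooth immersion of the open set `Ω` into `N`, tangent to ruling planes of the coframe
`θ` with the smooth parameter `u`. -/
structure IsNullPatch (θ : E4 → E4 →L[ℝ] (Fin 4 → ℝ)) (N : Set E4) (h : E2 → E4) (u : E2 → ℝ)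
    (Ω : Set E2) : Prop where
  isOpen : IsOpen Ω
  smooth : ContDiffOn ℝ ∞ h Ω
  mapsTo : MapsTo h Ω N
  injective : ∀ s ∈ Ω, Function.Injective (fderiv ℝ h s)
  ruling : IsRulingParameter θ h Ω u

/-- A submersion `T` from an open set `Q` of the 5-dimensional space of ruling planes, with
coordinates `(p, u)`, to a 3-dimensional space, whose fibres are surfaces that project to surfaces
tangent to the ruling planes which they represent: the points of the fibre over `t` are the ruling
planes tangent to the null surface with parameter `t`. -/
structure IsTwistorMap (θ : E4 → E4 →L[ℝ] (Fin 4 → ℝ)) (Q : Set (E4 × ℝ)) (T : E4 × ℝ → E3) :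
    Prop where
  isOpen : IsOpen Q
  smooth : ContDiffOn ℝ ∞ T Q
  surjective : ∀ q ∈ Q, Function.Surjective (fderiv ℝ T q)
  ruling : ∀ q ∈ Q, ∀ ξ, fderiv ℝ T q ξ = 0 → InRulingPlane q.2 (θ q.1 ξ.1)
  lift : ∀ q ∈ Q, ∀ y, InRulingPlane q.2 (θ q.1 y) → ∃ κ, fderiv ℝ T q (y, κ) = 0
  fibre : ∀ q ∈ Q, fderiv ℝ T q (0, 1) ≠ 0

/-- The lift of a surface to the space of ruling planes. -/
def rulingLift (h : E2 → E4) (u : E2 → ℝ) (s : E2) : E4 × ℝ := (h s, u s)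

/-- The pullback of the 1-form `ωⁱ` to the surface. -/
noncomputable def surfaceForm (θ : E4 → E4 →L[ℝ] (Fin 4 → ℝ)) (h : E2 → E4) (i : Fin 4) (s : E2) :
    E2 →L[ℝ] ℝ :=
  (ContinuousLinearMap.proj (R := ℝ) (φ := fun _ : Fin 4 => ℝ) i).comp
    ((θ (h s)).comp (fderiv ℝ h s))

lemma surfaceForm_apply (θ : E4 → E4 →L[ℝ] (Fin 4 → ℝ)) (h : E2 → E4) (i : Fin 4) (s w : E2) :
    surfaceForm θ h i s w = θ (h s) (fderiv ℝ h s w) i := rfl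

/-- The velocity of the curve in the twistor space formed by the null surfaces through the point
`h s`, at the null surface `h` itself. Up to scale, this is the point of the projectivized tangent
space of the twistor space that corresponds to `s`. -/
noncomputable def twistorVelocity (T : E4 × ℝ → E3) (h : E2 → E4) (u : E2 → ℝ) (s : E2) : E3 :=
  fderiv ℝ T (rulingLift h u s) (0, 1)

section NullPatch

variable {θ : E4 → E4 →L[ℝ] (Fin 4 → ℝ)} {N : Set E4} {h : E2 → E4} {u : E2 → ℝ} {Ω : Set E2}

namespace IsNullPatch

lemma inRulingPlane (hn : IsNullPatch θ N h u Ω) {s : E2} (hs : s ∈ Ω) (w : E2) :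
    InRulingPlane (u s) (θ (h s) (fderiv ℝ h s w)) :=
  (hn.ruling.2 s hs _).1 ⟨w, rfl⟩

lemma contDiffAt (hn : IsNullPatch θ N h u Ω) {s : E2} (hs : s ∈ Ω) : ContDiffAt ℝ ∞ h s :=
  hn.smooth.contDiffAt (hn.isOpen.mem_nhds hs)

lemma contDiffAt_param (hn : IsNullPatch θ N h u Ω) {s : E2} (hs : s ∈ Ω) :
    ContDiffAt ℝ ∞ u s :=
  hn.ruling.1.contDiffAt (hn.isOpen.mem_nhds hs)

lemma contDiffAt_rulingLift (hn : IsNullPatch θ N h u Ω) {s : E2} (hs : s ∈ Ω) :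
    ContDiffAt ℝ ∞ (rulingLift h u) s :=
  (hn.contDiffAt hs).prodMk (hn.contDiffAt_param hs)

lemma fderiv_rulingLift (hn : IsNullPatch θ N h u Ω) {s : E2} (hs : s ∈ Ω) (w : E2) :
    fderiv ℝ (rulingLift h u) s w = (fderiv ℝ h s w, fderiv ℝ u s w) := by
  have h1 := (hn.contDiffAt hs).differentiableAt (by simp)
  have h2 := (hn.contDiffAt_param hs).differentiableAt (by simp)
  exact congrArg (· w) (h1.fderiv_prodMk h2)

lemma contDiffAt_surfaceForm (hc : IsCoframe θ N) (hn : IsNullPatch θ N h u Ω) {s : E2}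
    (hs : s ∈ Ω) (i : Fin 4) : ContDiffAt ℝ ∞ (surfaceForm θ h i) s := by
  have h1 : ContDiffAt ℝ ∞ (fun s => θ (h s)) s :=
    (hc.smooth.contDiffAt (hc.isOpen.mem_nhds (hn.mapsTo hs))).comp s (hn.contDiffAt hs)
  have h2 : ContDiffAt ℝ ∞ (fderiv ℝ h) s := (hn.contDiffAt hs).fderiv_right (by simp)
  exact contDiffAt_const.clm_comp (h1.clm_comp h2)

/-- The forms `ω¹` and `ω³` restrict to a coframe on a null surface. -/
lemma eq_zero_of_surfaceForm (hc : IsCoframe θ N) (hn : IsNullPatch θ N h u Ω) {s : E2}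
    (hs : s ∈ Ω) {w : E2} (h1 : surfaceForm θ h 1 s w = 0) (h3 : surfaceForm θ h 3 s w = 0) :
    w = 0 := by
  obtain ⟨e0, e2⟩ := hn.inRulingPlane hs w
  rw [surfaceForm_apply] at h1 h3
  rw [h1, h3] at e0
  rw [h3] at e2
  have : θ (h s) (fderiv ℝ h s w) = 0 := by
    ext i; fin_cases i
    · simpa using e0
    · simpa using h1
    · simpa using e2
    · simpa using h3
  have h' := (hc.bijective _ (hn.mapsTo hs)).1 (this.trans (map_zero _).symm)
  exact hn.injective s hs (h'.trans (map_zero _).symm)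

lemma exists_surfaceForm (hc : IsCoframe θ N) (hn : IsNullPatch θ N h u Ω) {s : E2}
    (hs : s ∈ Ω) (r t : ℝ) : ∃ w, surfaceForm θ h 1 s w = r ∧ surfaceForm θ h 3 s w = t := by
  have hinj : Function.Injective ((surfaceForm θ h 1 s).toLinearMap.prod
      (surfaceForm θ h 3 s).toLinearMap) := by
    rw [injective_iff_map_eq_zero]
    intro w hw
    exact hn.eq_zero_of_surfaceForm hc hs (congrArg Prod.fst hw) (congrArg Prod.snd hw)
  have hsurj := (LinearMap.injective_iff_surjective_of_finrank_eq_finrank (by simp)).1 hinj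
  obtain ⟨w, hw⟩ := hsurj (r, t)
  exact ⟨w, congrArg Prod.fst hw, congrArg Prod.snd hw⟩

end IsNullPatch

end NullPatch

section TwistorPair

variable {T : E4 × ℝ → E3} {h : E2 → E4} {u : E2 → ℝ} {s : E2}
  {a : E4 × ℝ → E3 →L[ℝ] ℝ} {A : E4 × ℝ → E4 →L[ℝ] ℝ}

lemma fderiv_twistorVelocity (hT : ContDiffAt ℝ ∞ T (rulingLift h u s))
    (hq : DifferentiableAt ℝ (rulingLift h u) s) (w : E2) :
    fderiv ℝ (twistorVelocity T h u) s w
      = fderiv ℝ (fderiv ℝ T) (rulingLift h u s) (0, 1) (fderiv ℝ (rulingLift h u) s w) := by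
  have hdT : DifferentiableAt ℝ (fderiv ℝ T) (rulingLift h u s) :=
    (hT.fderiv_right (m := ∞) (by simp)).differentiableAt (by simp)
  have hc : DifferentiableAt ℝ (fun s => fderiv ℝ T (rulingLift h u s)) s := hdT.comp s hq
  have : fderiv ℝ (twistorVelocity T h u) s w
      = fderiv ℝ (fun s => fderiv ℝ T (rulingLift h u s)) s w (0, 1) :=
    fderiv_clm_apply_const_apply hc _ w
  rw [this, fderiv_fderiv_symm (hT.of_le (by norm_cast))]
  have h2 : fderiv ℝ (fun s => fderiv ℝ T (rulingLift h u s)) s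
      = (fderiv ℝ (fderiv ℝ T) (rulingLift h u s)).comp (fderiv ℝ (rulingLift h u) s) :=
    fderiv_comp s hdT hq
  rw [h2]; rfl

/-- The derivative of the identity `a ∘ dT = A ∘ pr₁` along the fibre. -/
lemma apply_fderiv_twistorVelocity (hT : ContDiffAt ℝ ∞ T (rulingLift h u s))
    (hq : DifferentiableAt ℝ (rulingLift h u) s)
    (ha : DifferentiableAt ℝ a (rulingLift h u s))
    (haA : ∀ᶠ q in 𝓝 (rulingLift h u s), ∀ ξ, a q (fderiv ℝ T q ξ) = A q ξ.1) (w : E2) :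
    a (rulingLift h u s) (fderiv ℝ (twistorVelocity T h u) s w)
      = fderiv ℝ (fun q => A q (fderiv ℝ (rulingLift h u) s w).1) (rulingLift h u s) (0, 1)
        - fderiv ℝ a (rulingLift h u s) (0, 1)
          (fderiv ℝ T (rulingLift h u s) (fderiv ℝ (rulingLift h u) s w)) := by
  have hdT : DifferentiableAt ℝ (fderiv ℝ T) (rulingLift h u s) :=
    (hT.fderiv_right (m := ∞) (by simp)).differentiableAt (by simp)
  rw [fderiv_twistorVelocity hT hq]
  set ξ := fderiv ℝ (rulingLift h u) s w
  have e : (fun q => A q ξ.1) =ᶠ[𝓝 (rulingLift h u s)] fun q => a q (fderiv ℝ T q ξ) := by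
    filter_upwards [haA] with q hq using (hq ξ).symm
  rw [e.fderiv_eq, fderiv_clm_apply_apply ha (hdT.clm_apply (differentiableAt_const _)),
    fderiv_clm_apply_const_apply hdT]
  ring

/-- Consequence of the symmetry of the second derivative of `T` along the lifted surface. -/
lemma fderiv_covector_symm (hT : ContDiffAt ℝ ∞ T (rulingLift h u s))
    (hq : ContDiffAt ℝ ∞ (rulingLift h u) s)
    (ha : DifferentiableAt ℝ a (rulingLift h u s))
    (hA : ∀ᶠ s' in 𝓝 s, ∀ w, a (rulingLift h u s')
      (fderiv ℝ (fun s => T (rulingLift h u s)) s' w) = 0) (w w' : E2) :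
    fderiv ℝ (fun s => a (rulingLift h u s)) s w (fderiv ℝ (fun s => T (rulingLift h u s)) s w')
      = fderiv ℝ (fun s => a (rulingLift h u s)) s w'
        (fderiv ℝ (fun s => T (rulingLift h u s)) s w) := by
  have hTq : ContDiffAt ℝ ∞ (fun s => T (rulingLift h u s)) s := hT.comp s hq
  have hdTq : DifferentiableAt ℝ (fderiv ℝ (fun s => T (rulingLift h u s))) s :=
    (hTq.fderiv_right (m := ∞) (by simp)).differentiableAt (by simp)
  have haq : DifferentiableAt ℝ (fun s => a (rulingLift h u s)) s :=
    ha.comp s (hq.differentiableAt (by simp))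
  have key (z z' : E2) : fderiv ℝ (fun s => a (rulingLift h u s)) s z
      (fderiv ℝ (fun s => T (rulingLift h u s)) s z') = - a (rulingLift h u s)
        (fderiv ℝ (fderiv ℝ (fun s => T (rulingLift h u s))) s z z') := by
    have e : (fun s' => a (rulingLift h u s') (fderiv ℝ (fun s => T (rulingLift h u s)) s' z'))
        =ᶠ[𝓝 s] fun _ => 0 := by
      filter_upwards [hA] with s' hs' using hs' z'
    have := congrArg (fun L : E2 →L[ℝ] ℝ => L z) e.fderiv_eq
    simp only [fderiv_fun_const, Pi.zero_apply, zero_apply] at this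
    rw [fderiv_clm_apply_apply haq (hdTq.clm_apply (differentiableAt_const _)),
      fderiv_clm_apply_const_apply hdTq] at this
    linarith
  rw [key, key, fderiv_fderiv_symm (hTq.of_le (by norm_cast))]

end TwistorPair

/-! ### Null surfaces and the twistor space -/

lemma contDiff_rulingA : ContDiff ℝ ∞ rulingA := by
  unfold rulingA; fun_prop

lemma contDiff_rulingB : ContDiff ℝ ∞ rulingB := by
  unfold rulingB; fun_prop

section Twistor

variable {θ : E4 → E4 →L[ℝ] (Fin 4 → ℝ)} {N : Set E4} {h : E2 → E4} {u : E2 → ℝ} {Ω : Set E2}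
  {Q : Set (E4 × ℝ)} {T : E4 × ℝ → E3}

lemma IsCoframe.contDiffAt (hc : IsCoframe θ N) {p : E4} (hp : p ∈ N) : ContDiffAt ℝ ∞ θ p :=
  hc.smooth.contDiffAt (hc.isOpen.mem_nhds hp)

lemma IsCoframe.contDiffAt_rulingA (hc : IsCoframe θ N) {q : E4 × ℝ} (hq : q.1 ∈ N) :
    ContDiffAt ℝ ∞ (fun q : E4 × ℝ => (rulingA q.2).comp (θ q.1)) q :=
  (contDiff_rulingA.contDiffAt.comp q contDiffAt_snd).clm_comp
    ((hc.contDiffAt hq).comp q contDiffAt_fst)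

lemma IsCoframe.contDiffAt_rulingB (hc : IsCoframe θ N) {q : E4 × ℝ} (hq : q.1 ∈ N) :
    ContDiffAt ℝ ∞ (fun q : E4 × ℝ => (rulingB q.2).comp (θ q.1)) q :=
  (contDiff_rulingB.contDiffAt.comp q contDiffAt_snd).clm_comp
    ((hc.contDiffAt hq).comp q contDiffAt_fst)

lemma IsCoframe.fderiv_rulingA_fibre (hc : IsCoframe θ N) {q : E4 × ℝ} (hq : q.1 ∈ N) (y : E4) :
    fderiv ℝ (fun q : E4 × ℝ => (rulingA q.2).comp (θ q.1) y) q (0, 1)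
      = θ q.1 y 1 - q.2 ^ 2 * θ q.1 y 3 := by
  obtain ⟨p, t⟩ := q
  rw [fderiv_prod_snd_eq_deriv (((hc.contDiffAt_rulingA hq).differentiableAt (by simp)).clm_apply
    (differentiableAt_const y))]
  have : (fun r : ℝ => (rulingA r).comp (θ p) y)
      = fun r => θ p y 0 + r * θ p y 1 - r ^ 3 / 3 * θ p y 3 := by
    ext r; simp [rulingA_apply]
  rw [this]
  have hd := (((hasDerivAt_id t).mul_const (θ p y 1)).const_add (θ p y 0)).sub
    ((((hasDerivAt_id t).pow 3).div_const 3).mul_const (θ p y 3))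
  refine (HasDerivAt.deriv hd).trans ?_
  simp

lemma IsCoframe.fderiv_rulingB_fibre (hc : IsCoframe θ N) {q : E4 × ℝ} (hq : q.1 ∈ N) (y : E4) :
    fderiv ℝ (fun q : E4 × ℝ => (rulingB q.2).comp (θ q.1) y) q (0, 1) = θ q.1 y 3 := by
  obtain ⟨p, t⟩ := q
  rw [fderiv_prod_snd_eq_deriv (((hc.contDiffAt_rulingB hq).differentiableAt (by simp)).clm_apply
    (differentiableAt_const y))]
  have : (fun r : ℝ => (rulingB r).comp (θ p) y) = fun r => θ p y 2 + r * θ p y 3 := by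
    ext r; simp [rulingB_apply]
  rw [this]
  have hd := ((hasDerivAt_id t).mul_const (θ p y 3)).const_add (θ p y 2)
  refine (HasDerivAt.deriv hd).trans ?_
  simp

namespace IsTwistorMap

lemma contDiffAt (hT : IsTwistorMap θ Q T) {q : E4 × ℝ} (hq : q ∈ Q) : ContDiffAt ℝ ∞ T q :=
  hT.smooth.contDiffAt (hT.isOpen.mem_nhds hq)

/-- The two equations of the ruling planes are pulled back from covectors of the twistor space. -/
lemma exists_covectors (hc : IsCoframe θ N) (hT : IsTwistorMap θ Q T) {q : E4 × ℝ}
    (hq : q ∈ Q) (hqN : q.1 ∈ N) :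
    ∃ a b : E4 × ℝ → E3 →L[ℝ] ℝ, ContDiffAt ℝ 2 a q ∧ ContDiffAt ℝ 2 b q ∧
      (∀ᶠ q' in 𝓝 q, ∀ ξ, a q' (fderiv ℝ T q' ξ) = (rulingA q'.2).comp (θ q'.1) ξ.1) ∧
      ∀ᶠ q' in 𝓝 q, ∀ ξ, b q' (fderiv ℝ T q' ξ) = (rulingB q'.2).comp (θ q'.1) ξ.1 := by
  have hdT : ContDiffAt ℝ ∞ (fderiv ℝ T) q := (hT.contDiffAt hq).fderiv_right (by simp)
  have hev := hT.isOpen.mem_nhds hq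
  have h2 : (2 : ℕ∞ω) ≤ ∞ := by norm_cast
  obtain ⟨a, ha, haA⟩ := exists_covector_comp_fderiv (n := 2) (T := T) (x := q)
    (A := fun q' : E4 × ℝ => ((rulingA q'.2).comp (θ q'.1)).comp (ContinuousLinearMap.fst ℝ E4 ℝ))
    (hdT.of_le h2) (hT.surjective q hq)
    (((hc.contDiffAt_rulingA hqN).clm_comp contDiffAt_const).of_le h2) (by
      filter_upwards [hev] with q' hq' ξ hξ
      exact ((inRulingPlane_iff _ _).1 (hT.ruling q' hq' ξ hξ)).1)
  obtain ⟨b, hb, hbB⟩ := exists_covector_comp_fderiv (n := 2) (T := T) (x := q)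
    (A := fun q' : E4 × ℝ => ((rulingB q'.2).comp (θ q'.1)).comp (ContinuousLinearMap.fst ℝ E4 ℝ))
    (hdT.of_le h2) (hT.surjective q hq)
    (((hc.contDiffAt_rulingB hqN).clm_comp contDiffAt_const).of_le h2) (by
      filter_upwards [hev] with q' hq' ξ hξ
      exact ((inRulingPlane_iff _ _).1 (hT.ruling q' hq' ξ hξ)).2)
  exact ⟨a, b, ha, hb, haA, hbB⟩

end IsTwistorMap

/-- A null surface that lies in the domain of a twistor map. -/
structure IsTwistorPatch (θ : E4 → E4 →L[ℝ] (Fin 4 → ℝ)) (N : Set E4) (h : E2 → E4) (u : E2 → ℝ)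
    (Ω : Set E2) (Q : Set (E4 × ℝ)) (T : E4 × ℝ → E3) : Prop where
  coframe : IsCoframe θ N
  nullPatch : IsNullPatch θ N h u Ω
  twistor : IsTwistorMap θ Q T
  mapsTo : MapsTo (rulingLift h u) Ω Q

namespace IsTwistorPatch

variable (H : IsTwistorPatch θ N h u Ω Q T)
include H

lemma fderiv_comp_rulingLift {s : E2} (hs : s ∈ Ω) (w : E2) :
    fderiv ℝ (fun s => T (rulingLift h u s)) s w
      = fderiv ℝ T (rulingLift h u s) (fderiv ℝ (rulingLift h u) s w) := by
  have h1 := (H.twistor.contDiffAt (H.mapsTo hs)).differentiableAt (by simp)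
  have h2 := (H.nullPatch.contDiffAt_rulingLift hs).differentiableAt (by simp)
  exact congrArg (fun L : E2 →L[ℝ] E3 => L w) (fderiv_comp s h1 h2)

/-- The lift of every null surface is tangent to the fibres of a twistor map, since the lifts of
null surfaces are integral surfaces of the distribution spanned by the tangent planes of these
fibres and `∂_u`, whose brackets with `∂_u` leave the distribution. -/
lemma fderiv_comp_rulingLift_eq_zero {s : E2} (hs : s ∈ Ω) (w : E2) :
    fderiv ℝ T (rulingLift h u s) (fderiv ℝ (rulingLift h u) s w) = 0 := by
  obtain ⟨a, b, ha, hb, haA, hbB⟩ := H.twistor.exists_covectors H.coframe (H.mapsTo hs)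
    (H.nullPatch.mapsTo hs)
  have hq := H.nullPatch.contDiffAt_rulingLift hs
  have hqd := hq.differentiableAt (by simp)
  have hT := H.twistor.contDiffAt (H.mapsTo hs)
  have had := ha.differentiableAt (by simp)
  have hbd := hb.differentiableAt (by simp)
  have hΩ : ∀ᶠ s' in 𝓝 s, s' ∈ Ω := H.nullPatch.isOpen.mem_nhds hs
  -- The derivative of the lift is vertical modulo the tangent plane of the fibre.
  have hκ (w : E2) : ∃ κ : ℝ, fderiv ℝ T (rulingLift h u s) (fderiv ℝ (rulingLift h u) s w)
      = κ • twistorVelocity T h u s := by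
    obtain ⟨κ, hκ⟩ := H.twistor.lift _ (H.mapsTo hs) _ (H.nullPatch.inRulingPlane hs w)
    refine ⟨fderiv ℝ u s w - κ, ?_⟩
    have : fderiv ℝ (rulingLift h u) s w
        = (fderiv ℝ h s w, κ) + (fderiv ℝ u s w - κ) • ((0 : E4), (1 : ℝ)) := by
      rw [H.nullPatch.fderiv_rulingLift hs]; simp
    rw [this, map_add, map_smul]
    erw [hκ]
    rw [zero_add]; rfl
  choose κ hκ using hκ
  -- Both covectors lead to a relation between `κ` and the restricted coframe.
  have gen (a : E4 × ℝ → E3 →L[ℝ] ℝ) (A : E4 × ℝ → E4 →L[ℝ] ℝ)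
      (ha : DifferentiableAt ℝ a (rulingLift h u s))
      (haA : ∀ᶠ q in 𝓝 (rulingLift h u s), ∀ ξ, a q (fderiv ℝ T q ξ) = A q ξ.1)
      (hA0 : ∀ s' ∈ Ω, ∀ w, A (rulingLift h u s') (fderiv ℝ h s' w) = 0) (w w' : E2) :
      κ w' * fderiv ℝ (fun q => A q (fderiv ℝ h s w)) (rulingLift h u s) (0, 1)
        = κ w * fderiv ℝ (fun q => A q (fderiv ℝ h s w')) (rulingLift h u s) (0, 1) := by
    have haq : DifferentiableAt ℝ (fun s => a (rulingLift h u s)) s := ha.comp s hqd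
    have haA' := hq.continuousAt.eventually haA
    have hsym := fderiv_covector_symm hT hq ha (by
      filter_upwards [haA', hΩ] with s' h1 h2 z
      rw [H.fderiv_comp_rulingLift h2, h1, H.nullPatch.fderiv_rulingLift h2]
      exact hA0 s' h2 z)
    have hg0 : (fun s' => a (rulingLift h u s') (twistorVelocity T h u s')) =ᶠ[𝓝 s]
        fun _ => 0 := by
      filter_upwards [haA'] with s' h1
      rw [twistorVelocity, h1]; simp
    have hgd : DifferentiableAt ℝ (twistorVelocity T h u) s :=
      ((((hT.fderiv_right (m := ∞) (by simp)).comp s hq).clm_apply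
        contDiffAt_const).differentiableAt (by simp))
    have hdg (z : E2) : fderiv ℝ (fun s => a (rulingLift h u s)) s z (twistorVelocity T h u s)
        = - a (rulingLift h u s) (fderiv ℝ (twistorVelocity T h u) s z) := by
      have := congrArg (fun L : E2 →L[ℝ] ℝ => L z) hg0.fderiv_eq
      simp only [fderiv_fun_const, Pi.zero_apply, zero_apply] at this
      rw [fderiv_clm_apply_apply haq hgd] at this
      linarith
    have hf (z : E2) := apply_fderiv_twistorVelocity hT hqd ha haA z
    have h1 := hsym w w'
    rw [H.fderiv_comp_rulingLift hs, H.fderiv_comp_rulingLift hs, hκ, hκ, map_smul, map_smul,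
      hdg, hdg, hf, hf, hκ, hκ, H.nullPatch.fderiv_rulingLift hs,
      H.nullPatch.fderiv_rulingLift hs, map_smul, map_smul] at h1
    simp only [smul_eq_mul] at h1
    linear_combination -h1
  have hA (w w' : E2) := gen a (fun q => (rulingA q.2).comp (θ q.1)) had haA (fun s' hs' w =>
    ((inRulingPlane_iff _ _).1 (H.nullPatch.inRulingPlane hs' w)).1) w w'
  have hB (w w' : E2) := gen b (fun q => (rulingB q.2).comp (θ q.1)) hbd hbB (fun s' hs' w =>
    ((inRulingPlane_iff _ _).1 (H.nullPatch.inRulingPlane hs' w)).2) w w'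
  have hN : (rulingLift h u s).1 ∈ N := H.nullPatch.mapsTo hs
  simp only [H.coframe.fderiv_rulingA_fibre hN] at hA
  simp only [H.coframe.fderiv_rulingB_fibre hN] at hB
  obtain ⟨w1, h11, h13⟩ := H.nullPatch.exists_surfaceForm H.coframe hs 1 0
  obtain ⟨w3, h31, h33⟩ := H.nullPatch.exists_surfaceForm H.coframe hs 0 1
  simp only [surfaceForm_apply] at h11 h13 h31 h33
  have e1 : κ w1 = 0 := by
    have := hB w3 w1
    simp only [rulingLift] at this
    rw [h33, h13] at this; linarith
  have e2 : κ w = 0 := by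
    have := hA w1 w
    simp only [rulingLift] at this
    rw [h11, h13, e1] at this; linarith
  rw [hκ, e2, zero_smul]

/-- Near each point there are covectors along the surface which span the annihilator of the
twistor velocity, and in terms of which the derivative of the twistor velocity is the restricted
coframe. -/
lemma exists_covectors {s : E2} (hs : s ∈ Ω) :
    ∃ a b : E4 × ℝ → E3 →L[ℝ] ℝ,
      ContDiffAt ℝ 2 a (rulingLift h u s) ∧ ContDiffAt ℝ 2 b (rulingLift h u s) ∧
      (∀ᶠ q' in 𝓝 (rulingLift h u s), ∀ ξ,
        a q' (fderiv ℝ T q' ξ) = (rulingA q'.2).comp (θ q'.1) ξ.1) ∧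
      (∀ᶠ q' in 𝓝 (rulingLift h u s), ∀ ξ,
        b q' (fderiv ℝ T q' ξ) = (rulingB q'.2).comp (θ q'.1) ξ.1) ∧
      ∀ᶠ s' in 𝓝 s, a (rulingLift h u s') (twistorVelocity T h u s') = 0 ∧
        b (rulingLift h u s') (twistorVelocity T h u s') = 0 ∧
        ∀ w, a (rulingLift h u s') (fderiv ℝ (twistorVelocity T h u) s' w)
            = surfaceForm θ h 1 s' w - u s' ^ 2 * surfaceForm θ h 3 s' w ∧
          b (rulingLift h u s') (fderiv ℝ (twistorVelocity T h u) s' w)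
            = surfaceForm θ h 3 s' w := by
  obtain ⟨a, b, ha, hb, haA, hbB⟩ := H.twistor.exists_covectors H.coframe (H.mapsTo hs)
    (H.nullPatch.mapsTo hs)
  refine ⟨a, b, ha, hb, haA, hbB, ?_⟩
  have hq := H.nullPatch.contDiffAt_rulingLift hs
  have hΩ : ∀ᶠ s' in 𝓝 s, s' ∈ Ω := H.nullPatch.isOpen.mem_nhds hs
  filter_upwards [hΩ, hq.continuousAt.eventually haA.eventually_nhds,
    hq.continuousAt.eventually hbB.eventually_nhds,
    hq.continuousAt.eventually (ha.eventually (by simp)),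
    hq.continuousAt.eventually (hb.eventually (by simp))] with s' hs' haA' hbB' ha' hb'
  have hq' := (H.nullPatch.contDiffAt_rulingLift hs').differentiableAt (by simp)
  have hT' := H.twistor.contDiffAt (H.mapsTo hs')
  have hN : (rulingLift h u s').1 ∈ N := H.nullPatch.mapsTo hs'
  refine ⟨?_, ?_, fun w => ⟨?_, ?_⟩⟩
  · rw [twistorVelocity, haA'.self_of_nhds]; simp
  · rw [twistorVelocity, hbB'.self_of_nhds]; simp
  · rw [apply_fderiv_twistorVelocity (A := fun q => (rulingA q.2).comp (θ q.1)) hT' hq'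
      (ha'.differentiableAt (by simp)) haA',
      H.fderiv_comp_rulingLift_eq_zero hs', H.coframe.fderiv_rulingA_fibre hN,
      H.nullPatch.fderiv_rulingLift hs', map_zero, sub_zero]
    rfl
  · rw [apply_fderiv_twistorVelocity (A := fun q => (rulingB q.2).comp (θ q.1)) hT' hq'
      (hb'.differentiableAt (by simp)) hbB',
      H.fderiv_comp_rulingLift_eq_zero hs', H.coframe.fderiv_rulingB_fibre hN,
      H.nullPatch.fderiv_rulingLift hs', map_zero, sub_zero]
    rfl

lemma contDiffAt_twistorVelocity {s : E2} (hs : s ∈ Ω) :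
    ContDiffAt ℝ ∞ (twistorVelocity T h u) s :=
  (((H.twistor.contDiffAt (H.mapsTo hs)).fderiv_right (m := ∞) (by simp)).comp s
    (H.nullPatch.contDiffAt_rulingLift hs)).clm_apply contDiffAt_const

/-- The twistor velocity is an immersion into the projectivized tangent space. -/
lemma twistorVelocity_independent {s : E2} (hs : s ∈ Ω) (c : ℝ) (w : E2)
    (hcw : c • twistorVelocity T h u s + fderiv ℝ (twistorVelocity T h u) s w = 0) :
    c = 0 ∧ w = 0 := by
  obtain ⟨a, b, -, -, -, -, hev⟩ := H.exists_covectors hs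
  obtain ⟨h1, h2, h3⟩ := hev.self_of_nhds
  have e1 := congrArg (a (rulingLift h u s)) hcw
  have e2 := congrArg (b (rulingLift h u s)) hcw
  rw [map_add, map_smul, h1, (h3 w).1, map_zero] at e1
  rw [map_add, map_smul, h2, (h3 w).2, map_zero] at e2
  simp only [smul_eq_mul, mul_zero, zero_add] at e1 e2
  rw [e2, mul_zero, sub_zero] at e1
  have hw := H.nullPatch.eq_zero_of_surfaceForm H.coframe hs e1 e2
  refine ⟨?_, hw⟩
  rw [hw, map_zero, add_zero] at hcw
  exact (smul_eq_zero.1 hcw).resolve_right (H.twistor.fibre _ (H.mapsTo hs))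

lemma exists_eq_twistorVelocity {s : E2} (hs : s ∈ Ω) (z : E3) :
    ∃ (c : ℝ) (w : E2),
      z = c • twistorVelocity T h u s + fderiv ℝ (twistorVelocity T h u) s w := by
  let L : ℝ × E2 →ₗ[ℝ] E3 := (LinearMap.toSpanSingleton ℝ E3 (twistorVelocity T h u s)).coprod
    (fderiv ℝ (twistorVelocity T h u) s).toLinearMap
  have hinj : Function.Injective L := by
    rw [injective_iff_map_eq_zero]
    rintro ⟨c, w⟩ hcw
    obtain ⟨rfl, rfl⟩ := H.twistorVelocity_independent hs c w (by simpa [L] using hcw)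
    rfl
  obtain ⟨⟨c, w⟩, hcw⟩ := (LinearMap.injective_iff_surjective_of_finrank_eq_finrank
    (by simp)).1 hinj z
  exact ⟨c, w, by simpa [L] using hcw.symm⟩

end IsTwistorPatch

end Twistor

/-! ### The characteristic directions tangent to a null surface -/

/-- The covector along `dT` which represents the Hilbert form. -/
noncomputable def hilbertCovector (a b : E4 × ℝ → E3 →L[ℝ] ℝ) (q : E4 × ℝ × ℝ) : E3 →L[ℝ] ℝ :=
  a (q.1, q.2.1) + (q.2.1 ^ 2 - q.2.2) • b (q.1, q.2.1)

section Hilbert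

variable {θ : E4 → E4 →L[ℝ] (Fin 4 → ℝ)} {N : Set E4} {h : E2 → E4} {u : E2 → ℝ} {Ω : Set E2}
  {Q : Set (E4 × ℝ)} {T : E4 × ℝ → E3} {a b : E4 × ℝ → E3 →L[ℝ] ℝ} {q : E4 × ℝ × ℝ}

lemma hilbertForm_apply (q ξ : E4 × ℝ × ℝ) : hilbertForm θ q ξ
    = rulingA q.2.1 (θ q.1 ξ.1) + (q.2.1 ^ 2 - q.2.2) * rulingB q.2.1 (θ q.1 ξ.1) := by
  simp [hilbertForm, fderiv_cayleyCubic_nullVector]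

lemma differentiableAt_hilbertCovector (ha : DifferentiableAt ℝ a (q.1, q.2.1))
    (hb : DifferentiableAt ℝ b (q.1, q.2.1)) :
    DifferentiableAt ℝ (hilbertCovector a b) q := by
  have hπ : DifferentiableAt ℝ (fun q : E4 × ℝ × ℝ => (q.1, q.2.1)) q := by fun_prop
  have h1 : DifferentiableAt ℝ (fun q : E4 × ℝ × ℝ => a (q.1, q.2.1)) q := ha.comp q hπ
  have h2 : DifferentiableAt ℝ (fun q : E4 × ℝ × ℝ => b (q.1, q.2.1)) q := hb.comp q hπ
  have h3 : DifferentiableAt ℝ (fun q : E4 × ℝ × ℝ => q.2.1 ^ 2 - q.2.2) q := by fun_prop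
  exact h1.add (h3.smul h2)

lemma hilbertForm_eventuallyEq
    (haA : ∀ᶠ q' in 𝓝 (q.1, q.2.1), ∀ ξ,
      a q' (fderiv ℝ T q' ξ) = (rulingA q'.2).comp (θ q'.1) ξ.1)
    (hbB : ∀ᶠ q' in 𝓝 (q.1, q.2.1), ∀ ξ,
      b q' (fderiv ℝ T q' ξ) = (rulingB q'.2).comp (θ q'.1) ξ.1) :
    ∀ᶠ q' in 𝓝 q, ∀ ξ : E4 × ℝ × ℝ, hilbertForm θ q' ξ
      = hilbertCovector a b q' (fderiv ℝ T (q'.1, q'.2.1) (ξ.1, ξ.2.1)) := by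
  have hπ : ContinuousAt (fun q : E4 × ℝ × ℝ => (q.1, q.2.1)) q := by fun_prop
  filter_upwards [hπ.eventually haA, hπ.eventually hbB] with q' h1 h2 ξ
  simp [hilbertForm_apply, hilbertCovector, h1, h2]

/-- Since `d(dT) = 0`, only the derivative of the covector enters the exterior derivative of the
Hilbert form. -/
lemma dForm_hilbertForm (hT : ContDiffAt ℝ ∞ T (q.1, q.2.1))
    (ha : DifferentiableAt ℝ a (q.1, q.2.1)) (hb : DifferentiableAt ℝ b (q.1, q.2.1))
    (haA : ∀ᶠ q' in 𝓝 (q.1, q.2.1), ∀ ξ,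
      a q' (fderiv ℝ T q' ξ) = (rulingA q'.2).comp (θ q'.1) ξ.1)
    (hbB : ∀ᶠ q' in 𝓝 (q.1, q.2.1), ∀ ξ,
      b q' (fderiv ℝ T q' ξ) = (rulingB q'.2).comp (θ q'.1) ξ.1)
    (ξ η : E4 × ℝ × ℝ) :
    dForm (hilbertForm θ) q ξ η
      = fderiv ℝ (hilbertCovector a b) q ξ (fderiv ℝ T (q.1, q.2.1) (η.1, η.2.1))
        - fderiv ℝ (hilbertCovector a b) q η (fderiv ℝ T (q.1, q.2.1) (ξ.1, ξ.2.1)) := by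
  let π : E4 × ℝ × ℝ →L[ℝ] E4 × ℝ := (ContinuousLinearMap.fst ℝ E4 (ℝ × ℝ)).prod
    ((ContinuousLinearMap.fst ℝ ℝ ℝ).comp (ContinuousLinearMap.snd ℝ E4 (ℝ × ℝ)))
  have hdT : DifferentiableAt ℝ (fderiv ℝ T) (π q) :=
    (hT.fderiv_right (m := ∞) (by simp)).differentiableAt (by simp)
  have hdTπ : DifferentiableAt ℝ (fun q => fderiv ℝ T (π q)) q :=
    hdT.comp q π.differentiableAt
  have hcov := differentiableAt_hilbertCovector ha hb
  have e : hilbertForm θ =ᶠ[𝓝 q]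
      fun q' => (hilbertCovector a b q').comp ((fderiv ℝ T (π q')).comp π) := by
    filter_upwards [hilbertForm_eventuallyEq haA hbB] with q' hq'
    exact ContinuousLinearMap.ext fun ξ => hq' ξ
  have hd : DifferentiableAt ℝ (hilbertForm θ) q :=
    (hcov.clm_comp (hdTπ.clm_comp (differentiableAt_const π))).congr_of_eventuallyEq e
  have hf (ξ η : E4 × ℝ × ℝ) : fderiv ℝ (hilbertForm θ) q ξ η
      = fderiv ℝ (hilbertCovector a b) q ξ (fderiv ℝ T (π q) (π η))
        + hilbertCovector a b q (fderiv ℝ (fderiv ℝ T) (π q) (π ξ) (π η)) := by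
    rw [← fderiv_clm_apply_const_apply hd]
    have e' : (fun q' => hilbertForm θ q' η) =ᶠ[𝓝 q]
        fun q' => hilbertCovector a b q' (fderiv ℝ T (π q') (π η)) := by
      filter_upwards [hilbertForm_eventuallyEq haA hbB] with q' hq' using hq' η
    rw [e'.fderiv_eq, fderiv_clm_apply_apply hcov (hdTπ.clm_apply (differentiableAt_const _)),
      fderiv_clm_apply_const_apply hdTπ]
    have h2 : fderiv ℝ (fun q => fderiv ℝ T (π q)) q = (fderiv ℝ (fderiv ℝ T) (π q)).comp π := by
      refine (fderiv_comp q hdT π.differentiableAt).trans ?_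
      rw [π.fderiv]
    rw [h2]; rfl
  rw [dForm_eq hd, hf, hf, fderiv_fderiv_symm (x := π q) (hT.of_le (by norm_cast)) (π ξ)]
  change _ + _ - (fderiv ℝ (hilbertCovector a b) q η (fderiv ℝ T (π q) (π ξ)) + _) = _
  rw [add_sub_add_right_eq_sub]
  rfl

namespace IsTwistorPatch

variable (H : IsTwistorPatch θ N h u Ω Q T)
include H

lemma fderiv_surfaceLift {s : E2} (hs : s ∈ Ω) (v : ℝ) (ξ : E2 × ℝ) :
    DifferentiableAt ℝ (surfaceLift h u) (s, v) ∧
    fderiv ℝ (surfaceLift h u) (s, v) ξ = (fderiv ℝ h s ξ.1, fderiv ℝ u s ξ.1, ξ.2) := by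
  have h1 : HasFDerivAt (fun q : E2 × ℝ => h q.1) ((fderiv ℝ h s).comp
      (ContinuousLinearMap.fst ℝ E2 ℝ)) (s, v) :=
    HasFDerivAt.comp (g := h) (s, v)
      ((H.nullPatch.contDiffAt hs).differentiableAt (by simp)).hasFDerivAt hasFDerivAt_fst
  have h2 : HasFDerivAt (fun q : E2 × ℝ => u q.1) ((fderiv ℝ u s).comp
      (ContinuousLinearMap.fst ℝ E2 ℝ)) (s, v) :=
    HasFDerivAt.comp (g := u) (s, v)
      ((H.nullPatch.contDiffAt_param hs).differentiableAt (by simp)).hasFDerivAt hasFDerivAt_fst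
  have h3 : HasFDerivAt (surfaceLift h u) _ (s, v) := h1.prodMk (h2.prodMk hasFDerivAt_snd)
  exact ⟨h3.differentiableAt, by rw [h3.fderiv]; rfl⟩

/-- The characteristic directions are those along which the hyperplane in the tangent space of the
twistor space given by the Hilbert form is constant. -/
lemma mem_pathLine_iff_covector {s : E2} (hs : s ∈ Ω) (v : ℝ)
    (ha : DifferentiableAt ℝ a (rulingLift h u s)) (hb : DifferentiableAt ℝ b (rulingLift h u s))
    (haA : ∀ᶠ q' in 𝓝 (rulingLift h u s), ∀ ξ,
      a q' (fderiv ℝ T q' ξ) = (rulingA q'.2).comp (θ q'.1) ξ.1)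
    (hbB : ∀ᶠ q' in 𝓝 (rulingLift h u s), ∀ ξ,
      b q' (fderiv ℝ T q' ξ) = (rulingB q'.2).comp (θ q'.1) ξ.1)
    (ξ : E2 × ℝ) :
    ξ ∈ pathLine θ h u (s, v) ↔ ∀ z, hilbertCovector a b (surfaceLift h u (s, v)) z = 0 →
      fderiv ℝ (fun q => hilbertCovector a b (surfaceLift h u q)) (s, v) ξ z = 0 := by
  have hT := H.twistor.contDiffAt (H.mapsTo hs)
  obtain ⟨hd, hξ⟩ := H.fderiv_surfaceLift hs v ξ
  have hchain : fderiv ℝ (fun q => hilbertCovector a b (surfaceLift h u q)) (s, v) ξ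
      = fderiv ℝ (hilbertCovector a b) (surfaceLift h u (s, v))
        (fderiv ℝ (surfaceLift h u) (s, v) ξ) := by
    have := fderiv_comp (s, v) (differentiableAt_hilbertCovector (q := surfaceLift h u (s, v))
      ha hb) hd
    exact congrArg (fun L : E2 × ℝ →L[ℝ] _ => L ξ) this
  have h0 : fderiv ℝ T (rulingLift h u s) (fderiv ℝ h s ξ.1, fderiv ℝ u s ξ.1) = 0 := by
    rw [← H.nullPatch.fderiv_rulingLift hs]
    exact H.fderiv_comp_rulingLift_eq_zero hs ξ.1
  have hα := (hilbertForm_eventuallyEq (q := surfaceLift h u (s, v)) haA hbB).self_of_nhds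
  have hdα := dForm_hilbertForm (q := surfaceLift h u (s, v)) hT ha hb haA hbB
  rw [hchain]
  set ξ' := fderiv ℝ (surfaceLift h u) (s, v) ξ
  have hξ0 : fderiv ℝ T ((surfaceLift h u (s, v)).1, (surfaceLift h u (s, v)).2.1)
      (ξ'.1, ξ'.2.1) = 0 := by rw [hξ]; exact h0
  change (hilbertForm θ _ ξ' = 0 ∧ ∀ η, hilbertForm θ _ η = 0 → dForm (hilbertForm θ) _ ξ' η = 0)
    ↔ _
  simp only [hα, hdα, hξ0, map_zero, sub_zero, true_and]
  constructor
  · intro hh z hz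
    obtain ⟨η, rfl⟩ := H.twistor.surjective _ (H.mapsTo hs) z
    exact hh (η.1, η.2, 0) hz
  · intro hh η hη
    exact hh _ hη

end IsTwistorPatch

end Hilbert

/-- The slope `dv/dτ` of the geodesic of the connection `G` with initial velocity `y`, where
`ω³(y) = 1` and `ω¹(y) = v`, if `v` is the quotient of the values of `ω¹` and `ω³` on the velocity
of the curve. -/
noncomputable def pathSlope (θ : E4 → E4 →L[ℝ] (Fin 4 → ℝ)) (h : E2 → E4) (s : E2)
    (G : E2 →L[ℝ] E2 →L[ℝ] E2) (v : ℝ) (y : E2) : ℝ :=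
  fderiv ℝ (surfaceForm θ h 1) s y y - v * fderiv ℝ (surfaceForm θ h 3) s y y
    - (surfaceForm θ h 1 s (G y y) - v * surfaceForm θ h 3 s (G y y))

/-- The geodesics of the connection `G` at `s` are mapped by `g`, read as a map to a projective
plane, to curves with an inflection point. -/
def IsInflectionalAt (g : E2 → E3) (G : E2 →L[ℝ] E2 →L[ℝ] E2) (s : E2) : Prop :=
  ∀ w, ∃ c c' : ℝ, fderiv ℝ (fderiv ℝ g) s w w = fderiv ℝ g s (G w w) + c • fderiv ℝ g s w + c' • g s

namespace IsTwistorPatch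

variable {θ : E4 → E4 →L[ℝ] (Fin 4 → ℝ)} {N : Set E4} {h : E2 → E4} {u : E2 → ℝ} {Ω : Set E2}
  {Q : Set (E4 × ℝ)} {T : E4 × ℝ → E3} (H : IsTwistorPatch θ N h u Ω Q T)
include H

lemma pathLine_main {s : E2} (hs : s ∈ Ω) (v : ℝ) :
    (∀ ξ ∈ pathLine θ h u (s, v), surfaceForm θ h 1 s ξ.1 = v * surfaceForm θ h 3 s ξ.1 ∧
      (ξ.1 = 0 → ξ.2 = 0)) ∧
    ∀ G, IsInflectionalAt (twistorVelocity T h u) G s → ∀ y, surfaceForm θ h 1 s y = v →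
      surfaceForm θ h 3 s y = 1 → (y, pathSlope θ h s G v y) ∈ pathLine θ h u (s, v) := by
  obtain ⟨a, b, ha2, hb2, haA, hbB, hev⟩ := H.exists_covectors hs
  have ha := ha2.differentiableAt (by simp)
  have hb := hb2.differentiableAt (by simp)
  have hmem := H.mem_pathLine_iff_covector hs v ha hb haA hbB
  obtain ⟨hd, -⟩ := H.fderiv_surfaceLift hs v 0
  set Λ := fun q : E2 × ℝ => hilbertCovector a b (surfaceLift h u q) with hΛ
  have hΛd : DifferentiableAt ℝ Λ (s, v) :=
    (differentiableAt_hilbertCovector (q := surfaceLift h u (s, v)) ha hb).comp (s, v) hd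
  set g := twistorVelocity T h u with hg
  have hgs := H.contDiffAt_twistorVelocity hs
  have hev' : ∀ᶠ q : E2 × ℝ in 𝓝 (s, v), Λ q (g q.1) = 0 ∧ ∀ w, Λ q (fderiv ℝ g q.1 w)
      = surfaceForm θ h 1 q.1 w - q.2 * surfaceForm θ h 3 q.1 w := by
    filter_upwards [continuousAt_fst.eventually hev] with q ⟨h1, h2, h3⟩
    have hΛq : Λ q = a (rulingLift h u q.1) + (u q.1 ^ 2 - q.2) • b (rulingLift h u q.1) := rfl
    rw [hΛq]
    simp only [add_apply, smul_apply, smul_eq_mul, h1, h2, h3]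
    exact ⟨by ring, fun w => by ring⟩
  obtain ⟨hΛg, hΛdg⟩ := hev'.self_of_nhds
  dsimp only at hΛg hΛdg
  have fst_apply {F : Type} [NormedAddCommGroup F] [NormedSpace ℝ F] {f : E2 → F}
      (hf : DifferentiableAt ℝ f s) (ξ : E2 × ℝ) :
      DifferentiableAt ℝ (fun q : E2 × ℝ => f q.1) (s, v) ∧
      fderiv ℝ (fun q : E2 × ℝ => f q.1) (s, v) ξ = fderiv ℝ f s ξ.1 := by
    have := HasFDerivAt.comp (g := f) (s, v) hf.hasFDerivAt (hasFDerivAt_fst (𝕜 := ℝ))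
    exact ⟨this.differentiableAt, by
      have e := this.fderiv
      exact congrArg (fun L : E2 × ℝ →L[ℝ] F => L ξ) e⟩
  -- The derivatives of the two identities for `Λ`.
  have e1 (ξ : E2 × ℝ) : fderiv ℝ Λ (s, v) ξ (g s)
      = -(surfaceForm θ h 1 s ξ.1 - v * surfaceForm θ h 3 s ξ.1) := by
    have e : (fun q : E2 × ℝ => Λ q (g q.1)) =ᶠ[𝓝 (s, v)] fun _ => 0 := by
      filter_upwards [hev'] with q hq using hq.1
    obtain ⟨f1, f2⟩ := fst_apply (hgs.differentiableAt (by simp)) ξ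
    have := congrArg (fun L : E2 × ℝ →L[ℝ] ℝ => L ξ) e.fderiv_eq
    simp only [fderiv_fun_const, Pi.zero_apply, zero_apply] at this
    rw [fderiv_clm_apply_apply hΛd f1, f2, hΛdg] at this
    linarith
  have e2 (ξ : E2 × ℝ) (y : E2) : fderiv ℝ Λ (s, v) ξ (fderiv ℝ g s y)
      = fderiv ℝ (surfaceForm θ h 1) s ξ.1 y - v * fderiv ℝ (surfaceForm θ h 3) s ξ.1 y
        - ξ.2 * surfaceForm θ h 3 s y - Λ (s, v) (fderiv ℝ (fderiv ℝ g) s ξ.1 y) := by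
    have e : (fun q : E2 × ℝ => Λ q (fderiv ℝ g q.1 y)) =ᶠ[𝓝 (s, v)]
        fun q => surfaceForm θ h 1 q.1 y - q.2 * surfaceForm θ h 3 q.1 y := by
      filter_upwards [hev'] with q hq using hq.2 y
    have hdg : DifferentiableAt ℝ (fderiv ℝ g) s :=
      (hgs.fderiv_right (m := ∞) (by simp)).differentiableAt (by simp)
    have hω (i : Fin 4) : DifferentiableAt ℝ (surfaceForm θ h i) s :=
      (H.nullPatch.contDiffAt_surfaceForm H.coframe hs i).differentiableAt (by simp)
    obtain ⟨f1, f2⟩ := fst_apply (hdg.clm_apply (differentiableAt_const y)) ξ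
    obtain ⟨g1, g2⟩ := fst_apply ((hω 1).clm_apply (differentiableAt_const y)) ξ
    obtain ⟨k1, k2⟩ := fst_apply ((hω 3).clm_apply (differentiableAt_const y)) ξ
    rw [fderiv_clm_apply_const_apply hdg] at f2
    rw [fderiv_clm_apply_const_apply (hω _)] at g2 k2
    have := congrArg (fun L : E2 × ℝ →L[ℝ] ℝ => L ξ) e.fderiv_eq
    rw [fderiv_clm_apply_apply hΛd f1, f2] at this
    have r := (g1.hasFDerivAt.sub ((hasFDerivAt_snd (𝕜 := ℝ) (p := (s, v))).mul
      k1.hasFDerivAt)).fderiv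
    have r' := congrArg (fun L : E2 × ℝ →L[ℝ] ℝ => L ξ) r
    have r'' := this.trans r'
    simp only [sub_apply, add_apply, smul_apply, smul_eq_mul, g2, k2] at r''
    simp only [ContinuousLinearMap.coe_snd'] at r''
    linarith
  have h1 (ξ : E2 × ℝ) (hξ : ξ ∈ pathLine θ h u (s, v)) :
      surfaceForm θ h 1 s ξ.1 = v * surfaceForm θ h 3 s ξ.1 := by
    have := (hmem ξ).1 hξ (g s) hΛg
    rw [e1] at this
    linarith
  refine ⟨fun ξ hξ => ⟨h1 ξ hξ, fun hξ0 => ?_⟩, fun G hG y hy1 hy3 => ?_⟩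
  · obtain ⟨y, hy1, hy3⟩ := H.nullPatch.exists_surfaceForm H.coframe hs v 1
    have := (hmem ξ).1 hξ (fderiv ℝ g s y) (by
      change Λ (s, v) _ = 0
      rw [hΛdg, hy1, hy3]; ring)
    rw [e2, hξ0, hy3] at this
    simpa using this
  · rw [hmem]
    intro z hz
    change Λ (s, v) z = 0 at hz
    obtain ⟨c, w, rfl⟩ := H.exists_eq_twistorVelocity hs z
    rw [map_add, map_smul, hΛg, hΛdg] at hz
    have hw : w = surfaceForm θ h 3 s w • y := by
      rw [← sub_eq_zero]
      refine H.nullPatch.eq_zero_of_surfaceForm H.coframe hs ?_ ?_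
      · rw [map_sub, map_smul, hy1, smul_eq_mul]
        simp only [smul_eq_mul, mul_zero, zero_add] at hz
        linarith
      · rw [map_sub, map_smul, hy3]; simp
    obtain ⟨k, k', hk⟩ := hG y
    rw [hw, map_add, map_smul, map_smul, map_smul, e1, e2]
    dsimp only
    rw [hk, map_add, map_add, map_smul, map_smul, hΛg, hΛdg, hΛdg, hy1, hy3, pathSlope]
    simp only [smul_eq_mul]
    ring

end IsTwistorPatch

/-! ### The path geometry and its geodesics -/

/-- The geodesics of the connection `G` at `s` in nonsingular directions have characteristic
lifts. -/
def IsPathConnectionAt (θ : E4 → E4 →L[ℝ] (Fin 4 → ℝ)) (h : E2 → E4) (u : E2 → ℝ) (s : E2)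
    (G : E2 →L[ℝ] E2 →L[ℝ] E2) : Prop :=
  ∀ v y, surfaceForm θ h 1 s y = v → surfaceForm θ h 3 s y = 1 →
    (y, pathSlope θ h s G v y) ∈ pathLine θ h u (s, v)

/-- The characteristic directions over `s` are transversal to the fibre and project to the null
directions which they lie over. -/
def IsPathLineTransversalAt (θ : E4 → E4 →L[ℝ] (Fin 4 → ℝ)) (h : E2 → E4) (u : E2 → ℝ) (s : E2) :
    Prop :=
  ∀ v, ∀ ξ ∈ pathLine θ h u (s, v), surfaceForm θ h 1 s ξ.1 = v * surfaceForm θ h 3 s ξ.1 ∧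
      (ξ.1 = 0 → ξ.2 = 0)

section PathGeometry

variable {θ : E4 → E4 →L[ℝ] (Fin 4 → ℝ)} {N : Set E4} {h : E2 → E4} {u : E2 → ℝ} {Ω : Set E2}
  {s : E2} {Γ : E2 → E2 →L[ℝ] E2 →L[ℝ] E2} {G G' : E2 →L[ℝ] E2 →L[ℝ] E2}

lemma pathSlope_eq_of_isPathConnectionAt (hl : IsPathLineTransversalAt θ h u s)
    {v κ : ℝ} {y : E2} (hy : (y, κ) ∈ pathLine θ h u (s, v))
    (hG : (y, pathSlope θ h s G v y) ∈ pathLine θ h u (s, v)) : κ = pathSlope θ h s G v y := by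
  have := (hl v _ (Submodule.sub_mem _ hy hG)).2 (by simp)
  simpa [sub_eq_zero] using this

lemma mem_pathLine_iff (hc : IsCoframe θ N) (hn : IsNullPatch θ N h u Ω) (hs : s ∈ Ω)
    (hl : IsPathLineTransversalAt θ h u s) (hG : IsPathConnectionAt θ h u s G) {v : ℝ} {y : E2}
    (hy1 : surfaceForm θ h 1 s y = v) (hy3 : surfaceForm θ h 3 s y = 1) (ξ : E2 × ℝ) :
    ξ ∈ pathLine θ h u (s, v) ↔ surfaceForm θ h 1 s ξ.1 = v * surfaceForm θ h 3 s ξ.1 ∧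
      ξ.2 = pathSlope θ h s G v y * surfaceForm θ h 3 s ξ.1 := by
  have hy := hG v y hy1 hy3
  have hw (w : E2) (hw : surfaceForm θ h 1 s w = v * surfaceForm θ h 3 s w) :
      w = surfaceForm θ h 3 s w • y := by
    rw [← sub_eq_zero]
    refine hn.eq_zero_of_surfaceForm hc hs ?_ ?_
    · rw [map_sub, map_smul, hy1, hw, smul_eq_mul, mul_comm, sub_self]
    · rw [map_sub, map_smul, hy3, smul_eq_mul, mul_one, sub_self]
  constructor
  · intro hξ
    obtain ⟨h1, -⟩ := hl v ξ hξ
    refine ⟨h1, ?_⟩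
    have h2 := (hl v _ (Submodule.sub_mem _ hξ
      (Submodule.smul_mem _ (surfaceForm θ h 3 s ξ.1) hy))).2 (by
        simpa [sub_eq_zero] using hw _ h1)
    simp only [Prod.snd_sub, Prod.smul_snd, smul_eq_mul] at h2
    linarith
  · rintro ⟨h1, h2⟩
    have : ξ = surfaceForm θ h 3 s ξ.1 • (y, pathSlope θ h s G v y) :=
      Prod.ext (hw _ h1) (by simp [h2, mul_comm])
    rw [this]
    exact Submodule.smul_mem _ _ hy

lemma isPathGeometry_pathLine (hc : IsCoframe θ N) (hn : IsNullPatch θ N h u Ω)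
    (hl : ∀ s ∈ Ω, IsPathLineTransversalAt θ h u s)
    (hG : ∀ s ∈ Ω, IsPathConnectionAt θ h u s (Γ s)) (hΓ : ContDiffOn ℝ ∞ Γ Ω) :
    IsPathGeometry (Ω ×ˢ univ) (pathLine θ h u) fibreLine := by
  intro x hx
  have hW : IsOpen (Ω ×ˢ (univ : Set ℝ)) := hn.isOpen.prod isOpen_univ
  -- The frame of the surface dual to `ω¹` and `ω³`, and the vector `y` over a point `(s, v)`.
  let J : E2 → E2 →L[ℝ] ℝ × ℝ := fun s => (surfaceForm θ h 1 s).prod (surfaceForm θ h 3 s)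
  have hJ (s : E2) (hs : s ∈ Ω) : ∃ e : E2 ≃L[ℝ] ℝ × ℝ, (e : E2 →L[ℝ] ℝ × ℝ) = J s := by
    have hinj : Function.Injective (J s) := by
      rw [injective_iff_map_eq_zero]
      intro w hw
      exact hn.eq_zero_of_surfaceForm hc hs (congrArg Prod.fst hw) (congrArg Prod.snd hw)
    have hsurj := (LinearMap.injective_iff_surjective_of_finrank_eq_finrank
      (f := (J s).toLinearMap) (by simp)).1 hinj
    exact ⟨(LinearEquiv.ofBijective (J s).toLinearMap ⟨hinj, hsurj⟩).toContinuousLinearEquiv,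
      by ext w <;> rfl⟩
  let y : E2 × ℝ → E2 := fun q => (J q.1).inverse (q.2, 1)
  have hy (q : E2 × ℝ) (hq : q.1 ∈ Ω) :
      surfaceForm θ h 1 q.1 (y q) = q.2 ∧ surfaceForm θ h 3 q.1 (y q) = 1 := by
    obtain ⟨e, he⟩ := hJ q.1 hq
    have : J q.1 (y q) = (q.2, 1) := by
      simp only [y, ← he, ContinuousLinearMap.inverse_equiv]
      simp
    exact ⟨congrArg Prod.fst this, congrArg Prod.snd this⟩
  have hω (i : Fin 4) (q : E2 × ℝ) (hq : q.1 ∈ Ω) :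
      ContDiffAt ℝ ∞ (fun q : E2 × ℝ => surfaceForm θ h i q.1) q :=
    (hn.contDiffAt_surfaceForm hc hq i).comp q contDiffAt_fst
  have hdω (i : Fin 4) (q : E2 × ℝ) (hq : q.1 ∈ Ω) :
      ContDiffAt ℝ ∞ (fun q : E2 × ℝ => fderiv ℝ (surfaceForm θ h i) q.1) q :=
    ((hn.contDiffAt_surfaceForm hc hq i).fderiv_right (m := ∞) (by simp)).comp q contDiffAt_fst
  have hyd (q : E2 × ℝ) (hq : q.1 ∈ Ω) : ContDiffAt ℝ ∞ y q := by
    have h1 : ContDiffAt ℝ ∞ (fun q : E2 × ℝ => (J q.1).inverse) q := by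
      refine ContDiffAt.comp (g := ContinuousLinearMap.inverse) (f := fun q : E2 × ℝ => J q.1) q ?_
        ((ContinuousLinearMap.prodₗᵢ (𝕜 := ℝ) (E := E2) (F := ℝ) (G := ℝ) ℝ).contDiff.comp_contDiffAt
          (f := fun q : E2 × ℝ => (surfaceForm θ h 1 q.1, surfaceForm θ h 3 q.1)) q
          ((hω 1 q hq).prodMk (hω 3 q hq)))
      obtain ⟨e, he⟩ := hJ q.1 hq
      rw [← he]
      exact contDiffAt_map_inverse e
    exact h1.clm_apply (contDiffAt_snd.prodMk contDiffAt_const)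
  let P : E2 × ℝ → ℝ := fun q => pathSlope θ h q.1 (Γ q.1) q.2 (y q)
  have hP (q : E2 × ℝ) (hq : q.1 ∈ Ω) : ContDiffAt ℝ ∞ P q := by
    have hΓq : ContDiffAt ℝ ∞ (fun q : E2 × ℝ => Γ q.1) q :=
      (hΓ.contDiffAt (hn.isOpen.mem_nhds hq)).comp q contDiffAt_fst
    have hΓy := (hΓq.clm_apply (hyd q hq)).clm_apply (hyd q hq)
    exact (((((hdω 1 q hq).clm_apply (hyd q hq)).clm_apply (hyd q hq)).sub
      (contDiffAt_snd.mul (((hdω 3 q hq).clm_apply (hyd q hq)).clm_apply (hyd q hq))))).sub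
      (((hω 1 q hq).clm_apply hΓy).sub (contDiffAt_snd.mul ((hω 3 q hq).clm_apply hΓy)))
  let fstL := ContinuousLinearMap.fst ℝ E2 ℝ
  let sndL := ContinuousLinearMap.snd ℝ E2 ℝ
  let η : E2 × ℝ → E2 × ℝ →L[ℝ] ℝ := fun q =>
    (surfaceForm θ h 1 q.1 - q.2 • surfaceForm θ h 3 q.1).comp fstL
  have hη (q : E2 × ℝ) (hq : q.1 ∈ Ω) : ContDiffAt ℝ ∞ η q :=
    ((hω 1 q hq).sub (contDiffAt_snd.smul (hω 3 q hq))).clm_comp contDiffAt_const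
  refine ⟨Ω ×ˢ univ, hW, hx, subset_rfl, fun q => (-surfaceForm θ h 3 q.1).comp fstL, η,
    fun q => sndL - P q • (surfaceForm θ h 3 q.1).comp fstL, ?_, ?_, ?_, ?_⟩
  · exact fun q hq => ((hω 3 q hq.1).neg.clm_comp contDiffAt_const).contDiffWithinAt
  · exact fun q hq => (hη q hq.1).contDiffWithinAt
  · exact fun q hq => (contDiffAt_const.sub ((hP q hq.1).smul
      ((hω 3 q hq.1).clm_comp contDiffAt_const))).contDiffWithinAt
  rintro ⟨s, v⟩ ⟨hs, -⟩
  obtain ⟨hy1, hy3⟩ := hy (s, v) hs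
  refine ⟨⟨fun ξ ξ' hξ => ?_, fun z => ?_⟩, fun ξ => ?_, fun ξ => ?_, fun ξ ξ' hξ hξ' => ?_⟩
  · have e0 := congrFun hξ 0
    have e1 := congrFun hξ 1
    have e2 := congrFun hξ 2
    simp [η, fstL, sndL] at e0 e1 e2
    rw [e0] at e1 e2
    have : ξ.1 = ξ'.1 := by
      rw [← sub_eq_zero]
      exact hn.eq_zero_of_surfaceForm hc hs (by rw [map_sub]; linarith)
        (by rw [map_sub]; linarith)
    exact Prod.ext this (by linarith)
  · obtain ⟨w, h1, h3⟩ := hn.exists_surfaceForm hc hs (z 1 + v * -z 0) (-z 0)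
    refine ⟨(w, z 2 + P (s, v) * -z 0), ?_⟩
    ext i; fin_cases i <;> simp [η, fstL, sndL, h1, h3]
  · rw [mem_pathLine_iff hc hn hs (hl s hs) (hG s hs) hy1 hy3]
    simp [η, fstL, sndL, P, sub_eq_zero]
  · simp only [fibreLine, LinearMap.mem_ker, LinearMap.fst_apply]
    constructor
    · intro h0; simp [η, fstL, h0]
    · rintro ⟨h1, h3⟩
      simp [η, fstL] at h1 h3
      exact hn.eq_zero_of_surfaceForm hc hs (by rw [h3] at h1; linarith) h3
  · have hηd := (hη (s, v) hs).differentiableAt (by simp)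
    have hω1 := (hω 1 (s, v) hs).differentiableAt (by simp)
    have hω3 := (hω 3 (s, v) hs).differentiableAt (by simp)
    have hfst (i : Fin 4) (ζ : E2 × ℝ) : fderiv ℝ (fun q : E2 × ℝ => surfaceForm θ h i q.1) (s, v) ζ
        = fderiv ℝ (surfaceForm θ h i) s ζ.1 := by
      have := HasFDerivAt.comp (g := surfaceForm θ h i) (s, v)
        ((hn.contDiffAt_surfaceForm hc hs i).differentiableAt (by simp)).hasFDerivAt
        (hasFDerivAt_fst (𝕜 := ℝ))
      exact congrArg (fun L : E2 × ℝ →L[ℝ] _ => L ζ) this.fderiv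
    have hdη (ζ ζ' : E2 × ℝ) : fderiv ℝ η (s, v) ζ ζ'
        = fderiv ℝ (surfaceForm θ h 1) s ζ.1 ζ'.1
          - (ζ.2 * surfaceForm θ h 3 s ζ'.1 + v * fderiv ℝ (surfaceForm θ h 3) s ζ.1 ζ'.1) := by
      rw [← fderiv_clm_apply_const_apply hηd, ← hfst, ← hfst,
        ← fderiv_clm_apply_const_apply hω1, ← fderiv_clm_apply_const_apply hω3]
      have r := (((hω1.clm_apply (differentiableAt_const ζ'.1)).hasFDerivAt).sub
        ((hasFDerivAt_snd (𝕜 := ℝ) (p := (s, v))).mul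
          (hω3.clm_apply (differentiableAt_const ζ'.1)).hasFDerivAt)).fderiv
      refine (congrArg (fun L : E2 × ℝ →L[ℝ] ℝ => L ζ) r).trans ?_
      simp
      ring
    have hker (ζ : E2 × ℝ) (hζ : η (s, v) ζ = 0) : ζ.1 = surfaceForm θ h 3 s ζ.1 • y (s, v) := by
      simp [η, fstL] at hζ
      rw [← sub_eq_zero]
      refine hn.eq_zero_of_surfaceForm hc hs ?_ ?_
      · rw [map_sub, map_smul, hy1, smul_eq_mul]; linarith
      · rw [map_sub, map_smul, hy3, smul_eq_mul, mul_one, sub_self]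
    rw [dForm_eq hηd, hdη, hdη]
    have k := hker ξ hξ
    have k' := hker ξ' hξ'
    have hsymm (i : Fin 4) : fderiv ℝ (surfaceForm θ h i) s ξ.1 ξ'.1
        = fderiv ℝ (surfaceForm θ h i) s ξ'.1 ξ.1 := by
      rw [k, k']; simp; ring
    rw [hsymm, hsymm]
    simp [fstL, sndL]
    ring

/-- The derivative of the value of a 1-form on the velocity of a curve. -/
lemma hasDerivAt_surfaceForm_velocity (hc : IsCoframe θ N) (hn : IsNullPatch θ N h u Ω) {I : Set ℝ}
    {c : ℝ → E2} (hreg : IsRegularCurve Ω I c) {τ : ℝ} (hτ : τ ∈ I) (i : Fin 4) :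
    HasDerivAt (fun τ => surfaceForm θ h i (c τ) (deriv c τ))
      (fderiv ℝ (surfaceForm θ h i) (c τ) (deriv c τ) (deriv c τ)
        + surfaceForm θ h i (c τ) (deriv (deriv c) τ)) τ := by
  obtain ⟨hI, hcI, hcΩ⟩ := hreg
  have h1 : HasDerivAt c (deriv c τ) τ :=
    ((hcI.contDiffAt (hI.mem_nhds hτ)).differentiableAt (by simp)).hasDerivAt
  have h2 : HasDerivAt (deriv c) (deriv (deriv c) τ) τ :=
    (((hcI.deriv_of_isOpen (m := ∞) hI (by simp)).contDiffAt
      (hI.mem_nhds hτ)).differentiableAt (by simp)).hasDerivAt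
  have h3 := ((hn.contDiffAt_surfaceForm hc (hcΩ τ hτ).1 i).differentiableAt
    (by simp)).hasFDerivAt.comp_hasDerivAt τ h1
  exact h3.clm_apply h2

lemma isPath_iff (hc : IsCoframe θ N) (hn : IsNullPatch θ N h u Ω)
    (hl : ∀ s ∈ Ω, IsPathLineTransversalAt θ h u s)
    (hG : ∀ s ∈ Ω, IsPathConnectionAt θ h u s (Γ s)) {I : Set ℝ} {c : ℝ → E2}
    (hreg : IsRegularCurve Ω I c) :
    IsPath θ h u I c ↔ IsUnparamGeodesic Γ I c ∧ IsNowhereSingular θ h I c := by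
  have hderiv (i : Fin 4) {τ : ℝ} (hτ : τ ∈ I) := hasDerivAt_surfaceForm_velocity hc hn hreg hτ i
  obtain ⟨hI, hcI, hcΩ⟩ := hreg
  have hcd {τ : ℝ} (hτ : τ ∈ I) : HasDerivAt c (deriv c τ) τ :=
    ((hcI.contDiffAt (hI.mem_nhds hτ)).differentiableAt (by simp)).hasDerivAt
  have hns : IsNowhereSingular θ h I c ↔
      ∀ τ ∈ I, surfaceForm θ h 3 (c τ) (deriv c τ) ≠ 0 := by
    refine forall₂_congr fun τ hτ => not_congr ⟨fun hh => hh.2, fun hh => ⟨?_, hh⟩⟩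
    have := (hn.inRulingPlane (hcΩ τ hτ).1 (deriv c τ)).2
    rw [← surfaceForm_apply θ h 3, hh] at this
    simpa using this
  -- The characteristic direction over the velocity of a curve with `ω¹ = v ω³`.
  have hchar {τ v κ : ℝ} (hτ : τ ∈ I) (h3 : surfaceForm θ h 3 (c τ) (deriv c τ) ≠ 0)
      (h1 : surfaceForm θ h 1 (c τ) (deriv c τ) = v * surfaceForm θ h 3 (c τ) (deriv c τ)) :
      (deriv c τ, κ) ∈ pathLine θ h u (c τ, v) ↔ κ * surfaceForm θ h 3 (c τ) (deriv c τ)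
        = pathSlope θ h (c τ) (Γ (c τ)) v (deriv c τ) := by
    set r := surfaceForm θ h 3 (c τ) (deriv c τ) with hr
    have hy1 : surfaceForm θ h 1 (c τ) (r⁻¹ • deriv c τ) = v := by
      rw [map_smul, h1, smul_eq_mul]; field_simp
    have hy3 : surfaceForm θ h 3 (c τ) (r⁻¹ • deriv c τ) = 1 := by
      rw [map_smul, ← hr, smul_eq_mul]; field_simp
    rw [mem_pathLine_iff hc hn (hcΩ τ hτ).1 (hl _ (hcΩ τ hτ).1) (hG _ (hcΩ τ hτ).1) hy1 hy3]
    have e : pathSlope θ h (c τ) (Γ (c τ)) v (r⁻¹ • deriv c τ)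
        = r⁻¹ * r⁻¹ * pathSlope θ h (c τ) (Γ (c τ)) v (deriv c τ) := by
      simp [pathSlope]; ring
    rw [e]
    simp only [h1, true_and, ← hr]
    constructor
    · intro hh; rw [hh]; field_simp
    · intro hh; rw [← hh]; field_simp
  rw [hns]
  constructor
  · rintro ⟨v, hv, hpath⟩
    have hvd {τ : ℝ} (hτ : τ ∈ I) : HasDerivAt v (deriv v τ) τ :=
      ((hv.contDiffAt (hI.mem_nhds hτ)).differentiableAt (by simp)).hasDerivAt
    have hpath' (τ : ℝ) (hτ : τ ∈ I) :
        (deriv c τ, deriv v τ) ∈ pathLine θ h u (c τ, v τ) := by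
      have := hpath τ hτ
      rwa [((hcd hτ).prodMk (hvd hτ)).deriv] at this
    have h1 (τ : ℝ) (hτ : τ ∈ I) := (hl _ (hcΩ τ hτ).1 _ _ (hpath' τ hτ)).1
    have h3 (τ : ℝ) (hτ : τ ∈ I) : surfaceForm θ h 3 (c τ) (deriv c τ) ≠ 0 := fun h3 =>
      (hcΩ τ hτ).2 (hn.eq_zero_of_surfaceForm hc (hcΩ τ hτ).1 (by
        have := h1 τ hτ
        dsimp only at this
        rw [this, h3, mul_zero]) h3)
    refine ⟨fun τ hτ => ?_, h3⟩
    have hslope := (hchar hτ (h3 τ hτ) (h1 τ hτ)).1 (hpath' τ hτ)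
    have hd : deriv (fun τ => surfaceForm θ h 1 (c τ) (deriv c τ)) τ
        = deriv (fun τ => v τ * surfaceForm θ h 3 (c τ) (deriv c τ)) τ := by
      refine Filter.EventuallyEq.deriv_eq ?_
      filter_upwards [hI.mem_nhds hτ] with τ' hτ' using h1 τ' hτ'
    rw [(hderiv 1 hτ).deriv, ((hvd hτ).fun_mul (hderiv 3 hτ)).deriv] at hd
    rw [pathSlope] at hslope
    set a := deriv (deriv c) τ + Γ (c τ) (deriv c τ) (deriv c τ) with ha
    have ha1 : surfaceForm θ h 1 (c τ) a = v τ * surfaceForm θ h 3 (c τ) a := by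
      rw [ha, map_add, map_add]; linarith
    refine ⟨surfaceForm θ h 3 (c τ) a / surfaceForm θ h 3 (c τ) (deriv c τ), ?_⟩
    rw [← sub_eq_zero]
    have h1' := h1 τ hτ
    dsimp only at h1'
    have h3' := h3 τ hτ
    refine hn.eq_zero_of_surfaceForm hc (hcΩ τ hτ).1 ?_ ?_
    · rw [map_sub, map_smul, ha1, h1', smul_eq_mul]; field_simp; ring
    · rw [map_sub, map_smul, smul_eq_mul]; field_simp; ring
  · rintro ⟨hgeo, h3⟩
    have hcd' : ContDiffOn ℝ ∞ (deriv c) I := hcI.deriv_of_isOpen hI (by simp)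
    have hω (i : Fin 4) : ContDiffOn ℝ ∞ (fun τ => surfaceForm θ h i (c τ) (deriv c τ)) I := by
      intro τ hτ
      have := (hn.contDiffAt_surfaceForm hc (hcΩ τ hτ).1 i).comp τ
        (hcI.contDiffAt (hI.mem_nhds hτ))
      exact (this.clm_apply (hcd'.contDiffAt (hI.mem_nhds hτ))).contDiffWithinAt
    let v : ℝ → ℝ := fun τ => surfaceForm θ h 1 (c τ) (deriv c τ)
      / surfaceForm θ h 3 (c τ) (deriv c τ)
    have hv : ContDiffOn ℝ ∞ v I := (hω 1).div (hω 3) h3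
    refine ⟨v, hv, fun τ hτ => ?_⟩
    have h3' := h3 τ hτ
    have h1' : surfaceForm θ h 1 (c τ) (deriv c τ) = v τ * surfaceForm θ h 3 (c τ) (deriv c τ) := by
      simp only [v]; field_simp
    have hvd := (hderiv 1 hτ).fun_div (hderiv 3 hτ) h3'
    have hvd' : HasDerivAt v _ τ := hvd
    rw [((hcd hτ).prodMk hvd').deriv, hchar hτ h3' h1', pathSlope]
    obtain ⟨k, hk⟩ := hgeo τ hτ
    have hk' : deriv (deriv c) τ = k • deriv c τ - Γ (c τ) (deriv c τ) (deriv c τ) :=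
      eq_sub_of_add_eq hk
    rw [hk', map_sub, map_sub, map_smul, map_smul, smul_eq_mul, smul_eq_mul, h1']
    field_simp
    ring

end PathGeometry

/-! ### Uniqueness and convexity of the connections -/

section Connections

variable {θ : E4 → E4 →L[ℝ] (Fin 4 → ℝ)} {N : Set E4} {h : E2 → E4} {u : E2 → ℝ} {Ω : Set E2}
  {s : E2} {G G' : E2 →L[ℝ] E2 →L[ℝ] E2}

lemma convex_isPathConnectionAt (θ : E4 → E4 →L[ℝ] (Fin 4 → ℝ)) (h : E2 → E4) (u : E2 → ℝ)
    (s : E2) : Convex ℝ {G | IsPathConnectionAt θ h u s G} := by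
  intro G hG G' hG' t t' _ _ htt v y hy1 hy3
  have e : (y, pathSlope θ h s (t • G + t' • G') v y)
      = t • (y, pathSlope θ h s G v y) + t' • (y, pathSlope θ h s G' v y) := by
    refine Prod.ext ?_ ?_
    · simp [← add_smul, htt]
    · simp only [pathSlope, add_apply, smul_apply, map_add, map_smul, smul_eq_mul, Prod.snd_add,
        Prod.smul_snd]
      linear_combination (-(fderiv ℝ (surfaceForm θ h 1) s y y)
        + v * fderiv ℝ (surfaceForm θ h 3) s y y) * htt
  rw [e]
  exact Submodule.add_mem _ (Submodule.smul_mem _ _ (hG v y hy1 hy3))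
    (Submodule.smul_mem _ _ (hG' v y hy1 hy3))

/-- Two connections whose geodesics have characteristic lifts are projectively equivalent. -/
lemma IsPathConnectionAt.exists_smul_add (hc : IsCoframe θ N) (hn : IsNullPatch θ N h u Ω)
    (hs : s ∈ Ω) (hl : IsPathLineTransversalAt θ h u s) (hG : IsPathConnectionAt θ h u s G)
    (hG' : IsPathConnectionAt θ h u s G') (w : E2) : ∃ k : ℝ, G w w = G' w w + k • w := by
  set ω1 := surfaceForm θ h 1 s with hω1
  set ω3 := surfaceForm θ h 3 s with hω3
  let F : E2 → ℝ := fun w => ω3 w * ω1 (G w w - G' w w) - ω1 w * ω3 (G w w - G' w w)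
  have hF (w : E2) (hw : ω3 w ≠ 0) : F w = 0 := by
    have h3 : surfaceForm θ h 3 s ((ω3 w)⁻¹ • w) = 1 := by
      rw [map_smul, ← hω3, smul_eq_mul]; field_simp
    have := pathSlope_eq_of_isPathConnectionAt hl (hG _ _ rfl h3) (hG' _ _ rfl h3)
    simp only [pathSlope, map_smul, smul_apply, smul_eq_mul, ← hω1, ← hω3] at this
    simp only [F, map_sub]
    field_simp at this
    linear_combination -this
  have hF0 (w : E2) : F w = 0 := by
    obtain ⟨y, -, hy3⟩ := hn.exists_surfaceForm hc hs 0 1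
    by_cases hw : ω3 w = 0
    · have hcont : Continuous fun t : ℝ => F (w + t • y) := by
        simp only [F]; fun_prop
      have := congrFun (hcont.ext_on (dense_compl_singleton (0 : ℝ)) continuous_const
        fun t ht => hF _ (by
          rw [map_add, map_smul, hw, hy3, smul_eq_mul, mul_one, zero_add]; exact ht)) 0
      simpa using this
    · exact hF w hw
  have hw := hF0 w
  simp only [F] at hw
  by_cases h3 : ω3 w = 0
  · by_cases h1 : ω1 w = 0
    · obtain rfl := hn.eq_zero_of_surfaceForm hc hs h1 h3
      exact ⟨0, by simp⟩
    · refine ⟨ω1 (G w w - G' w w) / ω1 w, ?_⟩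
      rw [h3, zero_mul, zero_sub, neg_eq_zero] at hw
      have hw' := (mul_eq_zero.1 hw).resolve_left h1
      rw [← sub_eq_zero, ← sub_sub]
      refine hn.eq_zero_of_surfaceForm hc hs ?_ ?_
      · rw [map_sub, map_smul, ← hω1, smul_eq_mul]; field_simp; ring
      · rw [map_sub, map_smul, ← hω3, hw', h3]; simp
  · refine ⟨ω3 (G w w - G' w w) / ω3 w, ?_⟩
    rw [← sub_eq_zero, ← sub_sub]
    refine hn.eq_zero_of_surfaceForm hc hs ?_ ?_
    · rw [map_sub, map_smul, ← hω1, smul_eq_mul]; field_simp; linarith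
    · rw [map_sub, map_smul, ← hω3, smul_eq_mul]; field_simp; ring

end Connections

/-! ### Projective charts -/

section Projective

/-- Inflection points are projective notions: they do not depend on the choice of the homogeneous
coordinates. -/
lemma IsInflectionalAt.smul {g : E2 → E3} {f : E2 → ℝ} {G : E2 →L[ℝ] E2 →L[ℝ] E2} {s : E2}
    (hg : ContDiffAt ℝ ∞ g s) (hf : ContDiffAt ℝ ∞ f s) (hfs : f s ≠ 0)
    (H : IsInflectionalAt g G s) : IsInflectionalAt (fun s => f s • g s) G s := by
  intro w
  obtain ⟨c, c', hc⟩ := H w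
  have hfd := hf.differentiableAt (by simp)
  have hgd := hg.differentiableAt (by simp)
  have hdf : DifferentiableAt ℝ (fderiv ℝ f) s :=
    (hf.fderiv_right (m := ∞) (by simp)).differentiableAt (by simp)
  have hdg : DifferentiableAt ℝ (fderiv ℝ g) s :=
    (hg.fderiv_right (m := ∞) (by simp)).differentiableAt (by simp)
  have e1 {s' : E2} (h1 : DifferentiableAt ℝ f s') (h2 : DifferentiableAt ℝ g s') (w : E2) :
      fderiv ℝ (fun s => f s • g s) s' w = fderiv ℝ f s' w • g s' + f s' • fderiv ℝ g s' w := by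
    rw [fderiv_fun_smul h1 h2]; simp [add_comm]
  have e2 : fderiv ℝ (fderiv ℝ fun s => f s • g s) s w w
      = fderiv ℝ (fderiv ℝ f) s w w • g s + (2 * fderiv ℝ f s w) • fderiv ℝ g s w
        + f s • fderiv ℝ (fderiv ℝ g) s w w := by
    have hd : DifferentiableAt ℝ (fderiv ℝ fun s => f s • g s) s :=
      ((hf.smul hg).fderiv_right (m := ∞) (by simp)).differentiableAt (by simp)
    rw [← fderiv_clm_apply_const_apply hd]
    have e : (fun s' => fderiv ℝ (fun s => f s • g s) s' w) =ᶠ[𝓝 s]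
        fun s' => fderiv ℝ f s' w • g s' + f s' • fderiv ℝ g s' w := by
      filter_upwards [(hf.of_le (m := 1) (by simp)).eventually (by simp),
        (hg.of_le (m := 1) (by simp)).eventually (by simp)] with s' h1 h2
      exact e1 (h1.differentiableAt (by simp)) (h2.differentiableAt (by simp)) w
    have d1 := hdf.clm_apply (differentiableAt_const w)
    have d2 := hdg.clm_apply (differentiableAt_const w)
    rw [e.fderiv_eq, fderiv_fun_add (d1.fun_smul hgd) (hfd.fun_smul d2), fderiv_fun_smul d1 hgd,
      fderiv_fun_smul hfd d2]
    simp only [add_apply, smul_apply, ContinuousLinearMap.smulRight_apply,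
      fderiv_clm_apply_const_apply hdf, fderiv_clm_apply_const_apply hdg]
    module
  refine ⟨(f s * c + 2 * fderiv ℝ f s w) / f s,
    (fderiv ℝ (fderiv ℝ f) s w w + f s * c' - fderiv ℝ f s (G w w)
      - (f s * c + 2 * fderiv ℝ f s w) / f s * fderiv ℝ f s w) / f s, ?_⟩
  rw [e2, hc, e1 hfd hgd, e1 hfd hgd]
  match_scalars <;> field_simp <;> ring

/-- An immersion of a surface into a projective plane provides coordinates and a flat connection
whose geodesics are mapped to straight lines. -/
lemma exists_projective_chart {g : E2 → E3} {Ω : Set E2} (hΩ : IsOpen Ω)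
    (hg : ∀ s ∈ Ω, ContDiffAt ℝ ∞ g s)
    (hind : ∀ s ∈ Ω, ∀ (c : ℝ) (w : E2), c • g s + fderiv ℝ g s w = 0 → c = 0 ∧ w = 0)
    {s₀ : E2} (hs₀ : s₀ ∈ Ω) :
    ∃ (ψ : OpenPartialHomeomorph E2 E2) (Γ : E2 → E2 →L[ℝ] E2 →L[ℝ] E2),
      s₀ ∈ ψ.source ∧ ψ.source ⊆ Ω ∧ ContDiffOn ℝ ∞ ψ ψ.source ∧
      ContDiffOn ℝ ∞ ψ.symm ψ.target ∧ IsTorsionFreeConnection ψ.source Γ ∧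
      ∀ s ∈ ψ.source, Function.Injective (fderiv ℝ ψ s) ∧
        (∀ w w', fderiv ℝ ψ s (Γ s w w') = fderiv ℝ (fderiv ℝ ψ) s w w') ∧
        IsInflectionalAt g (Γ s) s := by
  -- Homogeneous coordinates in which the surface is tangent to the plane `{1} × ℝ²` to first
  -- order.
  let L' : ℝ × E2 →ₗ[ℝ] E3 := (LinearMap.toSpanSingleton ℝ E3 (g s₀)).coprod
    (fderiv ℝ g s₀).toLinearMap
  have hinj : Function.Injective L' := by
    rw [injective_iff_map_eq_zero]
    rintro ⟨c, w⟩ hcw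
    obtain ⟨rfl, rfl⟩ := hind s₀ hs₀ c w (by simpa [L'] using hcw)
    rfl
  have hsurj := (LinearMap.injective_iff_surjective_of_finrank_eq_finrank (by simp)).1 hinj
  let L : (ℝ × E2) ≃L[ℝ] E3 := (LinearEquiv.ofBijective L' ⟨hinj, hsurj⟩).toContinuousLinearEquiv
  have hL (c : ℝ) (w : E2) : L (c, w) = c • g s₀ + fderiv ℝ g s₀ w := by
    change L' (c, w) = _; simp [L']
  let ε₀ : E3 →L[ℝ] ℝ := (ContinuousLinearMap.fst ℝ ℝ E2).comp (L.symm : E3 →L[ℝ] ℝ × E2)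
  let ε : E3 →L[ℝ] E2 := (ContinuousLinearMap.snd ℝ ℝ E2).comp (L.symm : E3 →L[ℝ] ℝ × E2)
  have hε (z : E3) : z = L (ε₀ z, ε z) := (L.apply_symm_apply z).symm
  have hsg : L.symm (g s₀) = (1, 0) := by
    rw [ContinuousLinearEquiv.symm_apply_eq, hL]; simp
  have hsd (w : E2) : L.symm (fderiv ℝ g s₀ w) = (0, w) := by
    rw [ContinuousLinearEquiv.symm_apply_eq, hL]; simp
  have hε₀g : ε₀ (g s₀) = 1 := congrArg Prod.fst hsg
  have hεg : ε (g s₀) = 0 := congrArg Prod.snd hsg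
  have hεd (w : E2) : ε (fderiv ℝ g s₀ w) = w := congrArg Prod.snd (hsd w)
  let f : E2 → ℝ := fun s => ε₀ (g s)
  let ψ : E2 → E2 := fun s => (f s)⁻¹ • ε (g s)
  have hf {s : E2} (hs : s ∈ Ω) : ContDiffAt ℝ ∞ f s := ε₀.contDiff.comp_contDiffAt s (hg s hs)
  have hψ {s : E2} (hs : s ∈ Ω) (h0 : f s ≠ 0) : ContDiffAt ℝ ∞ ψ s :=
    ((hf hs).inv h0).smul (ε.contDiff.comp_contDiffAt s (hg s hs))
  have hf0 : f s₀ ≠ 0 := by rw [show f s₀ = 1 from hε₀g]; exact one_ne_zero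
  have hψd : HasFDerivAt ψ ((ContinuousLinearEquiv.refl ℝ E2 : E2 ≃L[ℝ] E2) : E2 →L[ℝ] E2) s₀ := by
    have h1 : HasFDerivAt (fun s => ε (g s)) (ε.comp (fderiv ℝ g s₀)) s₀ :=
      ε.hasFDerivAt.comp s₀ ((hg s₀ hs₀).differentiableAt (by simp)).hasFDerivAt
    have h2 : DifferentiableAt ℝ (fun s => (f s)⁻¹) s₀ :=
      ((hf hs₀).inv hf0).differentiableAt (by simp)
    refine (h2.hasFDerivAt.smul h1).congr_fderiv ?_
    ext1 w
    simp only [add_apply, smul_apply, ContinuousLinearMap.smulRight_apply, hεg, smul_zero, add_zero,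
      ContinuousLinearMap.comp_apply, hεd]
    rw [show f s₀ = 1 from hε₀g]; simp
  let e₀ := (hψ hs₀ hf0).toOpenPartialHomeomorph ψ hψd (by simp)
  -- The neighbourhood on which everything is defined.
  have hev : ∀ᶠ s in 𝓝 s₀, s ∈ Ω ∧ f s ≠ 0 ∧
      fderiv ℝ ψ s ∈ range ((↑) : (E2 ≃L[ℝ] E2) → E2 →L[ℝ] E2) := by
    have hΩ₀ : ∀ᶠ s in 𝓝 s₀, s ∈ Ω := hΩ.mem_nhds hs₀
    refine hΩ₀.and (((hf hs₀).continuousAt.eventually_ne hf0).and ?_)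
    refine ((hψ hs₀ hf0).fderiv_right (m := ∞) (by simp)).continuousAt.eventually_mem ?_
    rw [hψd.fderiv]; exact ContinuousLinearEquiv.nhds _
  obtain ⟨W, hW, hWo, hsW⟩ := mem_nhds_iff.1 hev
  let e := e₀.restrOpen W hWo
  have he : (e : E2 → E2) = ψ := rfl
  have hes : e.source ⊆ W := fun s hs => hs.2
  have hinv (s : E2) (hs : s ∈ W) : ContDiffAt ℝ ∞ (fun s => (fderiv ℝ ψ s).inverse) s := by
    obtain ⟨h1, h2, h3, hE⟩ := hW hs
    refine ContDiffAt.comp (g := ContinuousLinearMap.inverse) s ?_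
      ((hψ h1 h2).fderiv_right (m := ∞) (by simp))
    rw [← hE]; exact contDiffAt_map_inverse h3
  refine ⟨e, fun s => (ContinuousLinearMap.compL ℝ E2 E2 E2 (fderiv ℝ ψ s).inverse).comp
    (fderiv ℝ (fderiv ℝ ψ) s), ⟨?_, hsW⟩, fun s hs => (hW (hes hs)).1,
    fun s hs => ?_, fun t ht => ?_, ⟨fun s hs => ?_, fun s hs w w' => ?_⟩, fun s hs => ?_⟩
  · exact (hψ hs₀ hf0).mem_toOpenPartialHomeomorph_source hψd (by simp)
  · obtain ⟨h1, h2, -⟩ := hW (hes hs)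
    exact (hψ h1 h2).contDiffWithinAt
  · obtain ⟨h1, h2, h3, hE⟩ := hW (hes (e.map_target ht))
    refine (e.contDiffAt_symm (f₀' := h3) ht ?_ (hψ h1 h2)).contDiffWithinAt
    rw [he, hE]
    exact ((hψ h1 h2).differentiableAt (by simp)).hasFDerivAt
  · obtain ⟨h1, h2, -⟩ := hW (hes hs)
    have hd2 : ContDiffAt ℝ ∞ (fderiv ℝ (fderiv ℝ ψ)) s :=
      ((hψ h1 h2).fderiv_right (m := ∞) (by simp)).fderiv_right (m := ∞) (by simp)
    exact ((((ContinuousLinearMap.compL ℝ E2 E2 E2).contDiff.comp_contDiffAt s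
      (hinv s (hes hs))).clm_comp hd2)).contDiffWithinAt
  · obtain ⟨h1, h2, -⟩ := hW (hes hs)
    change (fderiv ℝ ψ s).inverse (fderiv ℝ (fderiv ℝ ψ) s w w')
      = (fderiv ℝ ψ s).inverse (fderiv ℝ (fderiv ℝ ψ) s w' w)
    rw [fderiv_fderiv_symm ((hψ h1 h2).of_le (by norm_cast))]
  · obtain ⟨h1, h2, h3, hE⟩ := hW (hes hs)
    have hΓ (w w' : E2) : fderiv ℝ ψ s ((fderiv ℝ ψ s).inverse (fderiv ℝ (fderiv ℝ ψ) s w w'))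
        = fderiv ℝ (fderiv ℝ ψ) s w w' := by
      rw [← hE]; simp
    refine ⟨?_, hΓ, ?_⟩
    · rw [he, ← hE]; exact h3.injective
    -- The surface is the graph of `ψ` in the affine chart, up to the factor `f`.
    let A : E2 →L[ℝ] E3 := (L : ℝ × E2 →L[ℝ] E3).comp (ContinuousLinearMap.inr ℝ ℝ E2)
    let g' : E2 → E3 := fun s => g s₀ + A (ψ s)
    have hA (w : E2) : A w = L (0, w) := rfl
    have hg'd {s : E2} (hs : s ∈ W) : fderiv ℝ g' s = A.comp (fderiv ℝ ψ s) := by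
      obtain ⟨h1, h2, -⟩ := hW hs
      have := (A.hasFDerivAt.comp s
        ((hψ h1 h2).differentiableAt (by simp)).hasFDerivAt).const_add (g s₀)
      exact this.fderiv
    have hg'dd (w : E2) : fderiv ℝ (fderiv ℝ g') s w w = A (fderiv ℝ (fderiv ℝ ψ) s w w) := by
      have ev : fderiv ℝ g' =ᶠ[𝓝 s] fun s => A.comp (fderiv ℝ ψ s) := by
        filter_upwards [hWo.mem_nhds (hes hs)] with s' hs' using hg'd hs'
      have hdψ : DifferentiableAt ℝ (fderiv ℝ ψ) s :=
        ((hψ h1 h2).fderiv_right (m := ∞) (by simp)).differentiableAt (by simp)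
      rw [ev.fderiv_eq]
      have := ((ContinuousLinearMap.compL ℝ E2 E2 E3 A).hasFDerivAt.comp s hdψ.hasFDerivAt).fderiv
      exact congrArg (fun B : E2 →L[ℝ] E2 →L[ℝ] E3 => B w w) this
    have hinf : IsInflectionalAt g' ((ContinuousLinearMap.compL ℝ E2 E2 E2
        (fderiv ℝ ψ s).inverse).comp (fderiv ℝ (fderiv ℝ ψ) s)) s := by
      intro w
      refine ⟨0, 0, ?_⟩
      rw [hg'dd, hg'd (hes hs), zero_smul, zero_smul, add_zero, add_zero]
      exact congrArg A (hΓ w w).symm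
    have hg's : ContDiffAt ℝ ∞ g' s :=
      contDiffAt_const.add (A.contDiff.comp_contDiffAt s (hψ h1 h2))
    have hev : g =ᶠ[𝓝 s] fun s => f s • g' s := by
      filter_upwards [hWo.mem_nhds (hes hs)] with s' hs'
      obtain ⟨-, h2', -⟩ := hW hs'
      have : g' s' = L (1, ψ s') := by
        simp only [g', hA]
        rw [show g s₀ = L (1, 0) by rw [hL]; simp, ← map_add]; simp
      rw [this, ← map_smul]
      conv_lhs => rw [hε (g s')]
      congr 1
      refine Prod.ext ?_ ?_
      · simp [f]
      · simp [ψ, smul_smul, h2']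
    have := hinf.smul hg's (hf h1) h2
    intro w
    obtain ⟨c, c', hcc⟩ := this w
    refine ⟨c, c', ?_⟩
    rw [hev.fderiv.fderiv_eq, hev.fderiv_eq, hev.self_of_nhds]
    exact hcc

/-- The geodesics of a connection that is projectively equivalent to the pullback `Γ` of the flat
connection are mapped to the straight lines. -/
lemma isUnparamGeodesic_iff_comp {ψ : OpenPartialHomeomorph E2 E2}
    {Γ Γ' : E2 → E2 →L[ℝ] E2 →L[ℝ] E2} (hψ : ContDiffOn ℝ ∞ ψ ψ.source)
    (hinj : ∀ s ∈ ψ.source, Function.Injective (fderiv ℝ ψ s))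
    (hΓ : ∀ s ∈ ψ.source, ∀ w, fderiv ℝ ψ s (Γ s w w) = fderiv ℝ (fderiv ℝ ψ) s w w)
    (hΓ' : ∀ s ∈ ψ.source, ∀ w, ∃ k : ℝ, Γ' s w w = Γ s w w + k • w)
    {I : Set ℝ} {c : ℝ → E2} (hreg : IsRegularCurve ψ.source I c) :
    IsUnparamGeodesic Γ' I c ↔ IsUnparamGeodesic (fun _ => 0) I (ψ ∘ c) := by
  obtain ⟨hI, hcI, hcΩ⟩ := hreg
  refine forall₂_congr fun τ hτ => ?_
  have hcd {τ : ℝ} (hτ : τ ∈ I) : HasDerivAt c (deriv c τ) τ :=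
    ((hcI.contDiffAt (hI.mem_nhds hτ)).differentiableAt (by simp)).hasDerivAt
  have hcdd : HasDerivAt (deriv c) (deriv (deriv c) τ) τ :=
    (((hcI.deriv_of_isOpen (m := ∞) hI (by simp)).contDiffAt
      (hI.mem_nhds hτ)).differentiableAt (by simp)).hasDerivAt
  have hψs {s : E2} (hs : s ∈ ψ.source) : ContDiffAt ℝ ∞ ψ s :=
    hψ.contDiffAt (ψ.open_source.mem_nhds hs)
  have hd1 {τ : ℝ} (hτ : τ ∈ I) : deriv (ψ ∘ c) τ = fderiv ℝ ψ (c τ) (deriv c τ) :=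
    (((hψs (hcΩ τ hτ).1).differentiableAt (by simp)).hasFDerivAt.comp_hasDerivAt τ
      (hcd hτ)).deriv
  have hs := (hcΩ τ hτ).1
  have hd2 : deriv (deriv (ψ ∘ c)) τ = fderiv ℝ ψ (c τ)
      (deriv (deriv c) τ + Γ (c τ) (deriv c τ) (deriv c τ)) := by
    have ev : deriv (ψ ∘ c) =ᶠ[𝓝 τ] fun τ => fderiv ℝ ψ (c τ) (deriv c τ) := by
      filter_upwards [hI.mem_nhds hτ] with τ' hτ' using hd1 hτ'
    have hdψ : DifferentiableAt ℝ (fderiv ℝ ψ) (c τ) :=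
      ((hψs hs).fderiv_right (m := ∞) (by simp)).differentiableAt (by simp)
    have hd := (hdψ.hasFDerivAt.comp_hasDerivAt τ (hcd hτ)).clm_apply hcdd
    rw [ev.deriv_eq]
    refine (HasDerivAt.deriv hd).trans ?_
    rw [map_add, hΓ _ hs, add_comm]
    rfl
  obtain ⟨k₀, hk₀⟩ := hΓ' (c τ) hs (deriv c τ)
  rw [hd1 hτ, hd2]
  simp only [zero_apply, add_zero]
  constructor
  · rintro ⟨k, hk⟩
    refine ⟨k - k₀, ?_⟩
    rw [← map_smul, sub_smul, ← hk, hk₀]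
    congr 1; abel
  · rintro ⟨k, hk⟩
    rw [← map_smul] at hk
    refine ⟨k + k₀, ?_⟩
    rw [hk₀, ← add_assoc, hinj _ hs hk, add_smul]

end Projective

/-! ### Change of the adapted coframe -/

section ChangeOfCoframe

variable {θ₀ θ : E4 → E4 →L[ℝ] (Fin 4 → ℝ)} {N₀ N O : Set E4} {k : E4 → E4}

lemma IsCoframe.exists_equiv (hc : IsCoframe θ N) {p : E4} (hp : p ∈ N) :
    ∃ e : E4 ≃L[ℝ] (Fin 4 → ℝ), (e : E4 →L[ℝ] (Fin 4 → ℝ)) = θ p :=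
  ⟨(LinearEquiv.ofBijective (θ p).toLinearMap (hc.bijective p hp)).toContinuousLinearEquiv,
    by ext1 w; rfl⟩

/-- A change of coordinates between two adapted coframes induces a change of the parameter of the
ruling planes. -/
structure IsCoframeChange (θ₀ θ : E4 → E4 →L[ℝ] (Fin 4 → ℝ)) (O : Set E4) (k : E4 → E4)
    (μ : E4 × ℝ → ℝ) : Prop where
  isOpen : IsOpen O
  smooth : ContDiffOn ℝ ∞ k O
  bijective : ∀ p ∈ O, Function.Bijective (fderiv ℝ k p)
  smooth_param : ∀ q : E4 × ℝ, q.1 ∈ O → ContDiffAt ℝ ∞ μ q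
  fibre : ∀ q : E4 × ℝ, q.1 ∈ O → fderiv ℝ μ q (0, 1) ≠ 0
  ruling : ∀ q : E4 × ℝ, q.1 ∈ O → ∀ y,
    InRulingPlane (μ q) (θ₀ (k q.1) (fderiv ℝ k q.1 y)) ↔ InRulingPlane q.2 (θ q.1 y)

lemma exists_isCoframeChange (hc₀ : IsCoframe θ₀ N₀) (hc : IsCoframe θ N) (hO : IsOpen O)
    (hON : O ⊆ N) (hk : ContDiffOn ℝ ∞ k O) (hkN : MapsTo k O N₀)
    (hkb : ∀ p ∈ O, Function.Bijective (fderiv ℝ k p))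
    (hcone : ∀ p ∈ O, ∀ y, cayleyCubic (θ₀ (k p) (fderiv ℝ k p y)) = 0 ↔ cayleyCubic (θ p y) = 0) :
    ∃ μ, IsCoframeChange θ₀ θ O k μ := by
  let B : E4 → (Fin 4 → ℝ) →L[ℝ] (Fin 4 → ℝ) := fun p =>
    (θ₀ (k p)).comp ((fderiv ℝ k p).comp (θ p).inverse)
  have hBθ (p : E4) (hp : p ∈ O) (y : E4) : B p (θ p y) = θ₀ (k p) (fderiv ℝ k p y) := by
    obtain ⟨e, he⟩ := hc.exists_equiv (hON hp)
    simp only [B, ← he, ContinuousLinearMap.inverse_equiv]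
    simp
  have hB (p : E4) (hp : p ∈ O) : ContDiffAt ℝ ∞ B p := by
    have hkp := hk.contDiffAt (hO.mem_nhds hp)
    have h1 : ContDiffAt ℝ ∞ (fun p => (θ p).inverse) p := by
      refine ContDiffAt.comp (g := ContinuousLinearMap.inverse) p ?_ (hc.contDiffAt (hON hp))
      obtain ⟨e, he⟩ := hc.exists_equiv (hON hp)
      rw [← he]; exact contDiffAt_map_inverse e
    exact ((hc₀.contDiffAt (hkN hp)).comp p hkp).clm_comp
      ((hkp.fderiv_right (m := ∞) (by simp)).clm_comp h1)
  have hmap (p : E4) (hp : p ∈ O) : B p ![1, 0, 0, 0] 0 ≠ 0 ∧ B p ![0, 1, 0, 0] 1 ≠ 0 ∧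
      ∀ u y, InRulingPlane (rulingMap (B p).toLinearMap u) (B p y) ↔ InRulingPlane u y := by
    have hbij : Function.Bijective (B p) := by
      obtain ⟨e, he⟩ := hc.exists_equiv (hON hp)
      have : (B p : (Fin 4 → ℝ) → (Fin 4 → ℝ)) = θ₀ (k p) ∘ fderiv ℝ k p ∘ e.symm := by
        ext1 y; simp only [B, ← he, ContinuousLinearMap.inverse_equiv]; rfl
      rw [this]
      exact (hc₀.bijective _ (hkN hp)).comp ((hkb p hp).comp e.symm.bijective)
    refine inRulingPlane_rulingMap (B := LinearEquiv.ofBijective (B p).toLinearMap hbij) fun y => ?_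
    obtain ⟨z, rfl⟩ := (hc.bijective p (hON hp)).2 y
    change cayleyCubic (B p (θ p z)) = 0 ↔ _
    rw [hBθ p hp, hcone p hp]
  have hBc (z : Fin 4 → ℝ) (i : Fin 4) (q : E4 × ℝ) (hq : q.1 ∈ O) :
      ContDiffAt ℝ ∞ (fun q : E4 × ℝ => B q.1 z i) q := by
    have h1 : ContDiffAt ℝ ∞ (fun q : E4 × ℝ => B q.1 z) q :=
      ((hB q.1 hq).comp q contDiffAt_fst).clm_apply contDiffAt_const
    exact contDiffAt_pi.1 h1 i
  have hμ (q : E4 × ℝ) (hq : q.1 ∈ O) :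
      ContDiffAt ℝ ∞ (fun q : E4 × ℝ => rulingMap (B q.1).toLinearMap q.2) q :=
    (((hBc ![1, 0, 0, 0] 0 q hq).mul contDiffAt_snd).sub (hBc ![0, 1, 0, 0] 0 q hq)).div
      (hBc ![0, 1, 0, 0] 1 q hq) (hmap q.1 hq).2.1
  refine ⟨fun q => rulingMap (B q.1).toLinearMap q.2, hO, hk, hkb, hμ, fun q hq => ?_,
    fun q hq y => ?_⟩
  · obtain ⟨p, u⟩ := q
    obtain ⟨h0, h1, -⟩ := hmap p hq
    rw [fderiv_prod_snd_eq_deriv ((hμ (p, u) hq).differentiableAt (by simp))]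
    have hd := (((hasDerivAt_id u).const_mul (B p ![1, 0, 0, 0] 0)).sub_const
      (B p ![0, 1, 0, 0] 0)).div_const (B p ![0, 1, 0, 0] 1)
    have hd' : HasDerivAt (fun r => rulingMap (B p).toLinearMap r) _ u := hd
    rw [hd'.deriv, mul_one]
    exact div_ne_zero h0 h1
  · rw [← hBθ q.1 hq]
    exact (hmap q.1 hq).2.2 _ _

namespace IsCoframeChange

variable {μ : E4 × ℝ → ℝ} {h₀ h : E2 → E4} {u₀ u : E2 → ℝ} {Ω₀ Ω : Set E2}
  {Q₀ : Set (E4 × ℝ)} {T₀ : E4 × ℝ → E3} (K : IsCoframeChange θ₀ θ O k μ)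
include K

lemma fderiv_prodMk {q : E4 × ℝ} (hq : q.1 ∈ O) :
    ContDiffAt ℝ ∞ (fun q : E4 × ℝ => (k q.1, μ q)) q ∧
    ∀ ξ, fderiv ℝ (fun q : E4 × ℝ => (k q.1, μ q)) q ξ = (fderiv ℝ k q.1 ξ.1, fderiv ℝ μ q ξ) := by
  have h1 : ContDiffAt ℝ ∞ k q.1 := K.smooth.contDiffAt (K.isOpen.mem_nhds hq)
  have h2 := K.smooth_param q hq
  refine ⟨(h1.comp q contDiffAt_fst).prodMk h2, fun ξ => ?_⟩
  have hd := (HasFDerivAt.comp (g := k) q (h1.differentiableAt (by simp)).hasFDerivAt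
    (hasFDerivAt_fst (𝕜 := ℝ))).prodMk (h2.differentiableAt (by simp)).hasFDerivAt
  exact congrArg (fun L : E4 × ℝ →L[ℝ] E4 × ℝ => L ξ) hd.fderiv

/-- The pullback of a twistor map under a change of the adapted coframe. -/
lemma isTwistorMap (hT : IsTwistorMap θ₀ Q₀ T₀) :
    IsTwistorMap θ {q | q.1 ∈ O ∧ (k q.1, μ q) ∈ Q₀} (fun q => T₀ (k q.1, μ q)) := by
  have hd {q : E4 × ℝ} (hq : q.1 ∈ O) (hq₀ : (k q.1, μ q) ∈ Q₀) (ξ : E4 × ℝ) :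
      fderiv ℝ (fun q : E4 × ℝ => T₀ (k q.1, μ q)) q ξ
        = fderiv ℝ T₀ (k q.1, μ q) (fderiv ℝ k q.1 ξ.1, fderiv ℝ μ q ξ) := by
    obtain ⟨h1, h2⟩ := K.fderiv_prodMk hq
    rw [← h2]
    exact congrArg (fun L : E4 × ℝ →L[ℝ] E3 => L ξ) (fderiv_comp q
      ((hT.contDiffAt hq₀).differentiableAt (by simp)) (h1.differentiableAt (by simp)))
  -- The change of the parameter can be adjusted along the fibre.
  have hadj {q : E4 × ℝ} (hq : q.1 ∈ O) (y : E4) (r : ℝ) :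
      ∃ t, fderiv ℝ μ q (y, t) = r := by
    refine ⟨(r - fderiv ℝ μ q (y, 0)) / fderiv ℝ μ q (0, 1), ?_⟩
    have e (t : ℝ) : ((y, t) : E4 × ℝ) = (y, 0) + t • (0, 1) := by simp
    rw [e, map_add, map_smul, smul_eq_mul, div_mul_cancel₀ _ (K.fibre q hq)]
    ring
  refine ⟨?_, ?_, ?_, ?_, ?_, ?_⟩
  · rw [isOpen_iff_mem_nhds]
    rintro q ⟨hq, hq₀⟩
    have h1 := continuousAt_fst.preimage_mem_nhds (K.isOpen.mem_nhds hq)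
    have h2 := (K.fderiv_prodMk hq).1.continuousAt.preimage_mem_nhds (hT.isOpen.mem_nhds hq₀)
    exact Filter.inter_mem h1 h2
  · rintro q ⟨hq, hq₀⟩
    exact ((hT.contDiffAt hq₀).comp q (K.fderiv_prodMk hq).1).contDiffWithinAt
  · rintro q ⟨hq, hq₀⟩ z
    obtain ⟨η, rfl⟩ := hT.surjective _ hq₀ z
    obtain ⟨y, hy⟩ := (K.bijective _ hq).2 η.1
    obtain ⟨t, ht⟩ := hadj hq y η.2
    exact ⟨(y, t), by rw [hd hq hq₀, ht, hy]⟩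
  · rintro q ⟨hq, hq₀⟩ ξ hξ
    rw [hd hq hq₀] at hξ
    exact (K.ruling q hq _).1 (hT.ruling _ hq₀ _ hξ)
  · rintro q ⟨hq, hq₀⟩ y hy
    obtain ⟨r, hr⟩ := hT.lift _ hq₀ _ ((K.ruling q hq y).2 hy)
    obtain ⟨t, ht⟩ := hadj hq y r
    exact ⟨t, by rw [hd hq hq₀, ht, hr]⟩
  · rintro q ⟨hq, hq₀⟩
    rw [hd hq hq₀]
    have : ((fderiv ℝ k q.1 ((0 : E4), (1 : ℝ)).1, fderiv ℝ μ q (0, 1)) : E4 × ℝ)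
        = fderiv ℝ μ q (0, 1) • (0, 1) := by simp
    rw [this, map_smul]
    exact smul_ne_zero (K.fibre q hq) (hT.fibre _ hq₀)

lemma rulingLift_eq (hc₀ : IsCoframe θ₀ N₀) (hn₀ : IsNullPatch θ₀ N₀ h₀ u₀ Ω₀)
    (hn : IsNullPatch θ N h u Ω) {s : E2} (hs₀ : s ∈ Ω₀) (hs : s ∈ Ω) (hsO : h s ∈ O)
    (hk : h₀ =ᶠ[𝓝 s] fun s => k (h s)) : rulingLift h₀ u₀ s = (k (h s), μ (rulingLift h u s)) := by
  have hd (w : E2) : fderiv ℝ h₀ s w = fderiv ℝ k (h s) (fderiv ℝ h s w) := by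
    rw [hk.fderiv_eq]
    exact congrArg (fun L : E2 →L[ℝ] E4 => L w) (fderiv_comp s
      ((K.smooth.contDiffAt (K.isOpen.mem_nhds hsO)).differentiableAt (by simp))
      ((hn.contDiffAt hs).differentiableAt (by simp)))
  refine Prod.ext hk.self_of_nhds ?_
  obtain ⟨w, -, hw⟩ := hn₀.exists_surfaceForm hc₀ hs₀ 0 1
  rw [surfaceForm_apply] at hw
  have h1 := (hn₀.inRulingPlane hs₀ w).2
  have h2 := ((K.ruling (rulingLift h u s) hsO (fderiv ℝ h s w)).2 (hn.inRulingPlane hs w)).2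
  have h3 : k (rulingLift h u s).1 = h₀ s := hk.self_of_nhds.symm
  rw [h3] at h2
  change (θ₀ (h₀ s)) (fderiv ℝ k (h s) (fderiv ℝ h s w)) 2
    + μ (rulingLift h u s) * (θ₀ (h₀ s)) (fderiv ℝ k (h s) (fderiv ℝ h s w)) 3 = 0 at h2
  rw [← hd, hw] at h2
  rw [hw] at h1
  simp only [rulingLift]
  simp only [rulingLift] at h2
  linarith

/-- The paths of a null surface in one coframe are determined by the twistor velocity in
another. -/
lemma isPathConnectionAt (H₀ : IsTwistorPatch θ₀ N₀ h₀ u₀ Ω₀ Q₀ T₀) (hc : IsCoframe θ N)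
    (hn : IsNullPatch θ N h u Ω) {s : E2} (hs₀ : s ∈ Ω₀) (hs : s ∈ Ω) (hsO : h s ∈ O)
    (hk : h₀ =ᶠ[𝓝 s] fun s => k (h s)) :
    IsPathLineTransversalAt θ h u s ∧
    ∀ G, IsInflectionalAt (twistorVelocity T₀ h₀ u₀) G s → IsPathConnectionAt θ h u s G := by
  have hev : ∀ᶠ s' in 𝓝 s, s' ∈ Ω₀ ∧ s' ∈ Ω ∧ h s' ∈ O ∧ h₀ =ᶠ[𝓝 s'] fun s => k (h s) := by
    filter_upwards [H₀.nullPatch.isOpen.mem_nhds hs₀, hn.isOpen.mem_nhds hs,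
      (hn.contDiffAt hs).continuousAt.preimage_mem_nhds (K.isOpen.mem_nhds hsO),
      hk.eventuallyEq_nhds] with s' h1 h2 h3 h4 using ⟨h1, h2, h3, h4⟩
  obtain ⟨V, hV, hVo, hsV⟩ := mem_nhds_iff.1 hev
  have hlift {s' : E2} (hs' : s' ∈ V) :
      rulingLift h₀ u₀ s' = (k (h s'), μ (rulingLift h u s')) :=
    K.rulingLift_eq H₀.coframe H₀.nullPatch hn (hV hs').1 (hV hs').2.1 (hV hs').2.2.1
      (hV hs').2.2.2
  have hnV : IsNullPatch θ N h u V :=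
    ⟨hVo, hn.smooth.mono fun s' hs' => (hV hs').2.1, fun s' hs' => hn.mapsTo (hV hs').2.1,
      fun s' hs' => hn.injective s' (hV hs').2.1,
      ⟨hn.ruling.1.mono fun s' hs' => (hV hs').2.1, fun s' hs' => hn.ruling.2 s' (hV hs').2.1⟩⟩
  have hT := K.isTwistorMap H₀.twistor
  have H : IsTwistorPatch θ N h u V _ _ := ⟨hc, hnV, hT, fun s' hs' => ⟨(hV hs').2.2.1, by
    have := H₀.mapsTo (hV hs').1
    rw [hlift hs'] at this
    exact this⟩⟩
  have hvel {s' : E2} (hs' : s' ∈ V) : twistorVelocity (fun q => T₀ (k q.1, μ q)) h u s'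
      = fderiv ℝ μ (rulingLift h u s') (0, 1) • twistorVelocity T₀ h₀ u₀ s' := by
    obtain ⟨h1, h2⟩ := K.fderiv_prodMk (q := rulingLift h u s') (hV hs').2.2.1
    have hm := H₀.mapsTo (hV hs').1
    rw [twistorVelocity, twistorVelocity, hlift hs']
    rw [hlift hs'] at hm
    rw [← map_smul]
    have := congrArg (fun L : E4 × ℝ →L[ℝ] E3 => L (0, 1)) (fderiv_comp (rulingLift h u s')
      (g := T₀) (f := fun q : E4 × ℝ => (k q.1, μ q))
      ((H₀.twistor.contDiffAt hm).differentiableAt (by simp)) (h1.differentiableAt (by simp)))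
    refine this.trans ?_
    rw [ContinuousLinearMap.comp_apply, h2]
    simp [rulingLift]
  have hmain (v : ℝ) := H.pathLine_main hsV v
  refine ⟨fun v => (hmain v).1, fun G hG v y hy1 hy3 => (hmain v).2 G ?_ y hy1 hy3⟩
  have hf : ContDiffAt ℝ ∞ (fun s => fderiv ℝ μ (rulingLift h u s) (0, 1)) s :=
    (((K.smooth_param (rulingLift h u s) hsO).fderiv_right (m := ∞) (by simp)).comp s
      (hn.contDiffAt_rulingLift hs)).clm_apply contDiffAt_const
  have hinf := hG.smul (H₀.contDiffAt_twistorVelocity hs₀) hf (K.fibre (rulingLift h u s) hsO)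
  have hev : twistorVelocity (fun q => T₀ (k q.1, μ q)) h u =ᶠ[𝓝 s]
      fun s => fderiv ℝ μ (rulingLift h u s) (0, 1) • twistorVelocity T₀ h₀ u₀ s := by
    filter_upwards [hVo.mem_nhds hsV] with s' hs' using hvel hs'
  intro w
  obtain ⟨c, c', hcc⟩ := hinf w
  refine ⟨c, c', ?_⟩
  rw [hev.fderiv.fderiv_eq, hev.fderiv_eq, hev.self_of_nhds]
  exact hcc

end IsCoframeChange

end ChangeOfCoframe

/-! ### From the manifold to coordinates -/

section Manifold

variable {M : Type u} [TopologicalSpace M] [ChartedSpace E4 M]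

lemma IsAdaptedCoframe.isCoframe {cone : (x : M) → Set (TangentSpace (𝓡 4) x)}
    {e : OpenPartialHomeomorph M E4} {θ : E4 → E4 →L[ℝ] (Fin 4 → ℝ)}
    (he : IsAdaptedCoframe cone e θ) : IsCoframe θ e.target :=
  ⟨e.open_target, he.2.1, he.2.2.1⟩

lemma mdifferentiable_of_mem_maximalAtlas {n : ℕ} {X : Type*} [TopologicalSpace X]
    [ChartedSpace (EuclideanSpace ℝ (Fin n)) X] [IsManifold (𝓡 n) ∞ X]
    {e : OpenPartialHomeomorph X (EuclideanSpace ℝ (Fin n))}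
    (he : e ∈ IsManifold.maximalAtlas (𝓡 n) ∞ X) : e.MDifferentiable (𝓡 n) (𝓡 n) :=
  ⟨(contMDiffOn_of_mem_maximalAtlas he).mdifferentiableOn (by simp),
    (contMDiffOn_symm_of_mem_maximalAtlas he).mdifferentiableOn (by simp)⟩

/-- In the coordinates `(t, s)` of a 3-parameter family, the projection to `t` is a twistor map. -/
lemma isTwistorMap_of_foliation {θ : E4 → E4 →L[ℝ] (Fin 4 → ℝ)} {N : Set E4}
    (hc : IsCoframe θ N) {Ψ : OpenPartialHomeomorph (E4 × ℝ) (E3 × E2)}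
    (hsub : Ψ.source ⊆ N ×ˢ univ) (hΨ : ContDiffOn ℝ ∞ Ψ Ψ.source)
    (hΨ' : ContDiffOn ℝ ∞ Ψ.symm Ψ.target)
    (hrul : ∀ t s, (t, s) ∈ Ψ.target → ∀ y : E4,
        y ∈ range (fderiv ℝ (fun s' => (Ψ.symm (t, s')).1) s) ↔
          InRulingPlane (Ψ.symm (t, s)).2 (θ (Ψ.symm (t, s)).1 y)) :
    IsTwistorMap θ Ψ.source (fun q => (Ψ q).1) := by
  have hd {q : E4 × ℝ} (hq : q ∈ Ψ.source) : DifferentiableAt ℝ Ψ q :=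
    (hΨ.contDiffAt (Ψ.open_source.mem_nhds hq)).differentiableAt (by simp)
  have hd' {q : E4 × ℝ} (hq : q ∈ Ψ.source) : DifferentiableAt ℝ Ψ.symm (Ψ q) :=
    (hΨ'.contDiffAt (Ψ.open_target.mem_nhds (Ψ.map_source hq))).differentiableAt (by simp)
  have hT {q : E4 × ℝ} (hq : q ∈ Ψ.source) (ξ : E4 × ℝ) :
      fderiv ℝ (fun q => (Ψ q).1) q ξ = (fderiv ℝ Ψ q ξ).1 := by
    exact congrArg (fun L : E4 × ℝ →L[ℝ] E3 => L ξ) (hd hq).hasFDerivAt.fst.fderiv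
  have hDR {q : E4 × ℝ} (hq : q ∈ Ψ.source) (z : E3 × E2) :
      fderiv ℝ Ψ q (fderiv ℝ Ψ.symm (Ψ q) z) = z := by
    have h1 : HasFDerivAt Ψ (fderiv ℝ Ψ q) (Ψ.symm (Ψ q)) := by
      rw [Ψ.left_inv hq]; exact (hd hq).hasFDerivAt
    have h2 := h1.comp (Ψ q) (hd' hq).hasFDerivAt
    have h3 : (Ψ ∘ Ψ.symm) =ᶠ[𝓝 (Ψ q)] id := by
      filter_upwards [Ψ.open_target.mem_nhds (Ψ.map_source hq)] with z hz using Ψ.right_inv hz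
    have := h2.unique ((hasFDerivAt_id (Ψ q)).congr_of_eventuallyEq h3)
    exact congrArg (fun L : E3 × E2 →L[ℝ] E3 × E2 => L z) this
  have hRD {q : E4 × ℝ} (hq : q ∈ Ψ.source) (ξ : E4 × ℝ) :
      fderiv ℝ Ψ.symm (Ψ q) (fderiv ℝ Ψ q ξ) = ξ := by
    have h2 := (hd' hq).hasFDerivAt.comp q (hd hq).hasFDerivAt
    have h3 : (Ψ.symm ∘ Ψ) =ᶠ[𝓝 q] id := by
      filter_upwards [Ψ.open_source.mem_nhds hq] with z hz using Ψ.left_inv hz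
    have := h2.unique ((hasFDerivAt_id q).congr_of_eventuallyEq h3)
    exact congrArg (fun L : E4 × ℝ →L[ℝ] E4 × ℝ => L ξ) this
  have hslice {q : E4 × ℝ} (hq : q ∈ Ψ.source) (w : E2) :
      fderiv ℝ (fun s' => (Ψ.symm ((Ψ q).1, s')).1) (Ψ q).2 w
        = (fderiv ℝ Ψ.symm (Ψ q) (0, w)).1 := by
    have h1 : HasFDerivAt (fun s' : E2 => ((Ψ q).1, s')) (ContinuousLinearMap.inr ℝ E3 E2)
      (Ψ q).2 := hasFDerivAt_prodMk_right _ _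
    have h2 : HasFDerivAt Ψ.symm (fderiv ℝ Ψ.symm (Ψ q)) ((Ψ q).1, (Ψ q).2) :=
      (hd' hq).hasFDerivAt
    have := (h2.comp (Ψ q).2 h1).fst.fderiv
    exact congrArg (fun L : E2 →L[ℝ] E4 => L w) this
  have hrul' {q : E4 × ℝ} (hq : q ∈ Ψ.source) (y : E4) :
      (∃ w, (fderiv ℝ Ψ.symm (Ψ q) (0, w)).1 = y) ↔ InRulingPlane q.2 (θ q.1 y) := by
    have := hrul (Ψ q).1 (Ψ q).2 (Ψ.map_source hq) y
    rw [Prod.mk.eta, Ψ.left_inv hq] at this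
    rw [← this, mem_range]
    simp only [hslice hq]
  refine ⟨Ψ.open_source, hΨ.fst, fun q hq z => ?_, fun q hq ξ hξ => ?_, fun q hq y hy => ?_,
    fun q hq h0 => ?_⟩
  · exact ⟨fderiv ℝ Ψ.symm (Ψ q) (z, 0), by rw [hT hq, hDR hq]⟩
  · rw [hT hq] at hξ
    refine (hrul' hq _).1 ⟨(fderiv ℝ Ψ q ξ).2, ?_⟩
    have : ((0 : E3), (fderiv ℝ Ψ q ξ).2) = fderiv ℝ Ψ q ξ := Prod.ext hξ.symm rfl
    rw [this, hRD hq]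
  · obtain ⟨w, rfl⟩ := (hrul' hq y).2 hy
    refine ⟨(fderiv ℝ Ψ.symm (Ψ q) (0, w)).2, ?_⟩
    rw [Prod.mk.eta, hT hq, hDR hq]
  · -- The projection of the tangent plane of the slice to the ruling plane is onto, hence injective.
    rw [hT hq] at h0
    have hqN : q.1 ∈ N := (hsub hq).1
    let R : E2 →ₗ[ℝ] ℝ × ℝ := (((LinearMap.proj 1).prod (LinearMap.proj 3)).comp
      (θ q.1).toLinearMap).comp ((LinearMap.fst ℝ E4 ℝ).comp
        ((fderiv ℝ Ψ.symm (Ψ q)).toLinearMap.comp (LinearMap.inr ℝ E3 E2)))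
    have hR (w : E2) : R w = (θ q.1 (fderiv ℝ Ψ.symm (Ψ q) (0, w)).1 1,
      θ q.1 (fderiv ℝ Ψ.symm (Ψ q) (0, w)).1 3) := rfl
    have hsurj : Function.Surjective R := by
      rintro ⟨r, t⟩
      obtain ⟨y, hy⟩ := (hc.bijective _ hqN).2 (r • singVector q.2 + t • nullVector q.2 0)
      obtain ⟨w, hw⟩ := (hrul' hq y).2 (by
        rw [hy]
        exact (inRulingPlane_singVector _).add_smul (inRulingPlane_nullVector _ _) r t)
      refine ⟨w, ?_⟩
      rw [hR, hw, hy]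
      simp [singVector, nullVector]
    have hinj := (LinearMap.injective_iff_surjective_of_finrank_eq_finrank (by simp)).2 hsurj
    have e1 : ((0 : E3), (fderiv ℝ Ψ q (0, 1)).2) = fderiv ℝ Ψ q (0, 1) := Prod.ext h0.symm rfl
    have e2 : R (fderiv ℝ Ψ q (0, 1)).2 = 0 := by
      rw [hR, e1, hRD hq]; simp
    have e3 := hinj (e2.trans (map_zero R).symm)
    have e4 := hRD hq (0, 1)
    rw [← e1, e3, Prod.mk_zero_zero, map_zero] at e4
    simpa using congrArg Prod.snd e4

section Patch

variable {S : Type u} [TopologicalSpace S] [ChartedSpace E2 S]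
  {C : CayleyStructure M} {f : S → M} {φ : OpenPartialHomeomorph S E2}
  {e : OpenPartialHomeomorph M E4} {θ : E4 → E4 →L[ℝ] (Fin 4 → ℝ)}

lemma isOpen_surfaceDomain (hf : ContMDiff (𝓡 2) (𝓡 4) ∞ f) : IsOpen (surfaceDomain f φ e) :=
  φ.symm.isOpen_inter_preimage (hf.continuous.isOpen_preimage _ e.open_source)

lemma contDiffOn_surfaceCoord (hf : ContMDiff (𝓡 2) (𝓡 4) ∞ f)
    (hφ : φ ∈ IsManifold.maximalAtlas (𝓡 2) ∞ S) (he : e ∈ IsManifold.maximalAtlas (𝓡 4) ∞ M) :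
    ContDiffOn ℝ ∞ (surfaceCoord f φ e) (surfaceDomain f φ e) := by
  rw [← contMDiffOn_iff_contDiffOn]
  refine (contMDiffOn_of_mem_maximalAtlas he).comp (hf.comp_contMDiffOn
    ((contMDiffOn_symm_of_mem_maximalAtlas hφ).mono fun s hs => hs.1)) fun s hs => hs.2

variable [IsManifold (𝓡 4) ∞ M] [IsManifold (𝓡 2) ∞ S]

lemma fderiv_surfaceCoord (hf : ContMDiff (𝓡 2) (𝓡 4) ∞ f)
    (hφ : φ ∈ IsManifold.maximalAtlas (𝓡 2) ∞ S) (he : e ∈ IsManifold.maximalAtlas (𝓡 4) ∞ M)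
    {s : E2} (hs : s ∈ surfaceDomain f φ e) (w : E2) :
    fderiv ℝ (surfaceCoord f φ e) s w = mfderiv (𝓡 4) (𝓡 4) e (f (φ.symm s))
      (mfderiv (𝓡 2) (𝓡 4) f (φ.symm s) (mfderiv (𝓡 2) (𝓡 2) φ.symm s w)) := by
  have h1 := (mdifferentiable_of_mem_maximalAtlas hφ).mdifferentiableAt_symm hs.1
  have h2 := hf.mdifferentiableAt (x := φ.symm s) (by simp)
  have h3 := (mdifferentiable_of_mem_maximalAtlas he).mdifferentiableAt hs.2
  have h4 : HasMFDerivAt (𝓡 2) (𝓡 4) (surfaceCoord f φ e) s _ :=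
    h3.hasMFDerivAt.comp s (h2.hasMFDerivAt.comp s h1.hasMFDerivAt)
  have key (D : E2 →L[ℝ] E4) (hD : HasFDerivAt (surfaceCoord f φ e) D s) :
      fderiv ℝ (surfaceCoord f φ e) s w = D w := by rw [hD.fderiv]
  exact key _ (hasMFDerivAt_iff_hasFDerivAt.1 h4)

/-- The tangent planes of a null surface are ruling planes in every adapted coframe. -/
lemma exists_ruling_param (hf : C.IsNullSurface f) (hφ : φ ∈ IsManifold.maximalAtlas (𝓡 2) ∞ S)
    (he : IsAdaptedCoframe C.cone e θ) {s : E2} (hs : s ∈ surfaceDomain f φ e) :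
    Function.Injective (fderiv ℝ (surfaceCoord f φ e) s) ∧
    ∃ r : ℝ, ∀ y : E4, y ∈ range (fderiv ℝ (surfaceCoord f φ e) s) ↔
      InRulingPlane r (θ (surfaceCoord f φ e s) y) := by
  have hd := fderiv_surfaceCoord hf.1 hφ he.1 hs
  obtain ⟨hinj, A, hA, r₀, hr₀⟩ := hf.2 (φ.symm s)
  have hφb := (mdifferentiable_of_mem_maximalAtlas hφ).symm.mfderiv_bijective
    (x := s) hs.1
  have heb := (mdifferentiable_of_mem_maximalAtlas he.1).mfderiv_bijective hs.2
  refine ⟨fun w w' hw => ?_, ?_⟩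
  · rw [hd, hd] at hw
    exact hφb.1 (hinj (heb.1 hw))
  have hcone := he.2.2.2 _ hs.2
  let D : TangentSpace (𝓡 4) (f (φ.symm s)) →L[ℝ] E4 := mfderiv (𝓡 4) (𝓡 4) e (f (φ.symm s))
  let B' : (Fin 4 → ℝ) →ₗ[ℝ] (Fin 4 → ℝ) := (θ (e (f (φ.symm s)))).toLinearMap.comp
    (D.toLinearMap.comp A.symm.toLinearEquiv.toLinearMap)
  have hB' (y : TangentSpace (𝓡 4) (f (φ.symm s))) : B' (A y) = θ (e (f (φ.symm s))) (D y) := by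
    change θ (e (f (φ.symm s))) (D (A.symm (A y))) = _
    rw [A.symm_apply_apply]
  have hbij : Function.Bijective B' :=
    (he.2.2.1 _ (e.map_source hs.2)).comp (heb.comp A.symm.bijective)
  obtain ⟨-, -, hmap⟩ := inRulingPlane_rulingMap (B := LinearEquiv.ofBijective B' hbij) (by
    intro z
    obtain ⟨y, rfl⟩ := A.surjective z
    change cayleyCubic (B' (A y)) = 0 ↔ _
    rw [hB']
    have h1 : y ∈ C.cone (f (φ.symm s)) ↔ cayleyCubic (A y) = 0 := by rw [hA]; rfl
    have h2 : y ∈ C.cone (f (φ.symm s)) ↔ cayleyCubic (θ (e (f (φ.symm s))) (D y)) = 0 := by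
      rw [hcone]; rfl
    exact h2.symm.trans h1)
  refine ⟨rulingMap B' r₀, fun y => ?_⟩
  obtain ⟨y, rfl⟩ := heb.2 y
  have h1 := hmap r₀ (A y)
  change InRulingPlane _ (B' (A y)) ↔ _ at h1
  rw [hB', ← hr₀] at h1
  refine Iff.trans ?_ h1.symm
  constructor
  · rintro ⟨w, hw⟩
    rw [hd] at hw
    exact ⟨_, heb.1 hw⟩
  · rintro ⟨z, hz⟩
    obtain ⟨w, hw⟩ := hφb.2 z
    exact ⟨w, (hd w).trans (congrArg (mfderiv (𝓡 4) (𝓡 4) e (f (φ.symm s)))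
      ((congrArg (mfderiv (𝓡 2) (𝓡 4) f (φ.symm s)) hw).trans hz))⟩

/-- The parameter of the tangent plane of a null surface is a smooth function. -/
lemma exists_isRulingParameter (hf : C.IsNullSurface f)
    (hφ : φ ∈ IsManifold.maximalAtlas (𝓡 2) ∞ S) (he : IsAdaptedCoframe C.cone e θ) :
    ∃ r : E2 → ℝ, IsRulingParameter θ (surfaceCoord f φ e) (surfaceDomain f φ e) r := by
  classical
  have hΩ : IsOpen (surfaceDomain f φ e) := isOpen_surfaceDomain hf.1
  have hh := contDiffOn_surfaceCoord hf.1 hφ he.1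
  have hex : ∀ s, ∃ r : ℝ, s ∈ surfaceDomain f φ e → ∀ y : E4,
      y ∈ range (fderiv ℝ (surfaceCoord f φ e) s) ↔
        InRulingPlane r (θ (surfaceCoord f φ e s) y) := fun s => by
    by_cases hs : s ∈ surfaceDomain f φ e
    · obtain ⟨r, hr⟩ := (exists_ruling_param hf hφ he hs).2
      exact ⟨r, fun _ => hr⟩
    · exact ⟨0, fun h => absurd h hs⟩
  choose r hr using hex
  refine ⟨r, fun s hs => ContDiffAt.contDiffWithinAt ?_, hr⟩
  set h := surfaceCoord f φ e
  -- Near `s` the parameter is the quotient of `-ω²` and `ω³` on a tangent vector.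
  obtain ⟨y, hy⟩ := (he.2.2.1 (h s) (e.map_source hs.2)).2 (nullVector (r s) 0)
  obtain ⟨w, hw⟩ := (hr s hs y).2 (by rw [hy]; exact inRulingPlane_nullVector _ _)
  have hω (i : Fin 4) : ContDiffAt ℝ ∞ (fun s => θ (h s) (fderiv ℝ h s w) i) s := by
    have h0 : ContDiffAt ℝ ∞ h s := hh.contDiffAt (hΩ.mem_nhds hs)
    have h1 : ContDiffAt ℝ ∞ (fun s => θ (h s)) s :=
      (he.isCoframe.contDiffAt (e.map_source hs.2)).comp s h0
    have h2 : ContDiffAt ℝ ∞ (fun s => θ (h s) (fderiv ℝ h s w)) s :=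
      h1.clm_apply ((h0.fderiv_right (m := ∞) (by simp)).clm_apply contDiffAt_const)
    exact contDiffAt_pi.1 h2 i
  have h3 : θ (h s) (fderiv ℝ h s w) 3 ≠ 0 := by rw [hw, hy]; simp [nullVector]
  refine (((hω 2).neg.div (hω 3) h3)).congr_of_eventuallyEq ?_
  filter_upwards [(hω 3).continuousAt.eventually_ne h3, hΩ.mem_nhds hs] with s' h3' hs'
  have := ((hr s' hs' (fderiv ℝ h s' w)).1 ⟨w, rfl⟩).2
  change r s' = -(θ (h s') (fderiv ℝ h s' w) 2) / θ (h s') (fderiv ℝ h s' w) 3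
  rw [eq_div_iff h3']
  linarith

lemma isNullPatch (hf : C.IsNullSurface f)
    (hφ : φ ∈ IsManifold.maximalAtlas (𝓡 2) ∞ S) (he : IsAdaptedCoframe C.cone e θ) {r : E2 → ℝ}
    (hr : IsRulingParameter θ (surfaceCoord f φ e) (surfaceDomain f φ e) r) :
    IsNullPatch θ e.target (surfaceCoord f φ e) r (surfaceDomain f φ e) :=
  ⟨isOpen_surfaceDomain hf.1, contDiffOn_surfaceCoord hf.1 hφ he.1,
    fun _ hs => e.map_source hs.2, fun _ hs => (exists_ruling_param hf hφ he hs).1, hr⟩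

end Patch

variable [IsManifold (𝓡 4) ∞ M]

/-- The transition map between the charts of two adapted coframes. -/
lemma exists_isCoframeChange_of_adapted {C : CayleyStructure M} {e₀ e : OpenPartialHomeomorph M E4}
    {θ₀ θ : E4 → E4 →L[ℝ] (Fin 4 → ℝ)} (he₀ : IsAdaptedCoframe C.cone e₀ θ₀)
    (he : IsAdaptedCoframe C.cone e θ) :
    ∃ μ, IsCoframeChange θ₀ θ (e.target ∩ e.symm ⁻¹' e₀.source) (e₀ ∘ e.symm) μ := by
  have hO : IsOpen (e.target ∩ e.symm ⁻¹' e₀.source) :=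
    e.symm.isOpen_inter_preimage e₀.open_source
  have hk : ContDiffOn ℝ ∞ (e₀ ∘ e.symm) (e.target ∩ e.symm ⁻¹' e₀.source) := by
    rw [← contMDiffOn_iff_contDiffOn]
    exact (contMDiffOn_of_mem_maximalAtlas he₀.1).comp
      ((contMDiffOn_symm_of_mem_maximalAtlas he.1).mono inter_subset_left) fun p hp => hp.2
  have hd {p : E4} (hp : p ∈ e.target ∩ e.symm ⁻¹' e₀.source)
      (y : TangentSpace (𝓡 4) (e.symm p)) :
      fderiv ℝ (e₀ ∘ e.symm) p (mfderiv (𝓡 4) (𝓡 4) e (e.symm p) y)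
        = mfderiv (𝓡 4) (𝓡 4) e₀ (e.symm p) y := by
    have h1 := ((mdifferentiable_of_mem_maximalAtlas he.1).mdifferentiableAt
      (e.map_target hp.1)).hasMFDerivAt
    have h2 : HasMFDerivAt (𝓡 4) (𝓡 4) (e₀ ∘ e.symm) (e (e.symm p))
        (fderiv ℝ (e₀ ∘ e.symm) p) := by
      rw [e.right_inv hp.1]
      exact ((hk.contDiffAt (hO.mem_nhds hp)).differentiableAt
        (by simp)).hasFDerivAt.hasMFDerivAt
    have h3 := h2.comp (e.symm p) h1
    have h4 : e₀ =ᶠ[𝓝 (e.symm p)] (e₀ ∘ e.symm) ∘ e := by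
      filter_upwards [e.open_source.mem_nhds (e.map_target hp.1)] with x hx
      simp [e.left_inv hx]
    have h5 := h3.congr_of_eventuallyEq h4
    rw [h5.mfderiv]; rfl
  refine exists_isCoframeChange he₀.isCoframe he.isCoframe hO inter_subset_left hk
    (fun p hp => e₀.map_source hp.2) (fun p hp => ?_) fun p hp y => ?_
  · have hb₀ := (mdifferentiable_of_mem_maximalAtlas he₀.1).mfderiv_bijective hp.2
    have hb := (mdifferentiable_of_mem_maximalAtlas he.1).mfderiv_bijective (e.map_target hp.1)
    constructor
    · intro y y' hyy
      obtain ⟨z, rfl⟩ := hb.2 y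
      obtain ⟨z', rfl⟩ := hb.2 y'
      erw [hd hp, hd hp] at hyy
      rw [hb₀.1 hyy]
    · intro y
      obtain ⟨z, rfl⟩ := hb₀.2 y
      exact ⟨_, hd hp z⟩
  · have hb := (mdifferentiable_of_mem_maximalAtlas he.1).mfderiv_bijective (e.map_target hp.1)
    obtain ⟨z, rfl⟩ := hb.2 y
    erw [hd hp]
    have h0 := he₀.2.2.2 _ hp.2
    have h1 := he.2.2.2 _ (e.map_target hp.1)
    rw [e.right_inv hp.1] at h1
    have := Set.ext_iff.1 (h0.symm.trans h1) z
    exact this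

end Manifold

/-! ### The projective structure of a member of a half-flat family -/

/-- Local smooth sections of a family of convex sets over an open set can be glued to a global
one. -/
lemma exists_contDiffOn_forall_mem_convex_of_local {E F : Type*} [NormedAddCommGroup E]
    [NormedSpace ℝ E] [FiniteDimensional ℝ E] [NormedAddCommGroup F] [NormedSpace ℝ F] {U : Set E}
    (hU : IsOpen U) {t : E → Set F} (ht : ∀ x, Convex ℝ (t x))
    (hloc : ∀ x ∈ U, ∃ V, IsOpen V ∧ x ∈ V ∧ ∃ g : E → F, ContDiffOn ℝ ∞ g V ∧ ∀ y ∈ V, g y ∈ t y) :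
    ∃ g : E → F, ContDiffOn ℝ ∞ g U ∧ ∀ x ∈ U, g x ∈ t x := by
  classical
  let X : TopologicalSpace.Opens E := ⟨U, hU⟩
  have : LocallyCompactSpace X := hU.locallyCompactSpace
  have : SecondCountableTopology E := secondCountable_of_proper
  obtain ⟨g, hg⟩ := exists_contMDiffMap_forall_mem_convex_of_local (n := ⊤) (M := X)
      (t := fun x : X => t x) 𝓘(ℝ, E) (fun x => ht x) (by
    intro x
    obtain ⟨V, hV, hxV, g, hg, hgt⟩ := hloc x x.2
    refine ⟨(Subtype.val : X → E) ⁻¹' V, continuous_subtype_val.continuousAt.preimage_mem_nhds (hV.mem_nhds hxV),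
      fun x => g x, fun y hy => ContMDiffAt.contMDiffWithinAt ?_, fun y hy => hgt y hy⟩
    rw [contMDiffAt_subtype_iff (f := g), contMDiffAt_iff_contDiffAt]
    exact hg.contDiffAt (hV.mem_nhds hy))
  let g' : E → F := fun x => if h : x ∈ U then g ⟨x, h⟩ else 0
  have hg' (x : X) : g' x = g x := dif_pos x.2
  refine ⟨g', fun x hx => ContDiffAt.contDiffWithinAt ?_, fun x hx => ?_⟩
  · rw [← contMDiffAt_iff_contDiffAt, ← contMDiffAt_subtype_iff (U := X) (x := ⟨x, hx⟩)]
    have : (fun x : X => g' x) = g := funext hg'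
    rw [this]
    exact g.contMDiff _
  · rw [hg' ⟨x, hx⟩]
    exact hg ⟨x, hx⟩

section HalfFlat

variable {M : Type u} [TopologicalSpace M] [ChartedSpace E4 M]
  {C : CayleyStructure M}

/-- The symmetric connections at `s` whose geodesics in nonsingular directions have characteristic
lifts, in all adapted coframes. -/
def pathConnections (F : C.HalfFlatFamily) (i : F.ι) (φ : OpenPartialHomeomorph (F.S i) E2)
    (s : E2) : Set (E2 →L[ℝ] E2 →L[ℝ] E2) :=
  {G | (∀ w w', G w w' = G w' w) ∧
    ∀ (e : OpenPartialHomeomorph M E4) (θ : E4 → E4 →L[ℝ] (Fin 4 → ℝ)),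
      IsAdaptedCoframe C.cone e θ → ∀ r : E2 → ℝ,
      IsRulingParameter θ (surfaceCoord (F.f i) φ e) (surfaceDomain (F.f i) φ e) r →
      s ∈ surfaceDomain (F.f i) φ e →
        IsPathConnectionAt θ (surfaceCoord (F.f i) φ e) r s G}

lemma convex_pathConnections (F : C.HalfFlatFamily) (i : F.ι)
    (φ : OpenPartialHomeomorph (F.S i) E2) (s : E2) : Convex ℝ (pathConnections F i φ s) := by
  intro G hG G' hG' a b ha hb hab
  refine ⟨fun w w' => ?_, fun e θ he r hr hs => ?_⟩
  · simp [hG.1 w w', hG'.1 w w']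
  · exact convex_isPathConnectionAt θ _ r s (hG.2 e θ he r hr hs) (hG'.2 e θ he r hr hs)
      ha hb hab

variable [IsManifold (𝓡 4) ∞ M]

/-- Near each point of a member of the family there are coordinates and a flat connection, with the
straight lines as geodesics, which induces the paths in all adapted coframes. -/
lemma exists_local_flat_connection (F : C.HalfFlatFamily) (i : F.ι)
    {φ : OpenPartialHomeomorph (F.S i) E2} (hφ : φ ∈ IsManifold.maximalAtlas (𝓡 2) ∞ (F.S i))
    {s₀ : E2} (hs₀ : s₀ ∈ φ.target) :
    ∃ (ψ : OpenPartialHomeomorph E2 E2) (Γ : E2 → E2 →L[ℝ] E2 →L[ℝ] E2),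
      s₀ ∈ ψ.source ∧ ψ.source ⊆ φ.target ∧ ContDiffOn ℝ ∞ ψ ψ.source ∧
      ContDiffOn ℝ ∞ ψ.symm ψ.target ∧ IsTorsionFreeConnection ψ.source Γ ∧
      ∀ s ∈ ψ.source, Function.Injective (fderiv ℝ ψ s) ∧
        (∀ w w', fderiv ℝ ψ s (Γ s w w') = fderiv ℝ (fderiv ℝ ψ) s w w') ∧
        ∀ (e : OpenPartialHomeomorph M E4) (θ : E4 → E4 →L[ℝ] (Fin 4 → ℝ)),
          IsAdaptedCoframe C.cone e θ → ∀ r : E2 → ℝ,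
          IsRulingParameter θ (surfaceCoord (F.f i) φ e) (surfaceDomain (F.f i) φ e) r →
          s ∈ surfaceDomain (F.f i) φ e →
            IsPathLineTransversalAt θ (surfaceCoord (F.f i) φ e) r s ∧
            IsPathConnectionAt θ (surfaceCoord (F.f i) φ e) r s (Γ s) := by
  have hf := F.isNullSurface i
  obtain ⟨e₀, θ₀, he₀, hx⟩ := C.exists_adapted (F.f i (φ.symm s₀))
  have hsΩ : s₀ ∈ surfaceDomain (F.f i) φ e₀ := ⟨hs₀, hx⟩
  obtain ⟨r₀, hr₀⟩ := exists_isRulingParameter hf hφ he₀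
  have hn₀ := isNullPatch hf hφ he₀ hr₀
  set h₀ := surfaceCoord (F.f i) φ e₀ with hh₀
  obtain ⟨Ψ, hΨs, hsub, hΨ, hΨ', hrul, -⟩ := F.threeParameter e₀ θ₀ he₀ (h₀ s₀)
    (hn₀.mapsTo hsΩ) (r₀ s₀)
  have hT := isTwistorMap_of_foliation he₀.isCoframe hsub hΨ hΨ' hrul
  have hlift : ContinuousOn (rulingLift h₀ r₀) (surfaceDomain (F.f i) φ e₀) := fun s hs =>
    (hn₀.contDiffAt_rulingLift hs).continuousAt.continuousWithinAt
  have hΩo := hlift.isOpen_inter_preimage hn₀.isOpen Ψ.open_source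
  set Ω := surfaceDomain (F.f i) φ e₀ ∩ rulingLift h₀ r₀ ⁻¹' Ψ.source with hΩ
  have H : IsTwistorPatch θ₀ e₀.target h₀ r₀ Ω Ψ.source (fun q => (Ψ q).1) :=
    ⟨he₀.isCoframe, ⟨hΩo, hn₀.smooth.mono inter_subset_left,
      hn₀.mapsTo.mono_left inter_subset_left, fun s hs => hn₀.injective s hs.1,
      ⟨hn₀.ruling.1.mono inter_subset_left, fun s hs => hn₀.ruling.2 s hs.1⟩⟩, hT,
      fun s hs => hs.2⟩
  obtain ⟨ψ, Γ, hψ1, hψ2, hψ3, hψ4, hΓ, hψΓ⟩ := exists_projective_chart hΩo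
    (fun s hs => H.contDiffAt_twistorVelocity hs)
    (fun s hs c w => H.twistorVelocity_independent hs c w) (s₀ := s₀) ⟨hsΩ, hΨs⟩
  refine ⟨ψ, Γ, hψ1, fun s hs => (hψ2 hs).1.1, hψ3, hψ4, hΓ, fun s hs =>
    ⟨(hψΓ s hs).1, (hψΓ s hs).2.1, fun e θ he r hr hse => ?_⟩⟩
  obtain ⟨μ, K⟩ := exists_isCoframeChange_of_adapted he₀ he
  have hn := isNullPatch hf hφ he hr
  have hes {s : E2} (hs : s ∈ surfaceDomain (F.f i) φ e) :
      e.symm (surfaceCoord (F.f i) φ e s) = F.f i (φ.symm s) := e.left_inv hs.2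
  have hk : h₀ =ᶠ[𝓝 s] fun s => (e₀ ∘ e.symm) (surfaceCoord (F.f i) φ e s) := by
    filter_upwards [hn.isOpen.mem_nhds hse] with s' hs'
    simp only [Function.comp_apply, hes hs']
    rfl
  obtain ⟨h1, h2⟩ := K.isPathConnectionAt H he.isCoframe hn (hψ2 hs) hse
    ⟨e.map_source hse.2, by rw [mem_preimage, hes hse]; exact (hψ2 hs).1.2⟩ hk
  exact ⟨h1, h2 _ (hψΓ s hs).2.2⟩

set_option maxHeartbeats 1000000 in
/-- The connections of the local charts can be glued, since being symmetric and inducing the paths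
are convex conditions. -/
lemma exists_global_connection (F : C.HalfFlatFamily) (i : F.ι)
    {φ : OpenPartialHomeomorph (F.S i) E2} (hφ : φ ∈ IsManifold.maximalAtlas (𝓡 2) ∞ (F.S i)) :
    ∃ Γ : E2 → E2 →L[ℝ] E2 →L[ℝ] E2, IsTorsionFreeConnection φ.target Γ ∧
      ∀ s ∈ φ.target, ∀ (e : OpenPartialHomeomorph M E4) (θ : E4 → E4 →L[ℝ] (Fin 4 → ℝ)),
        IsAdaptedCoframe C.cone e θ → ∀ r : E2 → ℝ,
        IsRulingParameter θ (surfaceCoord (F.f i) φ e) (surfaceDomain (F.f i) φ e) r →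
        s ∈ surfaceDomain (F.f i) φ e →
          IsPathConnectionAt θ (surfaceCoord (F.f i) φ e) r s (Γ s) := by
  have hloc : ∀ x ∈ φ.target, ∃ V, IsOpen V ∧ x ∈ V ∧ ∃ g : E2 → E2 →L[ℝ] E2 →L[ℝ] E2,
      ContDiffOn ℝ ∞ g V ∧ ∀ y ∈ V, g y ∈ pathConnections F i φ y := by
    intro s₀ hs₀
    obtain ⟨ψ, Γ, hψ1, -, -, -, hΓ, hψΓ⟩ := exists_local_flat_connection F i hφ hs₀
    exact ⟨ψ.source, ψ.open_source, hψ1, Γ, hΓ.1, fun s hs =>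
      ⟨hΓ.2 s hs, fun e θ he r hr hse => ((hψΓ s hs).2.2 e θ he r hr hse).2⟩⟩
  obtain ⟨Γ, hΓ, hΓt⟩ := exists_contDiffOn_forall_mem_convex_of_local (E := E2)
    (F := E2 →L[ℝ] E2 →L[ℝ] E2) (U := φ.target) (t := pathConnections F i φ) φ.open_target
    (convex_pathConnections F i φ) hloc
  exact ⟨Γ, ⟨hΓ, fun s hs => (hΓt s hs).1⟩, fun s hs => (hΓt s hs).2⟩

end HalfFlat

theorem proposition5p2 {M : Type u} [TopologicalSpace M] [ChartedSpace E4 M]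
    [IsManifold (𝓡 4) ∞ M] (C : CayleyStructure M) (F : C.HalfFlatFamily) (i : F.ι)
    (φ : OpenPartialHomeomorph (F.S i) E2)
    (hφ : φ ∈ IsManifold.maximalAtlas (𝓡 2) ∞ (F.S i)) :
    ∃ Γ : E2 → E2 →L[ℝ] E2 →L[ℝ] E2,
      IsTorsionFreeConnection φ.target Γ ∧
      IsProjectivelyFlat φ.target Γ ∧
      ∀ (e : OpenPartialHomeomorph M E4) (θ : E4 → E4 →L[ℝ] (Fin 4 → ℝ)),
        IsAdaptedCoframe C.cone e θ →
        ∃ u : E2 → ℝ,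
          IsRulingParameter θ (surfaceCoord (F.f i) φ e) (surfaceDomain (F.f i) φ e) u ∧
          IsPathGeometry (surfaceDomain (F.f i) φ e ×ˢ univ)
            (pathLine θ (surfaceCoord (F.f i) φ e) u) fibreLine ∧
          ∀ (I : Set ℝ) (c : ℝ → E2), IsRegularCurve (surfaceDomain (F.f i) φ e) I c →
            (IsPath θ (surfaceCoord (F.f i) φ e) u I c ↔
              IsUnparamGeodesic Γ I c ∧
                IsNowhereSingular θ (surfaceCoord (F.f i) φ e) I c) := by
  obtain ⟨Γ, hΓ, hpath⟩ := exists_global_connection F i hφ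
  refine ⟨Γ, hΓ, fun s₀ hs₀ => ?_, fun e θ he => ?_⟩
  · obtain ⟨ψ, Γ', hψ1, hψ2, hψ3, hψ4, hΓ', hψΓ⟩ := exists_local_flat_connection F i hφ hs₀
    refine ⟨ψ, hψ1, hψ2, hψ3, hψ4, fun I c hreg => isUnparamGeodesic_iff_comp hψ3
      (fun s hs => (hψΓ s hs).1) (fun s hs w => (hψΓ s hs).2.1 w w) (fun s hs w => ?_) hreg⟩
    obtain ⟨e, θ, he, hx⟩ := C.exists_adapted (F.f i (φ.symm s))
    have hse : s ∈ surfaceDomain (F.f i) φ e := ⟨hψ2 hs, hx⟩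
    obtain ⟨r, hr⟩ := exists_isRulingParameter (F.isNullSurface i) hφ he
    obtain ⟨hl, hG'⟩ := (hψΓ s hs).2.2 e θ he r hr hse
    exact (hpath s (hψ2 hs) e θ he r hr hse).exists_smul_add he.isCoframe
      (isNullPatch (F.isNullSurface i) hφ he hr) hse hl hG' w
  · obtain ⟨r, hr⟩ := exists_isRulingParameter (F.isNullSurface i) hφ he
    have hn := isNullPatch (F.isNullSurface i) hφ he hr
    have hl (s : E2) (hs : s ∈ surfaceDomain (F.f i) φ e) :
        IsPathLineTransversalAt θ (surfaceCoord (F.f i) φ e) r s := by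
      obtain ⟨ψ, Γ', hψ1, -, -, -, -, hψΓ⟩ := exists_local_flat_connection F i hφ hs.1
      exact ((hψΓ s hψ1).2.2 e θ he r hr hs).1
    have hG (s : E2) (hs : s ∈ surfaceDomain (F.f i) φ e) := hpath s hs.1 e θ he r hr hs
    exact ⟨r, hr, isPathGeometry_pathLine he.isCoframe hn hl hG
      (hΓ.1.mono fun s hs => hs.1), fun I c hreg => isPath_iff he.isCoframe hn hl hG hreg⟩
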